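/- **Setting (indices).** Let $K$ be a non-empty poset with order $\subseteq$, with a relation $\subset$ such that $a\subset o$ implies $a\subseteq o$ and $a\neq o$, with a symmetric irreflexive relation $\perp$, and with an action of a group $\mathcal P$. Put $o^\perp=\{a\in K: a\perp o\}$. A $1$-simplex $b$ is a triple $\partial_0b,\partial_1b\subseteq|b|$ of elements of $K$; a $2$-simplex $c$ consists of $1$-simplices $\partial_0c,\partial_1c,\partial_2c$ and an element $|c|\in K$ with $|\partial_ic|\subseteq|c|$, $\partial_0\partial_0c=\partial_0\partial_1c$, $\partial_1\partial_0c=\partial_0\partial_2c$, $\partial_1\partial_1c=\partial_1\partial_2c$; $\Sigma_n(K)$ is the set of $n$-simplices ($\Sigma_0(K)=K$). A path $p=b_n*\cdots*b_1:a\to o$ ($n\ge1$) satisfies $\partial_1b_1=a$, $\partial_0b_{i-1}=\partial_1b_i$, $\partial_0b_n=o$. Homotopy of paths is generated by replacing some $\partial_1c$ in a path by $\partial_0c*\partial_2c$, $c\in\Sigma_2(K)$. Assume: for every $o$ there are $\hat o\subset o\subset\tilde o$; $o\perp a$ and $\hat o\subseteq o$ imply $\hat o\perp a$; $\{s: s\perp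 a\ \forall a\in o^\perp\}=\{a:a\subseteq o\}$; if $o\perp a$ then $o^\perp\cap a^\perp\ne\emptyset$, and otherwise there is $\tilde o\subset o$ with $\tilde o^\perp\cap a^\perp\neq\emptyset$; the action of $\mathcal P$ preserves $\subset$ and $\perp$; $K$ and every $o^\perp$ are pathwise connected (any two elements are joined by a path inside the set); every closed path $a\to a$ is homotopic to the constant path $(a,a;a)$. **Setting (net).** Let $\mathcal H$ be a complex Hilbert space, $o\mapsto\mathcal A(o)\subseteq\mathcal B(\mathcal H)$ a map from $K$ to von Neumann algebras, $\mathcal A(K)$ the $C^*$-algebra generated by all $\mathcal A(o)$, and $U:\mathcal P\to\mathcal U(\mathcal H)$ a unitary representation, $\alpha_\lambda=\mathrm{ad}_{U(\lambda)}$. Assume: $\mathcal A(o)\subseteq\mathcal A(a)$ if $o\subseteq a$; $\mathcal A(o)$ and $\mathcal A(a)$ commute if $o\perp a$; $\alpha_\lambda(\mathcal A(o))=\mathcal A(\lambda o)$; $\mathcal A(K)'\cap\mathcal A(K)''=\mathbb C1$; if $o\subset a$ and $E\in\mathcal A(o)$ is a nonzero projection, then $E=VV^*$ for an isometry $V\in\mathcal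 A(a)$; and $\mathcal A(o)=\mathcal A(K)''\cap\bigcap_{a\perp o}\mathcal A(a)'$ for all $o$. **Covariant 1-cocycles.** A covariant $1$-cocycle $X$ is a field of unitaries $X_b(\lambda)\in\mathcal A(|b|)$, $b\in\Sigma_1(K)$, $\lambda\in\mathcal P$, such that $X_{\partial_1c}(\sigma\lambda)=\alpha_\lambda^{-1}(X_{\lambda\partial_0c}(\sigma))X_{\partial_2c}(\lambda)$ for all $c\in\Sigma_2(K)$ and $\sigma,\lambda\in\mathcal P$. An intertwiner $t\in(X,Y)$ is a field $t_a\in\mathcal A(a)$, $a\in K$, with $\alpha_\lambda^{-1}(t_{\lambda\partial_0b})X_b(\lambda)=Y_b(\lambda)t_{\partial_1b}$ for all $b,\lambda$; composition, adjoint and linear structure are pointwise, $(1_X)_a=1$, and an element of $(X,X)$ is positive if it equals $s^*\cdot s$ for some $s\in(X,X)$. Write $X_b=X_b(e)$ and $X_p=X_{b_n}\cdots X_{b_1}$; this depends only on the endpoints of $p$. For $A\in\mathcal A(a)$ let $\rho^X(o)_a(A)=X_pAX_p^*$, where $p:\tilde a\to o$ and $\tilde a\perp a$ (independent of the choices). Define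 $I_b(\lambda)=1$, $(X\otimes Y)_b(\lambda)=X_b(\lambda)\,\rho^X(\partial_1b)_{|b|}(Y_b(\lambda))$, and $(t\otimes s)_a=t_a\,\rho^X(a)_a(s_a)$ for $t\in(X,Y)$, $s\in(Z,L)$. For paths $p=b_n*\cdots*b_1$, $q=d_n*\cdots*d_1$ of equal length let $(X\times Y)_{p,q}=(X\times Y)_{b_n,d_n}\cdots(X\times Y)_{b_1,d_1}$, where $(X\times Y)_{b,d}=X_b\,\rho^X(\partial_1b)_{|d|}(Y_d)$. The symmetry $\epsilon(X,Y)\in(X\otimes Y,Y\otimes X)$ is $\epsilon(X,Y)_a=(Y\times X)_{q,p}^*(X\times Y)_{p,q}$ for any two paths $p:a\to o_1$, $q:a\to o_2$ of equal length with $o_1\perp o_2$ (independent of the choice). **Finite statistics.** A left inverse of $X$ is a family of linear maps $\phi_{Z,Y}:(X\otimes Z,X\otimes Y)\to(Z,Y)$, indexed by covariant $1$-cocycles $Z,Y$, such that $\phi_{Z\otimes W,Y\otimes W}(t\otimes1_W)=\phi_{Z,Y}(t)\otimes1_W$ and $\phi_{Z',Y'}((1_X\otimes s)\cdot t\cdot(1_X\otimes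 r))=s\cdot\phi_{Z,Y}(t)\cdot r$ for $t\in(X\otimes Z,X\otimes Y)$, $s\in(Y,Y')$, $r\in(Z',Z)$. It is standard if every $\phi_{Y,Y}$ maps positive elements to positive elements, $\phi_{I,I}(1_X)=1_I$, and $(\phi_{X,X}(\epsilon(X,X)))^2=c\cdot1_X$ for some $c>0$. $X$ has finite statistics if it admits a standard left inverse; $Z^1_{c,f}(\mathcal A_K)$ is the full subcategory of such covariant $1$-cocycles. **Theorem.** The category $Z^1_{c,f}(\mathcal A_K)$ has conjugates: for every covariant $1$-cocycle $X$ with finite statistics there are a covariant $1$-cocycle $\bar X$ with finite statistics and intertwiners $r\in(I,\bar X\otimes X)$, $\bar r\in(I,X\otimes\bar X)$ such that $$(\bar r^*\otimes1_X)\cdot(1_X\otimes r)=1_X,\qquad(r^*\otimes1_{\bar X})\cdot(1_{\bar X}\otimes\bar r)=1_{\bar X}.$$ -/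

import Mathlib

namespace CovariantSectors

section Simplices

variable {K : Type*} [PartialOrder K]

/-- A singular `1`-simplex of a poset: faces `∂₀b`, `∂₁b` and a support `|b|` containing both.
It is thought of as going from `∂₁b` to `∂₀b`. -/
@[ext]
structure Simplex1 (K : Type*) [PartialOrder K] where
  d0 : K
  d1 : K
  supp : K
  d0_le : d0 ≤ supp
  d1_le : d1 ≤ supp

/-- A singular `2`-simplex of a poset: three `1`-simplices `∂₀c, ∂₁c, ∂₂c` satisfying the simplicial
identities `∂₀₀ = ∂₀₁`, `∂₁₀ = ∂₀₂`, `∂₁₁ = ∂₁₂`, and a support containing their supports. -/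
structure Simplex2 (K : Type*) [PartialOrder K] where
  d0 : Simplex1 K
  d1 : Simplex1 K
  d2 : Simplex1 K
  supp : K
  d0_supp_le : d0.supp ≤ supp
  d1_supp_le : d1.supp ≤ supp
  d2_supp_le : d2.supp ≤ supp
  d00_eq : d0.d0 = d1.d0
  d10_eq : d0.d1 = d2.d0
  d11_eq : d1.d1 = d2.d1

/-- The degenerate `1`-simplex `σ₀(o) = (o, o; o)`. -/
def Simplex1.degen (o : K) : Simplex1 K := ⟨o, o, o, le_rfl, le_rfl⟩

/-- `IsPath a o l`: the list `l = [bₙ, …, b₁]` (with `n ≥ 1`) is a path `bₙ * ⋯ * b₁ : a → o`, i.e.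
`∂₁b₁ = a`, `∂₀bₙ = o` and `∂₀bᵢ₋₁ = ∂₁bᵢ`. -/
inductive IsPath : K → K → List (Simplex1 K) → Prop
  | single (b : Simplex1 K) : IsPath b.d1 b.d0 [b]
  | cons (b : Simplex1 K) {a : K} {l : List (Simplex1 K)} (h : IsPath a b.d1 l) :
      IsPath a b.d0 (b :: l)

/-- `S ⊆ K` is pathwise connected: any two of its elements are joined by a path in `S`. -/
def PathwiseConnected (S : Set K) : Prop :=
  ∀ a ∈ S, ∀ o ∈ S, ∃ l, IsPath a o l ∧ ∀ b ∈ l, b.supp ∈ S ∧ b.d0 ∈ S ∧ b.d1 ∈ S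

/-- Elementary deformation: replace the `1`-simplex `∂₁c` in a path by `∂₀c * ∂₂c`. -/
inductive ElemDeformation : List (Simplex1 K) → List (Simplex1 K) → Prop
  | mk (l₁ l₂ : List (Simplex1 K)) (c : Simplex2 K) :
      ElemDeformation (l₁ ++ c.d1 :: l₂) (l₁ ++ c.d0 :: c.d2 :: l₂)

/-- Homotopy of paths: the equivalence relation generated by elementary deformations. -/
def Homotopic : List (Simplex1 K) → List (Simplex1 K) → Prop :=
  Relation.EqvGen ElemDeformation

/-- Every closed path is homotopic to the constant path (`π₁(K) = 1`). -/
def SimplyConnected (K : Type*) [PartialOrder K] : Prop :=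
  ∀ (a : K) (l : List (Simplex1 K)), IsPath a a l → Homotopic l [Simplex1.degen a]

theorem IsPath.append {a o s : K} {l m : List (Simplex1 K)} (h : IsPath a o l)
    (h' : IsPath o s m) : IsPath a s (m ++ l) := by
  induction h' with
  | single b => exact IsPath.cons b h
  | cons b _ ih => exact IsPath.cons b (ih h)

theorem IsPath.replicate_degen (a : K) (n : ℕ) :
    IsPath a a (List.replicate (n + 1) (Simplex1.degen a)) := by
  induction n with
  | zero => exact IsPath.single (Simplex1.degen a)
  | succ n ih => exact IsPath.cons (Simplex1.degen a) ih

theorem IsPath.length_pos {a o : K} {l : List (Simplex1 K)} (h : IsPath a o l) :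
    0 < l.length := by
  cases h <;> simp

end Simplices

/-- A set of indices `K` for localization regions, with symmetry group `P`. The relation `sub a o`
is the proper inclusion `a ⊂ o` (any relation implying `a ⊆ o` and `a ≠ o`), and `perp` is the causal
disjointness relation. -/
structure IndexSet (K P : Type*) [PartialOrder K] [Group P] [MulAction P K] where
  sub : K → K → Prop
  perp : K → K → Prop
  lt_of_sub : ∀ a o, sub a o → a < o
  perp_symm : ∀ a o, perp a o → perp o a
  perp_irrefl : ∀ o, ¬ perp o o
  /-- every region properly contains, and is properly contained in, another region -/
  exists_sub : ∀ o, (∃ a, sub a o) ∧ ∃ a, sub o a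
  /-- compatibility of causal disjointness with the order -/
  perp_of_le : ∀ o a o', perp o a → o' ≤ o → perp o' a
  /-- causal completeness: `o^⊥⊥ = {a | a ⊆ o}` -/
  causally_complete : ∀ o, {s | ∀ a, perp a o → perp s a} = {a | a ≤ o}
  exists_perp_of_perp : ∀ o a, perp o a → ∃ s, perp s o ∧ perp s a
  exists_perp_of_not_perp : ∀ o a, ¬ perp o a → ∃ o', sub o' o ∧ ∃ s, perp s o' ∧ perp s a
  /-- compatibility of the symmetry with proper inclusion and causal disjointness -/
  smul_sub : ∀ (g : P) (a o : K), sub a o → sub (g • a) (g • o)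
  smul_perp : ∀ (g : P) (a o : K), perp a o → perp (g • a) (g • o)
  connected : PathwiseConnected (Set.univ : Set K)
  connected_compl : ∀ o, PathwiseConnected {a | perp a o}
  simplyConnected : SimplyConnected K

namespace IndexSet

variable {K P : Type*} [PartialOrder K] [Group P] [MulAction P K]

theorem smul_le (S : IndexSet K P) (g : P) {a o : K} (h : a ≤ o) : g • a ≤ g • o := by
  have key : ∀ o a : K, (∀ s, S.perp s o → S.perp a s) ↔ a ≤ o := fun o a =>
    Set.ext_iff.1 (S.causally_complete o) a
  refine (key _ _).1 fun s hs => ?_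
  have h1 := S.smul_perp g⁻¹ _ _ hs
  rw [inv_smul_smul] at h1
  have h2 := S.smul_perp g _ _ ((key _ _).2 h _ h1)
  rwa [smul_inv_smul] at h2

theorem exists_perp (S : IndexSet K P) (a : K) : ∃ s, S.perp s a := by
  obtain ⟨o, ho⟩ := (S.exists_sub a).2
  by_contra! hcon
  have h : o ∈ {s | ∀ b, S.perp b a → S.perp s b} := fun b hb => absurd hb (hcon b)
  rw [S.causally_complete a] at h
  exact absurd (S.lt_of_sub _ _ ho) (not_lt_of_ge h)

/-- The action of the symmetry on `1`-simplices. -/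
def act (S : IndexSet K P) (g : P) (b : Simplex1 K) : Simplex1 K :=
  ⟨g • b.d0, g • b.d1, g • b.supp, S.smul_le g b.d0_le, S.smul_le g b.d1_le⟩

theorem act_one (S : IndexSet K P) (b : Simplex1 K) : S.act 1 b = b := by
  ext <;> simp [act]

theorem act_path (S : IndexSet K P) (g : P) {a o : K} {l : List (Simplex1 K)} (h : IsPath a o l) :
    IsPath (g • a) (g • o) (l.map (S.act g)) := by
  induction h with
  | single b => exact IsPath.single (S.act g b)
  | cons b _ ih => exact IsPath.cons (S.act g b) ih

theorem exists_path (S : IndexSet K P) (o a : K) : ∃ l, IsPath a o l := by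
  obtain ⟨l, hl, -⟩ := S.connected a trivial o trivial
  exact ⟨l, hl⟩

/-- Some region causally disjoint from `a`. -/
noncomputable def disj (S : IndexSet K P) (a : K) : K := (S.exists_perp a).choose

theorem disj_perp (S : IndexSet K P) (a : K) : S.perp (S.disj a) a := (S.exists_perp a).choose_spec

/-- Some path `a → o`. -/
noncomputable def path (S : IndexSet K P) (o a : K) : List (Simplex1 K) := (S.exists_path o a).choose

theorem path_isPath (S : IndexSet K P) (o a : K) : IsPath a o (S.path o a) := (S.exists_path o a).choose_spec

/-- Multiplicative functions of `1`-simplices are independent of the path. -/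
theorem prod_eq_of_isPath (S : IndexSet K P) {G : Type*} [Group G] (f : Simplex1 K → G)
    (hf : ∀ c : Simplex2 K, f c.d1 = f c.d0 * f c.d2) {a o : K} {l m : List (Simplex1 K)}
    (hl : IsPath a o l) (hm : IsPath a o m) : (l.map f).prod = (m.map f).prod := by
  have hom : ∀ l m : List (Simplex1 K), Homotopic l m → (l.map f).prod = (m.map f).prod := by
    intro l m h
    induction h with
    | rel _ _ h => cases h with | mk l₁ l₂ c => simp [hf c, mul_assoc]
    | refl _ => rfl
    | symm _ _ _ ih => exact ih.symm
    | trans _ _ _ _ _ ih1 ih2 => exact ih1.trans ih2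
  have hdeg : ∀ a : K, f (Simplex1.degen a) = 1 := by
    intro a
    have := hf ⟨Simplex1.degen a, Simplex1.degen a, Simplex1.degen a, a, le_rfl, le_rfl, le_rfl,
      rfl, rfl, rfl⟩
    simpa using this
  have loop : ∀ (a : K) (l : List (Simplex1 K)), IsPath a a l → (l.map f).prod = 1 := by
    intro a l h
    rw [hom _ _ (S.simplyConnected a l h)]
    simp [hdeg]
  obtain ⟨r, hr⟩ := S.exists_path a o
  have h1 := loop _ _ (hl.append hr)
  have h2 := loop _ _ (hm.append hr)
  rw [List.map_append, List.prod_append] at h1 h2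
  exact mul_left_cancel (h1.trans h2.symm)

end IndexSet

section Net

variable {K P : Type*} [PartialOrder K] [Group P] [MulAction P K]
variable {H : Type*} [NormedAddCommGroup H] [InnerProductSpace ℂ H] [CompleteSpace H]

/-- The `C*`-algebra generated by a family of von Neumann algebras. -/
noncomputable def globalAlgebra (alg : K → VonNeumannAlgebra H) : StarSubalgebra ℂ (H →L[ℂ] H) :=
  (StarAlgebra.adjoin ℂ (⋃ o, (alg o : Set (H →L[ℂ] H)))).topologicalClosure

/-- The bicommutant of the generated `C*`-algebra. -/
def globalBicommutant (alg : K → VonNeumannAlgebra H) : Set (H →L[ℂ] H) :=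
  Set.centralizer (Set.centralizer (globalAlgebra alg : Set (H →L[ℂ] H)))

/-- An observable net over a set of indices: isotonous, causal and covariant, with factorial global
algebra, the Borchers property and relative Haag duality. -/
structure ObservableNet (S : IndexSet K P) (H : Type*) [NormedAddCommGroup H]
    [InnerProductSpace ℂ H] [CompleteSpace H] where
  alg : K → VonNeumannAlgebra H
  U : P →* unitary (H →L[ℂ] H)
  isotony : ∀ o a, o ≤ a → (alg o : Set (H →L[ℂ] H)) ⊆ alg a
  causality : ∀ o a, S.perp o a → ∀ A ∈ alg o, ∀ B ∈ alg a, A * B = B * A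
  covariance : ∀ (g : P) (o : K) (A : H →L[ℂ] H),
    A ∈ alg o ↔ (U g : H →L[ℂ] H) * A * star (U g : H →L[ℂ] H) ∈ alg (g • o)
  factoriality : Set.centralizer (globalAlgebra alg : Set (H →L[ℂ] H)) ∩ globalBicommutant alg =
    Set.range fun z : ℂ => z • (1 : H →L[ℂ] H)
  borchers : ∀ o a, S.sub o a → ∀ E ∈ alg o, IsStarProjection E → E ≠ 0 →
    ∃ V ∈ alg a, star V * V = 1 ∧ V * star V = E
  duality : ∀ o, (alg o : Set (H →L[ℂ] H)) =
    globalBicommutant alg ∩ {A | ∀ a, S.perp a o → A ∈ (alg a).commutant}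

variable {S : IndexSet K P}

namespace ObservableNet

/-- The action `α_g = ad U(g)`. -/
noncomputable def α (N : ObservableNet S H) : P →* ((H →L[ℂ] H) ≃⋆ₐ[ℂ] (H →L[ℂ] H)) :=
  (Unitary.conjStarAlgAut ℂ (H →L[ℂ] H)).comp N.U

theorem α_apply (N : ObservableNet S H) (g : P) (A : H →L[ℂ] H) :
    N.α g A = (N.U g : H →L[ℂ] H) * A * star (N.U g : H →L[ℂ] H) := rfl

theorem α_mem (N : ObservableNet S H) (g : P) {o : K} {A : H →L[ℂ] H} (h : A ∈ N.alg o) :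
    N.α g A ∈ N.alg (g • o) := (N.covariance g o A).1 h

theorem α_inv_mem (N : ObservableNet S H) (g : P) {o : K} {A : H →L[ℂ] H}
    (h : A ∈ N.alg (g • o)) : N.α g⁻¹ A ∈ N.alg o := by
  have := N.α_mem g⁻¹ h
  rwa [inv_smul_smul] at this

theorem α_inv_α (N : ObservableNet S H) (g : P) (A : H →L[ℂ] H) : N.α g⁻¹ (N.α g A) = A := by
  rw [← StarAlgEquiv.mul_apply, ← map_mul]; simp

theorem α_α_inv (N : ObservableNet S H) (g : P) (A : H →L[ℂ] H) : N.α g (N.α g⁻¹ A) = A := by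
  rw [← StarAlgEquiv.mul_apply, ← map_mul]; simp

theorem alg_subset_global (N : ObservableNet S H) (o : K) :
    (N.alg o : Set (H →L[ℂ] H)) ⊆ globalBicommutant N.alg := by
  rw [N.duality o]; exact Set.inter_subset_left

theorem smul_mem (N : ObservableNet S H) {o : K} {A : H →L[ℂ] H} (c : ℂ) (h : A ∈ N.alg o) :
    c • A ∈ N.alg o := (N.alg o).toStarSubalgebra.smul_mem h c

end ObservableNet

/-- A covariant `1`-cocycle: a field of unitaries `X_b(g) ∈ 𝒜(|b|)` such that
`X_{∂₁c}(g'g) = α_g⁻¹(X_{g∂₀c}(g')) X_{∂₂c}(g)`. -/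
@[ext]
structure Cocycle (N : ObservableNet S H) where
  toFun : P → Simplex1 K → unitary (H →L[ℂ] H)
  mem_alg : ∀ g b, (toFun g b : H →L[ℂ] H) ∈ N.alg b.supp
  cocycle : ∀ (g g' : P) (c : Simplex2 K), (toFun (g' * g) c.d1 : H →L[ℂ] H) =
    N.α g⁻¹ (toFun g' (S.act g c.d0)) * toFun g c.d2

variable {N : ObservableNet S H}

instance : CoeFun (Cocycle N) (fun _ => P → Simplex1 K → unitary (H →L[ℂ] H)) :=
  ⟨Cocycle.toFun⟩

namespace Cocycle

theorem roberts (X : Cocycle N) (c : Simplex2 K) : X 1 c.d1 = X 1 c.d0 * X 1 c.d2 := by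
  have := X.cocycle 1 1 c
  rw [S.act_one] at this
  ext1
  simpa using this

/-- The identity cocycle `I`. -/
noncomputable def unit (N : ObservableNet S H) : Cocycle N where
  toFun _ _ := 1
  mem_alg _ _ := one_mem _
  cocycle g g' c := by simp

/-- The value `X_p = X_{bₙ} ⋯ X_{b₁}` on a path `p : a → o`; by simple connectedness it does not
depend on the path. -/
noncomputable def transport (X : Cocycle N) (o a : K) : unitary (H →L[ℂ] H) :=
  ((S.path o a).map (X 1)).prod

theorem prod_eq_transport (X : Cocycle N) {o a : K} {l : List (Simplex1 K)} (h : IsPath a o l) :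
    (l.map (X 1)).prod = X.transport o a :=
  S.prod_eq_of_isPath (X 1) X.roberts h (S.path_isPath o a)

theorem apply_eq_transport (X : Cocycle N) (b : Simplex1 K) :
    X 1 b = X.transport b.d0 b.d1 := by
  rw [← X.prod_eq_transport (IsPath.single b)]; simp

theorem transport_mul (X : Cocycle N) (o a s : K) :
    X.transport o a * X.transport a s = X.transport o s := by
  rw [← X.prod_eq_transport ((S.path_isPath a s).append (S.path_isPath o a)), List.map_append,
    List.prod_append]
  rfl

theorem transport_self (X : Cocycle N) (o : K) : X.transport o o = 1 := by
  simpa using X.transport_mul o o o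

theorem transport_inv (X : Cocycle N) (o a : K) : (X.transport o a)⁻¹ = X.transport a o :=
  inv_eq_of_mul_eq_one_right (by rw [transport_mul, transport_self])

theorem transport_coe_mul (X : Cocycle N) (o a s : K) :
    (X.transport o a : H →L[ℂ] H) * (X.transport a s : H →L[ℂ] H) = X.transport o s := by
  rw [← X.transport_mul o a s]; rfl

theorem transport_coe_star (X : Cocycle N) (o a : K) :
    star (X.transport o a : H →L[ℂ] H) = X.transport a o := by
  rw [← X.transport_inv o a]; rfl

theorem transport_mem_global (X : Cocycle N) (o a : K) :
    (X.transport o a : H →L[ℂ] H) ∈ globalBicommutant N.alg := by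
  have : ∀ l : List (Simplex1 K),
      (((l.map (X 1)).prod : unitary (H →L[ℂ] H)) : H →L[ℂ] H) ∈ globalBicommutant N.alg := by
    intro l
    induction l with
    | nil => exact Set.one_mem_centralizer
    | cons b l ih =>
      rw [List.map_cons, List.prod_cons]
      exact Set.mul_mem_centralizer (N.alg_subset_global _ (X.mem_alg _ _)) ih
  exact this _

theorem transport_comm (X : Cocycle N) {o a s : K} (ho : S.perp o s) (ha : S.perp a s)
    {A : H →L[ℂ] H} (hA : A ∈ N.alg s) :
    (X.transport o a : H →L[ℂ] H) * A = A * X.transport o a := by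
  obtain ⟨l, hl, hs⟩ := S.connected_compl s a ha o ho
  rw [← X.prod_eq_transport hl]
  clear hl
  induction l with
  | nil => simp
  | cons b l ih =>
    have h1 := N.causality _ _ (hs b (by simp)).1 _ (X.mem_alg 1 b) _ hA
    have h2 := ih fun b hb => hs b (by simp [hb])
    rw [List.map_cons, List.prod_cons, Submonoid.coe_mul, mul_assoc, h2, ← mul_assoc, h1, mul_assoc]

/-- The morphism `ρ(o)_a(A) = X_{p_{o,ã}} A X_{p_{ã,o}}` on `𝒜(a)` associated with a cocycle, where
`ã ⊥ a`. On `A ∈ 𝒜(a)` it is independent of `ã`. -/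
noncomputable def rho (X : Cocycle N) (o a : K) : (H →L[ℂ] H) ≃⋆ₐ[ℂ] (H →L[ℂ] H) :=
  Unitary.conjStarAlgAut ℂ (H →L[ℂ] H) (X.transport o (S.disj a))

theorem rho_eq (X : Cocycle N) (o : K) {a s : K} (hs : S.perp s a) {A : H →L[ℂ] H}
    (hA : A ∈ N.alg a) :
    X.rho o a A = (X.transport o s : H →L[ℂ] H) * A * X.transport s o := by
  have h : X.rho o a A = (X.transport o (S.disj a) : H →L[ℂ] H) * A * X.transport (S.disj a) o := by
    rw [← X.transport_coe_star o (S.disj a)]; rfl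
  rw [h, ← X.transport_coe_mul o s (S.disj a), ← X.transport_coe_mul (S.disj a) s o, mul_assoc,
    mul_assoc, ← mul_assoc A, ← X.transport_comm (S.disj_perp a) hs hA, mul_assoc,
    ← mul_assoc (X.transport s (S.disj a) : H →L[ℂ] H), X.transport_coe_mul, X.transport_self]
  simp [mul_assoc]

theorem rho_of_le (X : Cocycle N) (o : K) {a a' : K} (h : a ≤ a') {A : H →L[ℂ] H}
    (hA : A ∈ N.alg a) : X.rho o a' A = X.rho o a A := by
  have h' : S.perp (S.disj a') a := S.perp_symm _ _ (S.perp_of_le _ _ _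
    (S.perp_symm _ _ (S.disj_perp a')) h)
  rw [X.rho_eq o (S.disj_perp a') (N.isotony _ _ h hA), X.rho_eq o h' hA]

theorem rho_of_perp (X : Cocycle N) {o a : K} (h : S.perp a o) {A : H →L[ℂ] H}
    (hA : A ∈ N.alg a) : X.rho o a A = A := by
  rw [X.rho_eq o (S.perp_symm _ _ h) hA, X.transport_self]; simp

theorem rho_mem (X : Cocycle N) {o a : K} (h : o ≤ a) {A : H →L[ℂ] H} (hA : A ∈ N.alg a) :
    X.rho o a A ∈ N.alg a := by
  rw [← SetLike.mem_coe, N.duality a]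
  refine ⟨?_, ?_⟩
  · rw [X.rho_eq o (S.disj_perp a) hA]
    exact Set.mul_mem_centralizer (Set.mul_mem_centralizer (X.transport_mem_global _ _)
      (N.alg_subset_global _ hA)) (X.transport_mem_global _ _)
  · intro s hs
    rw [VonNeumannAlgebra.mem_commutant_iff]
    intro B hB
    obtain ⟨t, ht1, ht2⟩ := S.exists_perp_of_perp s a hs
    have hso : S.perp s o := S.perp_symm _ _ (S.perp_of_le _ _ _ (S.perp_symm _ _ hs) h)
    have hto : S.perp o s := S.perp_symm _ _ hso
    rw [X.rho_eq o ht2 hA]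
    have h1 := X.transport_comm hto ht1 hB
    have h2 := X.transport_comm ht1 hto hB
    have h3 := N.causality _ _ hs _ hB _ hA
    rw [← mul_assoc, ← mul_assoc, ← h1, mul_assoc _ B A, h3, ← mul_assoc, mul_assoc _ B, ← h2,
      ← mul_assoc]

/-- `X_b(g) = α_g⁻¹(X_{gb}) X_{∂₁b}(g)`. -/
theorem apply_eq_left (X : Cocycle N) (g : P) (b : Simplex1 K) :
    (X g b : H →L[ℂ] H) = N.α g⁻¹ (X.transport (g • b.d0) (g • b.d1)) *
      X g (Simplex1.degen b.d1) := by
  have := X.cocycle g 1 ⟨b, b, Simplex1.degen b.d1, b.supp, le_rfl, le_rfl, b.d1_le, rfl, rfl, rfl⟩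
  rw [one_mul] at this
  rw [this, X.apply_eq_transport]; rfl

/-- `X_b(g) = X_{∂₀b}(g) X_b`. -/
theorem apply_eq_right (X : Cocycle N) (g : P) (b : Simplex1 K) :
    (X g b : H →L[ℂ] H) = X g (Simplex1.degen b.d0) * X.transport b.d0 b.d1 := by
  have := X.cocycle 1 g ⟨Simplex1.degen b.d0, b, b, b.supp, b.d0_le, le_rfl, le_rfl, rfl, rfl, rfl⟩
  rw [mul_one, S.act_one, X.apply_eq_transport b] at this
  rw [this]; simp

theorem transport_covariance (X : Cocycle N) (g : P) (o a : K) :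
    N.α g⁻¹ (X.transport (g • o) (g • a)) * (X g (Simplex1.degen a) : H →L[ℂ] H) =
      X g (Simplex1.degen o) * X.transport o a := by
  have key : ∀ (l : List (Simplex1 K)), IsPath a o l →
    N.α g⁻¹ (X.transport (g • o) (g • a)) * (X g (Simplex1.degen a) : H →L[ℂ] H) =
      X g (Simplex1.degen o) * X.transport o a := by
    intro l hl
    induction hl with
    | single b => rw [← X.apply_eq_left, ← X.apply_eq_right]
    | cons b h ih =>
      rename_i a l
      rw [← X.transport_coe_mul _ (g • b.d1), map_mul, mul_assoc, ih, ← mul_assoc,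
        ← X.apply_eq_left, X.apply_eq_right, mul_assoc, X.transport_coe_mul]
  exact key _ (S.path_isPath o a)

/-- `ad X_b(g) ∘ ρ(∂₁b)_a = α_g⁻¹ ∘ ρ(g∂₀b)_{ga} ∘ α_g` on `𝒜(a)`. -/
theorem rho_covariance (X : Cocycle N) (g : P) (b : Simplex1 K) {a : K} {A : H →L[ℂ] H}
    (hA : A ∈ N.alg a) :
    (X g b : H →L[ℂ] H) * X.rho b.d1 a A = N.α g⁻¹ (X.rho (g • b.d0) (g • a) (N.α g A)) * X g b := by
  set s := S.disj a
  have hs : S.perp s a := S.disj_perp a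
  have hgs : S.perp (g • s) (g • a) := S.smul_perp g _ _ hs
  have hcomm : (X g (Simplex1.degen s) : H →L[ℂ] H) * A = A * X g (Simplex1.degen s) :=
    N.causality _ _ hs _ (X.mem_alg g (Simplex1.degen s)) _ hA
  have e1 := X.transport_covariance g b.d0 s
  have e2 := X.transport_covariance g s b.d0
  rw [X.rho_eq _ hs hA, X.rho_eq _ hgs (N.α_mem g hA), map_mul, map_mul, N.α_inv_α,
    X.apply_eq_right g b]
  calc _ = (X g (Simplex1.degen b.d0) : H →L[ℂ] H) *
          ((X.transport b.d0 b.d1 : H →L[ℂ] H) * X.transport b.d1 s) * A * X.transport s b.d1 := by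
        simp only [mul_assoc]
    _ = N.α g⁻¹ (X.transport (g • b.d0) (g • s)) * (X g (Simplex1.degen s) * A) *
          X.transport s b.d1 := by
        rw [X.transport_coe_mul, ← e1]; simp only [mul_assoc]
    _ = N.α g⁻¹ (X.transport (g • b.d0) (g • s)) * A * (X g (Simplex1.degen s) *
          X.transport s b.d0) * X.transport b.d0 b.d1 := by
        rw [hcomm, ← X.transport_coe_mul s b.d0 b.d1]; simp only [mul_assoc]
    _ = _ := by rw [← e2]; simp only [mul_assoc]

theorem rho_mem_unitary (X : Cocycle N) (o a : K) (u : unitary (H →L[ℂ] H)) :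
    X.rho o a u ∈ unitary (H →L[ℂ] H) :=
  (X.transport o (S.disj a) * u * (X.transport o (S.disj a))⁻¹).2

/-- The morphism `ρ(o)_a` on unitaries. -/
noncomputable def rhoU (X : Cocycle N) (o a : K) (u : unitary (H →L[ℂ] H)) :
    unitary (H →L[ℂ] H) :=
  ⟨X.rho o a u, X.rho_mem_unitary o a u⟩

/-- `(X × Y)_{b₁,b₂}(g) = X_{b₁}(g) ρ(∂₁b₁)_{|b₂|}(Y_{b₂}(g))`, with `ρ` the morphism of `X`. -/
noncomputable def cross (X Y : Cocycle N) (g : P) (b₁ b₂ : Simplex1 K) : unitary (H →L[ℂ] H) :=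
  X g b₁ * X.rhoU b₁.d1 b₂.supp (Y g b₂)

theorem coe_cross (X Y : Cocycle N) (g : P) (b₁ b₂ : Simplex1 K) :
    (X.cross Y g b₁ b₂ : H →L[ℂ] H) = X g b₁ * X.rho b₁.d1 b₂.supp (Y g b₂) := rfl

/-- The tensor product `(X ⊗ Y)_b(g) = X_b(g) ρ(∂₁b)_{|b|}(Y_b(g))`. -/
noncomputable def tensor (X Y : Cocycle N) : Cocycle N where
  toFun g b := X.cross Y g b b
  mem_alg g b := mul_mem (X.mem_alg g b) (X.rho_mem b.d1_le (Y.mem_alg g b))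
  cocycle g g' c := by
    have hA : N.α g⁻¹ (Y g' (S.act g c.d0)) ∈ N.alg c.supp :=
      N.isotony _ _ c.d0_supp_le (N.α_inv_mem g (Y.mem_alg g' (S.act g c.d0)))
    have h := X.rho_covariance g c.d2 hA
    rw [N.α_α_inv] at h
    simp only [coe_cross]
    rw [← X.rho_of_le _ c.d1_supp_le (Y.mem_alg _ _), ← X.rho_of_le _ c.d2_supp_le (Y.mem_alg _ _),
      ← X.rho_of_le (a := (S.act g c.d0).supp) (S.act g c.d0).d1 (S.smul_le g c.d0_supp_le)
        (Y.mem_alg _ _), X.cocycle,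
      Y.cocycle, map_mul, map_mul, c.d11_eq, mul_assoc, ← mul_assoc (X g c.d2 : H →L[ℂ] H), h]
    simp only [IndexSet.act, c.d10_eq, mul_assoc]

/-- The intertwiners from `X` to `Y`: the fields `t_a ∈ 𝒜(a)` such that
`α_g⁻¹(t_{g∂₀b}) X_b(g) = Y_b(g) t_{∂₁b}`. Composition is the pointwise product, the adjoint is the
pointwise adjoint, and the identity arrow is the constant field `1`. -/
def Hom (X Y : Cocycle N) : Submodule ℂ (K → (H →L[ℂ] H)) where
  carrier := {t | (∀ a, t a ∈ N.alg a) ∧ ∀ (g : P) (b : Simplex1 K),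
    N.α g⁻¹ (t (g • b.d0)) * (X g b : H →L[ℂ] H) = (Y g b : H →L[ℂ] H) * t b.d1}
  add_mem' h h' := ⟨fun a => add_mem (h.1 a) (h'.1 a), fun g b => by
    simp only [Pi.add_apply, map_add, add_mul, mul_add, h.2, h'.2]⟩
  zero_mem' := ⟨fun a => zero_mem _, fun g b => by simp⟩
  smul_mem' z t h := ⟨fun a => N.smul_mem z (h.1 a), fun g b => by
    simp only [Pi.smul_apply, map_smul, smul_mul_assoc, mul_smul_comm, h.2]⟩

theorem one_mem_hom (X : Cocycle N) : (1 : K → (H →L[ℂ] H)) ∈ Hom X X :=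
  ⟨fun _ => one_mem _, fun g b => by simp⟩

theorem mul_mem_hom {X Y Z : Cocycle N} {t s : K → (H →L[ℂ] H)} (ht : t ∈ Hom X Y)
    (hs : s ∈ Hom Z X) : t * s ∈ Hom Z Y :=
  ⟨fun a => mul_mem (ht.1 a) (hs.1 a), fun g b => by
    rw [Pi.mul_apply, Pi.mul_apply, map_mul, mul_assoc, hs.2, ← mul_assoc, ht.2, mul_assoc]⟩

theorem hom_transport {X Y : Cocycle N} {t : K → (H →L[ℂ] H)} (ht : t ∈ Hom X Y) (o a : K) :
    t o * (X.transport o a : H →L[ℂ] H) = (Y.transport o a : H →L[ℂ] H) * t a := by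
  have key : ∀ (l : List (Simplex1 K)), IsPath a o l →
      t o * (X.transport o a : H →L[ℂ] H) = (Y.transport o a : H →L[ℂ] H) * t a := by
    intro l hl
    have h1 : ∀ b : Simplex1 K, t b.d0 * (X.transport b.d0 b.d1 : H →L[ℂ] H) =
        (Y.transport b.d0 b.d1 : H →L[ℂ] H) * t b.d1 := by
      intro b
      have := ht.2 1 b
      rw [X.apply_eq_transport, Y.apply_eq_transport] at this
      simpa using this
    induction hl with
    | single b => exact h1 b
    | cons b h ih =>
      rw [← X.transport_coe_mul _ b.d1, ← Y.transport_coe_mul _ b.d1, ← mul_assoc, h1, mul_assoc,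
        ih, mul_assoc]
  exact key _ (S.path_isPath o a)

theorem hom_rho {X Y : Cocycle N} {t : K → (H →L[ℂ] H)} (ht : t ∈ Hom X Y) (o : K) {a : K}
    {A : H →L[ℂ] H} (hA : A ∈ N.alg a) : t o * X.rho o a A = Y.rho o a A * t o := by
  have hs := S.disj_perp a
  rw [X.rho_eq o hs hA, Y.rho_eq o hs hA, ← mul_assoc, ← mul_assoc, hom_transport ht,
    mul_assoc _ (t _) A, N.causality _ _ hs _ (ht.1 _) _ hA, mul_assoc _ _ (t o),
    ← hom_transport ht]
  simp only [mul_assoc]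

/-- The tensor product of fields `(t ⊗ s)_a = t_a ρ(a)_a(s_a)`, with `ρ` the morphism of the source
`X` of `t`. -/
noncomputable def tensorField (X : Cocycle N) (t s : K → (H →L[ℂ] H)) : K → (H →L[ℂ] H) :=
  fun a => t a * X.rho a a (s a)

theorem tensorField_mem {X Y Z L : Cocycle N} {t s : K → (H →L[ℂ] H)} (ht : t ∈ Hom X Y)
    (hs : s ∈ Hom Z L) : tensorField X t s ∈ Hom (X.tensor Z) (Y.tensor L) := by
  refine ⟨fun a => mul_mem (ht.1 a) (X.rho_mem le_rfl (hs.1 a)), fun g b => ?_⟩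
  have hA : N.α g⁻¹ (s (g • b.d0)) ∈ N.alg b.supp :=
    N.isotony _ _ b.d0_le (N.α_inv_mem g (hs.1 _))
  have h := X.rho_covariance g b hA
  rw [N.α_α_inv] at h
  change N.α g⁻¹ (t (g • b.d0) * X.rho (g • b.d0) (g • b.d0) (s (g • b.d0))) *
    ((X g b : H →L[ℂ] H) * X.rho b.d1 b.supp (Z g b)) =
    ((Y g b : H →L[ℂ] H) * Y.rho b.d1 b.supp (L g b)) * (t b.d1 * X.rho b.d1 b.d1 (s b.d1))
  calc _ = N.α g⁻¹ (t (g • b.d0)) * (N.α g⁻¹ (X.rho (g • b.d0) (g • b.supp) (s (g • b.d0))) *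
          X g b) * X.rho b.d1 b.supp (Z g b) := by
        rw [X.rho_of_le _ (S.smul_le g b.d0_le) (hs.1 _), map_mul]; simp only [mul_assoc]
    _ = (N.α g⁻¹ (t (g • b.d0)) * X g b) *
          X.rho b.d1 b.supp (N.α g⁻¹ (s (g • b.d0)) * Z g b) := by
        rw [← h, map_mul]; simp only [mul_assoc]
    _ = Y g b * (t b.d1 * X.rho b.d1 b.supp (L g b)) * X.rho b.d1 b.supp (s b.d1) := by
        rw [ht.2, hs.2, map_mul]; simp only [mul_assoc]
    _ = _ := by
        rw [hom_rho ht _ (L.mem_alg g b), X.rho_of_le _ b.d1_le (hs.1 _)]; simp only [mul_assoc]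

theorem rhoU_eq (X : Cocycle N) (o : K) {a s : K} (hs : S.perp s a) {u : unitary (H →L[ℂ] H)}
    (hu : (u : H →L[ℂ] H) ∈ N.alg a) :
    X.rhoU o a u = X.transport o s * u * X.transport s o :=
  Subtype.ext (X.rho_eq o hs hu)

theorem tensor_transport (X Y : Cocycle N) {o a t : K} (ho : S.perp o t) (ha : S.perp a t) :
    (X.tensor Y).transport o a = X.transport o t * Y.transport o a * X.transport t a := by
  obtain ⟨l, hl, hs⟩ := S.connected_compl t a ha o ho
  rw [← (X.tensor Y).prod_eq_transport hl]
  have h1 : ∀ b : Simplex1 K, S.perp b.supp t → (X.tensor Y) 1 b =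
      X.transport b.d0 t * Y.transport b.d0 b.d1 * X.transport t b.d1 := by
    intro b hb
    change X 1 b * X.rhoU b.d1 b.supp (Y 1 b) = _
    rw [X.rhoU_eq _ (S.perp_symm _ _ hb) (Y.mem_alg 1 b), X.apply_eq_transport,
      Y.apply_eq_transport, ← mul_assoc, ← mul_assoc, X.transport_mul]
  clear ho ha
  induction hl with
  | single b => simpa using h1 b (hs b (by simp)).1
  | cons b h ih =>
    rename_i a l
    rw [List.map_cons, List.prod_cons, h1 b (hs b (by simp)).1, ih fun b hb => hs b (by simp [hb]),
      ← Y.transport_mul b.d0 b.d1 a]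
    have := X.transport_mul t b.d1 t
    rw [X.transport_self] at this
    calc _ = X.transport b.d0 t * Y.transport b.d0 b.d1 * (X.transport t b.d1 * X.transport b.d1 t) *
          Y.transport b.d1 a * X.transport t a := by simp only [mul_assoc]
      _ = _ := by rw [this]; simp only [mul_assoc, one_mul]

theorem rho_tensor (X Y : Cocycle N) {o a : K} (h : o ≤ a) {A : H →L[ℂ] H} (hA : A ∈ N.alg a) :
    (X.tensor Y).rho o a A = X.rho o a (Y.rho o a A) := by
  have hs := S.disj_perp a
  set s := S.disj a
  obtain ⟨t, hts, hta⟩ := S.exists_perp_of_perp s a hs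
  have hot : S.perp o t := S.perp_of_le _ _ _ (S.perp_symm _ _ hta) h
  have hst := S.perp_symm _ _ hts
  rw [(X.tensor Y).rho_eq o hs hA, X.rho_eq o hta (Y.rho_mem h hA), Y.rho_eq o hs hA,
    X.tensor_transport Y hot hst, X.tensor_transport Y hst hot]
  simp only [Submonoid.coe_mul]
  have h1 := X.transport_comm hta hs hA
  have h2 := X.transport_coe_mul t s t
  rw [X.transport_self] at h2
  calc _ = X.transport o t * Y.transport o s * ((X.transport t s : H →L[ℂ] H) * A) *
        X.transport s t * Y.transport s o * X.transport t o := by simp only [mul_assoc]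
    _ = X.transport o t * Y.transport o s * A * ((X.transport t s : H →L[ℂ] H) *
        X.transport s t) * Y.transport s o * X.transport t o := by
      rw [h1]; simp only [mul_assoc]
    _ = _ := by rw [h2]; simp [mul_assoc]

/-- The tensor product is strictly associative. -/
theorem tensor_assoc (X Y Z : Cocycle N) : (X.tensor Y).tensor Z = X.tensor (Y.tensor Z) := by
  ext g b : 4
  change (X g b * X.rho b.d1 b.supp (Y g b) : H →L[ℂ] H) * (X.tensor Y).rho b.d1 b.supp (Z g b) =
    (X g b : H →L[ℂ] H) * X.rho b.d1 b.supp ((Y g b : H →L[ℂ] H) * Y.rho b.d1 b.supp (Z g b))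
  rw [X.rho_tensor Y b.d1_le (Z.mem_alg g b), map_mul, mul_assoc]

/-- `(X × Y)_{p,q} = (X × Y)_{bₙ,dₙ} ⋯ (X × Y)_{b₁,d₁}` for paths `p = bₙ * ⋯ * b₁`,
`q = dₙ * ⋯ * d₁` of the same length. -/
noncomputable def crossPath (X Y : Cocycle N) (p q : List (Simplex1 K)) :
    unitary (H →L[ℂ] H) :=
  (List.zipWith (X.cross Y 1) p q).prod

/-- `p` and `q` are two paths of the same length, starting from `a` and with causally disjoint
endpoints. -/
def Separates (S : IndexSet K P) (a : K) (p q : List (Simplex1 K)) : Prop :=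
  p.length = q.length ∧ ∃ o₁ o₂, IsPath a o₁ p ∧ IsPath a o₂ q ∧ S.perp o₁ o₂

theorem exists_separates (S : IndexSet K P) (a : K) : ∃ p q, Separates S a p q := by
  have hp := S.path_isPath (S.disj a) a
  refine ⟨S.path (S.disj a) a, List.replicate ((S.path (S.disj a) a).length - 1 + 1)
    (Simplex1.degen a), ?_, _, _, hp, IsPath.replicate_degen a _, S.disj_perp a⟩
  have := hp.length_pos
  simp; omega

/-- The symmetry `ε(X, Y)_a = (Y × X)_{q,p}^* (X × Y)_{p,q}`, for any two paths `p`, `q` (of the same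
length) starting from `a` and with causally disjoint endpoints. -/
noncomputable def symm (X Y : Cocycle N) (a : K) : H →L[ℂ] H :=
  star (Y.crossPath X (exists_separates S a).choose_spec.choose (exists_separates S a).choose :
    H →L[ℂ] H) *
    X.crossPath Y (exists_separates S a).choose (exists_separates S a).choose_spec.choose

theorem rhoU_mul (X : Cocycle N) (o a : K) (u v : unitary (H →L[ℂ] H)) :
    X.rhoU o a (u * v) = X.rhoU o a u * X.rhoU o a v :=
  Subtype.ext (map_mul (X.rho o a) (u : H →L[ℂ] H) v)

theorem rhoU_transport (X : Cocycle N) (o o' a : K) (u : unitary (H →L[ℂ] H)) :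
    X.rhoU o a u * X.transport o o' = X.transport o o' * X.rhoU o' a u := by
  have h : ∀ o, X.rhoU o a u = X.transport o (S.disj a) * u * (X.transport o (S.disj a))⁻¹ :=
    fun o => rfl
  rw [h, h, X.transport_inv, X.transport_inv, ← X.transport_mul o o' (S.disj a)]
  have h2 := X.transport_mul (S.disj a) o o'
  rw [mul_assoc, h2, mul_assoc, mul_assoc, mul_assoc]

/-- The product `ρ(o)_{|bₙ|}(Y_{bₙ}) ⋯ ρ(o)_{|b₁|}(Y_{b₁})` along a path `a → s`. -/
noncomputable def dressed (X Y : Cocycle N) (o s a : K) : unitary (H →L[ℂ] H) :=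
  ((S.path s a).map fun b => X.rhoU o b.supp (Y 1 b)).prod

theorem prod_eq_dressed (X Y : Cocycle N) (o : K) {s a : K} {l : List (Simplex1 K)}
    (h : IsPath a s l) : (l.map fun b => X.rhoU o b.supp (Y 1 b)).prod = X.dressed Y o s a := by
  refine S.prod_eq_of_isPath (fun b => X.rhoU o b.supp (Y 1 b)) (fun c => ?_) h (S.path_isPath s a)
  have hle : ∀ b : Simplex1 K, b.supp ≤ c.supp →
      X.rhoU o b.supp (Y 1 b) = X.rhoU o c.supp (Y 1 b) := fun b hb =>
    Subtype.ext (X.rho_of_le o hb (Y.mem_alg 1 b)).symm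
  change X.rhoU o c.d1.supp (Y 1 c.d1) =
    X.rhoU o c.d0.supp (Y 1 c.d0) * X.rhoU o c.d2.supp (Y 1 c.d2)
  rw [hle _ c.d0_supp_le, hle _ c.d1_supp_le, hle _ c.d2_supp_le, ← rhoU_mul, Y.roberts]

theorem dressed_mul (X Y : Cocycle N) (o s a t : K) :
    X.dressed Y o s a * X.dressed Y o a t = X.dressed Y o s t := by
  rw [← X.prod_eq_dressed Y o ((S.path_isPath a t).append (S.path_isPath s a)), List.map_append,
    List.prod_append]
  rfl

theorem dressed_self (X Y : Cocycle N) (o s : K) : X.dressed Y o s s = 1 := by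
  simpa using X.dressed_mul Y o s s s

theorem dressed_transport (X Y : Cocycle N) (o o' s a : K) :
    X.dressed Y o s a * X.transport o o' = X.transport o o' * X.dressed Y o' s a := by
  unfold dressed
  induction S.path s a with
  | nil => simp
  | cons b l ih =>
    rw [List.map_cons, List.prod_cons, mul_assoc, ih, ← mul_assoc, X.rhoU_transport,
      List.map_cons, List.prod_cons, mul_assoc]

theorem dressed_of_perp (X Y : Cocycle N) {o s a t : K} (hs : S.perp s t) (ha : S.perp a t) :
    X.dressed Y o s a = X.transport o t * Y.transport s a * X.transport t o := by
  obtain ⟨l, hl, hl'⟩ := S.connected_compl t a ha s hs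
  rw [← X.prod_eq_dressed Y o hl, ← Y.prod_eq_transport hl]
  clear hl
  induction l with
  | nil => simp [transport_mul, transport_self]
  | cons b l ih =>
    have h2 := X.transport_mul t o t
    rw [X.transport_self] at h2
    rw [List.map_cons, List.prod_cons, ih fun b hb => hl' b (by simp [hb]),
      X.rhoU_eq o (S.perp_symm _ _ (hl' b (by simp)).1) (Y.mem_alg 1 b), List.map_cons,
      List.prod_cons]
    calc _ = X.transport o t * Y 1 b * (X.transport t o * X.transport o t) *
          (l.map (Y 1)).prod * X.transport t o := by simp only [mul_assoc]
      _ = _ := by rw [h2]; simp only [mul_assoc, one_mul]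

/-- The value of `(X × Y)_{p,q}` for `p : a₁ → o₁` and `q : a₂ → o₂`. -/
noncomputable def pair (X Y : Cocycle N) (o₁ o₂ a₁ a₂ : K) : unitary (H →L[ℂ] H) :=
  X.transport o₁ a₁ * X.dressed Y a₁ o₂ a₂

theorem crossPath_eq_pair (X Y : Cocycle N) {a₁ o₁ a₂ o₂ : K} {p q : List (Simplex1 K)}
    (hlen : p.length = q.length) (hp : IsPath a₁ o₁ p) (hq : IsPath a₂ o₂ q) :
    X.crossPath Y p q = X.pair Y o₁ o₂ a₁ a₂ := by
  unfold pair
  rw [← X.prod_eq_transport hp, ← X.prod_eq_dressed Y a₁ hq]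
  clear hq
  induction hp generalizing q with
  | single b =>
    match q, hlen with
    | [d], _ => simp [crossPath, cross]
  | cons b h ih =>
    rename_i a l
    match q, hlen with
    | d :: q, hlen =>
      have h1 := ih (q := q) (by simpa using hlen)
      have h2 := X.rhoU_transport b.d1 a d.supp (Y 1 d)
      rw [← X.prod_eq_transport h] at h2
      unfold crossPath at h1 ⊢
      rw [List.zipWith_cons_cons, List.prod_cons, h1, cross, List.map_cons, List.map_cons,
        List.prod_cons, List.prod_cons, mul_assoc, ← mul_assoc (X.rhoU b.d1 d.supp (Y 1 d)), h2]
      simp only [mul_assoc]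

theorem pair_mul (X Y : Cocycle N) (o₁ o₂ s₁ s₂ a₁ a₂ : K) :
    X.pair Y o₁ o₂ s₁ s₂ * X.pair Y s₁ s₂ a₁ a₂ = X.pair Y o₁ o₂ a₁ a₂ := by
  unfold pair
  rw [mul_assoc, ← mul_assoc (X.dressed Y s₁ o₂ s₂), X.dressed_transport, ← X.dressed_mul Y a₁ o₂ s₂ a₂,
    ← X.transport_mul o₁ s₁ a₁]
  simp only [mul_assoc]

theorem pair_fst (X Y : Cocycle N) {o s a : K} (hs : S.perp s o) (ha : S.perp a o) :
    X.pair Y o s o a = Y.transport s a := by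
  unfold pair
  rw [X.dressed_of_perp Y hs ha, X.transport_self]; simp

theorem pair_snd (X Y : Cocycle N) (o s a : K) : X.pair Y o s a s = X.transport o a := by
  unfold pair
  rw [X.dressed_self, mul_one]

theorem pair_swap (X Y : Cocycle N) {o₁ o₂ a₁ a₂ : K} (ha : S.perp a₁ a₂) (ho : S.perp o₁ o₂) :
    X.pair Y o₁ o₂ a₁ a₂ = Y.pair X o₂ o₁ a₂ a₁ := by
  have hsnd : ∀ (X Y : Cocycle N) {o s a : K}, S.perp s o → S.perp a o →
      X.pair Y o s o a = Y.pair X s o a o := fun X Y o s a hs ha => by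
    rw [X.pair_fst Y hs ha, Y.pair_snd]
  obtain ⟨o, hle, s, hso, hs1⟩ : ∃ o, o ≤ a₁ ∧ ∃ s, S.perp s o ∧ S.perp s o₁ := by
    by_cases h : S.perp a₁ o₁
    · exact ⟨a₁, le_rfl, S.exists_perp_of_perp _ _ h⟩
    · obtain ⟨o, h1, h2⟩ := S.exists_perp_of_not_perp _ _ h
      exact ⟨o, (S.lt_of_sub _ _ h1).le, h2⟩
  have ho2 : S.perp o a₂ := S.perp_of_le _ _ _ ha hle
  have p := S.perp_symm
  rw [← X.pair_mul Y o₁ o₂ o₁ s a₁ a₂, ← X.pair_mul Y o₁ s o s a₁ a₂,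
    ← X.pair_mul Y o s o a₂ a₁ a₂, ← Y.pair_mul X o₂ o₁ s o₁ a₂ a₁,
    ← Y.pair_mul X s o₁ s o a₂ a₁, ← Y.pair_mul X s o a₂ o a₂ a₁,
    hsnd X Y (p _ _ ho) hs1, hsnd X Y hso (p _ _ ho2), ← hsnd Y X (p _ _ hs1) (p _ _ hso),
    ← hsnd Y X ho2 ha]

/-- The symmetry does not depend on the choice of the paths. -/
theorem symm_eq_pair (X Y : Cocycle N) (a : K) {o₁ o₂ : K} (h : S.perp o₁ o₂) :
    X.symm Y a = (((Y.pair X o₂ o₁ a a)⁻¹ * X.pair Y o₁ o₂ a a : unitary (H →L[ℂ] H)) :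
      H →L[ℂ] H) := by
  obtain ⟨hlen, s₁, s₂, hp, hq, hs⟩ := (exists_separates S a).choose_spec.choose_spec
  have h1 : X.symm Y a = (((Y.pair X s₂ s₁ a a)⁻¹ * X.pair Y s₁ s₂ a a : unitary (H →L[ℂ] H)) :
      H →L[ℂ] H) := by
    rw [← X.crossPath_eq_pair Y hlen hp hq, ← Y.crossPath_eq_pair X hlen.symm hq hp]; rfl
  rw [h1, ← X.pair_mul Y s₁ s₂ o₁ o₂, ← Y.pair_mul X s₂ s₁ o₂ o₁, X.pair_swap Y h hs, mul_inv_rev,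
    mul_assoc, inv_mul_cancel_left]

theorem symm_eq_crossPath (X Y : Cocycle N) {a : K} {p q : List (Simplex1 K)}
    (h : Separates S a p q) :
    X.symm Y a = star (Y.crossPath X q p : H →L[ℂ] H) * X.crossPath Y p q := by
  obtain ⟨hlen, s₁, s₂, hp, hq, hs⟩ := h
  rw [X.symm_eq_pair Y a hs, ← X.crossPath_eq_pair Y hlen hp hq,
    ← Y.crossPath_eq_pair X hlen.symm hq hp]
  rfl

theorem symm_mem_alg (X Y : Cocycle N) (a : K) : X.symm Y a ∈ N.alg a := by
  have hform : ∀ o, S.perp o a → X.symm Y a =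
      (Y.transport a o : H →L[ℂ] H) * X.dressed Y a o a := by
    intro o ho
    rw [X.symm_eq_pair Y a (S.perp_symm _ _ ho), Y.pair_snd, Y.transport_inv, pair,
      X.transport_self, one_mul]
    rfl
  have hdr : ∀ (T : Set (H →L[ℂ] H)) (o s b : K) (l : List (Simplex1 K)), IsPath b s l →
      (∀ d ∈ l, X.rho o d.supp (Y 1 d) ∈ Set.centralizer T) →
      (X.dressed Y o s b : H →L[ℂ] H) ∈ Set.centralizer T := by
    intro T o s b l hl
    rw [← X.prod_eq_dressed Y o hl]
    clear hl
    induction l with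
    | nil => intro _; simp [Set.one_mem_centralizer]
    | cons d l ih =>
      intro h
      rw [List.map_cons, List.prod_cons]
      exact Set.mul_mem_centralizer (h d (by simp)) (ih fun b hb => h b (by simp [hb]))
  rw [← SetLike.mem_coe, N.duality a]
  refine ⟨?_, ?_⟩
  · rw [hform _ (S.disj_perp a)]
    refine Set.mul_mem_centralizer (Y.transport_mem_global _ _)
      (hdr _ _ _ _ _ (S.path_isPath _ _) fun d _ => ?_)
    rw [X.rho_eq a (S.disj_perp d.supp) (Y.mem_alg 1 d)]
    exact Set.mul_mem_centralizer (Set.mul_mem_centralizer (X.transport_mem_global _ _)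
      (N.alg_subset_global _ (Y.mem_alg 1 d))) (X.transport_mem_global _ _)
  · intro s hs
    have hs' := S.perp_symm _ _ hs
    rw [VonNeumannAlgebra.mem_commutant_iff]
    obtain ⟨o, hoa, hos⟩ := S.exists_perp_of_perp a s hs'
    obtain ⟨l, hl, hls⟩ := S.connected_compl s a hs' o hos
    rw [hform o hoa]
    have h1 : (Y.transport a o : H →L[ℂ] H) ∈ Set.centralizer (N.alg s : Set (H →L[ℂ] H)) :=
      fun B hB => (Y.transport_comm hs' hos hB).symm
    refine fun B hB => Set.mul_mem_centralizer h1 (hdr _ _ _ _ l hl fun d hd => ?_) B hB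
    intro B hB
    have hds := (hls d hd).1
    obtain ⟨t, ht1, ht2⟩ := S.exists_perp_of_perp _ _ hds
    have h2 := X.transport_comm hs' ht2 hB
    have h3 := X.transport_comm ht2 hs' hB
    have h4 := N.causality _ _ hds _ (Y.mem_alg 1 d) _ hB
    rw [X.rho_eq a ht1 (Y.mem_alg 1 d), ← mul_assoc, ← mul_assoc, ← h2, mul_assoc _ B, ← h4,
      ← mul_assoc, mul_assoc _ B, ← h3, ← mul_assoc]

theorem symm_mem_hom (X Y : Cocycle N) : X.symm Y ∈ Hom (X.tensor Y) (Y.tensor X) := by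
  refine ⟨X.symm_mem_alg Y, ?_⟩
  -- the relation for the identity of the symmetry group
  have hone : ∀ o a : K, X.symm Y o * ((X.tensor Y).transport o a : H →L[ℂ] H) =
      ((Y.tensor X).transport o a : H →L[ℂ] H) * X.symm Y a := by
    have hb : ∀ b : Simplex1 K, X.symm Y b.d0 * ((X.tensor Y) 1 b : H →L[ℂ] H) =
        ((Y.tensor X) 1 b : H →L[ℂ] H) * X.symm Y b.d1 := by
      intro b
      have hpair : ∀ X Y : Cocycle N, (X.tensor Y) 1 b = X.pair Y b.d0 b.d0 b.d1 b.d1 := by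
        intro X Y
        rw [← X.crossPath_eq_pair Y rfl (IsPath.single b) (IsPath.single b)]
        simp [crossPath, tensor]
      have hs := S.perp_symm _ _ (S.disj_perp b.d0)
      rw [X.symm_eq_pair Y b.d0 hs, X.symm_eq_pair Y b.d1 hs, hpair, hpair, ← Submonoid.coe_mul,
        ← Submonoid.coe_mul, mul_assoc, X.pair_mul Y, ← Y.pair_mul X (S.disj b.d0) b.d0 b.d0 b.d0 b.d1 b.d1,
        mul_inv_rev]
      congr 1
      group
    intro o a
    have key : ∀ l, IsPath a o l → X.symm Y o * ((X.tensor Y).transport o a : H →L[ℂ] H) =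
        ((Y.tensor X).transport o a : H →L[ℂ] H) * X.symm Y a := by
      intro l hl
      induction hl with
      | single b => rw [← apply_eq_transport, ← apply_eq_transport, hb]
      | cons b h ih =>
        rw [← (X.tensor Y).transport_coe_mul _ b.d1, ← (Y.tensor X).transport_coe_mul _ b.d1,
          ← mul_assoc, ← apply_eq_transport, hb, mul_assoc, ih, ← mul_assoc, apply_eq_transport]
    exact key _ (S.path_isPath o a)
  -- the relation for degenerate simplices
  have hdeg : ∀ (g : P) (a : K), N.α g⁻¹ (X.symm Y (g • a)) *
      ((X.tensor Y) g (Simplex1.degen a) : H →L[ℂ] H) =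
      ((Y.tensor X) g (Simplex1.degen a) : H →L[ℂ] H) * X.symm Y a := by
    intro g a
    have hform : ∀ a o t : K, S.perp o a → S.perp t a → S.perp t o → X.symm Y a =
        (Y.transport a o : H →L[ℂ] H) * X.transport a t * Y.transport o a * X.transport t a := by
      intro a o t ho ht hto
      rw [X.symm_eq_pair Y a (S.perp_symm _ _ ho), Y.pair_snd, Y.transport_inv, pair,
        X.transport_self, one_mul,
        X.dressed_of_perp Y (S.perp_symm _ _ hto) (S.perp_symm _ _ ht)]
      simp only [Submonoid.coe_mul, mul_assoc]
    have ho := S.disj_perp a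
    set o := S.disj a
    obtain ⟨t, hto, hta⟩ := S.exists_perp_of_perp o a ho
    have ho' := S.perp_symm _ _ ho
    have hto' := S.perp_symm _ _ hto
    have hta' := S.perp_symm _ _ hta
    have hten : ∀ (X Y : Cocycle N) (t : K), S.perp t a →
        ((X.tensor Y) g (Simplex1.degen a) : H →L[ℂ] H) =
        X g (Simplex1.degen a) * ((X.transport a t : H →L[ℂ] H) * Y g (Simplex1.degen a) *
          X.transport t a) := by
      intro X Y t ht
      change (X g (Simplex1.degen a) : H →L[ℂ] H) * X.rho a a (Y g (Simplex1.degen a)) = _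
      rw [X.rho_eq a ht (Y.mem_alg g (Simplex1.degen a))]
    have hα : ∀ (X : Cocycle N) (s u : K), N.α g⁻¹ (X.transport (g • s) (g • u)) =
        (X g (Simplex1.degen s) : H →L[ℂ] H) * X.transport s u * star (X g (Simplex1.degen u) :
          H →L[ℂ] H) := by
      intro X s u
      rw [← X.transport_covariance, mul_assoc,
        Unitary.mul_star_self_of_mem (X g (Simplex1.degen u)).2, mul_one]
    rw [hform (g • a) (g • o) (g • t) (S.smul_perp g _ _ ho) (S.smul_perp g _ _ hta)
      (S.smul_perp g _ _ hto), hform a o t ho hta hto, hten X Y t hta, hten Y X o ho]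
    simp only [map_mul, hα]
    have hX : ∀ s, (X g (Simplex1.degen s) : H →L[ℂ] H) ∈ N.alg s := fun s =>
      X.mem_alg g (Simplex1.degen s)
    have hY : ∀ s, (Y g (Simplex1.degen s) : H →L[ℂ] H) ∈ N.alg s := fun s =>
      Y.mem_alg g (Simplex1.degen s)
    -- all of the following elements are handled in the group of unitaries
    have c1 : X g (Simplex1.degen t) * Y g (Simplex1.degen a) =
        Y g (Simplex1.degen a) * X g (Simplex1.degen t) :=
      Subtype.ext (N.causality _ _ hta _ (hX t) _ (hY a))
    have c2 : X g (Simplex1.degen t) * Y.transport o a = Y.transport o a * X g (Simplex1.degen t) :=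
      Subtype.ext (Y.transport_comm hto' hta' (hX t)).symm
    have c3 : X g (Simplex1.degen t) * Y g (Simplex1.degen o) =
        Y g (Simplex1.degen o) * X g (Simplex1.degen t) :=
      Subtype.ext (N.causality _ _ hto _ (hX t) _ (hY o))
    have c4 : Y g (Simplex1.degen o) * X.transport a t = X.transport a t * Y g (Simplex1.degen o) :=
      Subtype.ext (X.transport_comm ho' hto (hY o)).symm
    have c5 : Y g (Simplex1.degen o) * X g (Simplex1.degen a) =
        X g (Simplex1.degen a) * Y g (Simplex1.degen o) :=
      Subtype.ext (N.causality _ _ ho _ (hY o) _ (hX a))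
    have i1 := Y.transport_inv o a
    have i2 := X.transport_inv t a
    generalize X g (Simplex1.degen a) = Xa at *
    generalize X g (Simplex1.degen t) = Xt at *
    generalize Y g (Simplex1.degen a) = Ya at *
    generalize Y g (Simplex1.degen o) = Yo at *
    generalize X.transport a t = u at *
    generalize X.transport t a = u' at *
    generalize Y.transport o a = v at *
    generalize Y.transport a o = v' at *
    subst i1 i2
    have fin : Ya * v⁻¹ * Yo⁻¹ * (Xa * u'⁻¹ * Xt⁻¹) * (Yo * v * Ya⁻¹) * (Xt * u' * Xa⁻¹) *
        (Xa * (u'⁻¹ * Ya * u')) = Ya * (v⁻¹ * Xa * v) * (v⁻¹ * u'⁻¹ * v * u') := by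
      calc _ = Ya * v⁻¹ * Yo⁻¹ * (Xa * u'⁻¹ * Xt⁻¹) * (Yo * v * Ya⁻¹) * (Xt * Ya) * u' := by group
        _ = Ya * v⁻¹ * Yo⁻¹ * (Xa * u'⁻¹ * Xt⁻¹) * Yo * (v * Xt) * u' := by rw [c1]; group
        _ = Ya * v⁻¹ * Yo⁻¹ * (Xa * u'⁻¹ * Xt⁻¹) * (Yo * Xt) * v * u' := by rw [← c2]; group
        _ = Ya * v⁻¹ * Yo⁻¹ * Xa * (u'⁻¹ * Yo) * v * u' := by rw [← c3]; group
        _ = Ya * v⁻¹ * Yo⁻¹ * (Xa * Yo) * u'⁻¹ * v * u' := by rw [← c4]; group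
        _ = _ := by rw [← c5]; group
    exact congrArg Subtype.val fin
  intro g b
  have h1 := hone b.d0 b.d1
  rw [(X.tensor Y).apply_eq_right, (Y.tensor X).apply_eq_right, ← mul_assoc, hdeg, mul_assoc, h1,
    mul_assoc]

theorem tensorField_one_mem {X Z Y : Cocycle N} {t : K → (H →L[ℂ] H)}
    (ht : t ∈ Hom (X.tensor Z) (X.tensor Y)) (W : Cocycle N) :
    tensorField (X.tensor Z) t 1 ∈ Hom (X.tensor (Z.tensor W)) (X.tensor (Y.tensor W)) := by
  rw [← tensor_assoc, ← tensor_assoc]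
  exact tensorField_mem ht (one_mem_hom W)

theorem whisker_mem {X Z Y Z' Y' : Cocycle N} {s t r : K → (H →L[ℂ] H)}
    (hs : s ∈ Hom Y Y') (ht : t ∈ Hom (X.tensor Z) (X.tensor Y)) (hr : r ∈ Hom Z' Z) :
    tensorField X 1 s * t * tensorField X 1 r ∈ Hom (X.tensor Z') (X.tensor Y') :=
  mul_mem_hom (mul_mem_hom (tensorField_mem (one_mem_hom X) hs) ht)
    (tensorField_mem (one_mem_hom X) hr)

/-- A left inverse of `X`: linear maps `φ_{Z,Y} : (X ⊗ Z, X ⊗ Y) → (Z, Y)` with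
`φ_{Z⊗W,Y⊗W}(t ⊗ 1_W) = φ_{Z,Y}(t) ⊗ 1_W` and
`φ_{Z',Y'}((1_X ⊗ s) · t · (1_X ⊗ r)) = s · φ_{Z,Y}(t) · r`. -/
structure LeftInverse (X : Cocycle N) where
  φ : ∀ Z Y : Cocycle N, Hom (X.tensor Z) (X.tensor Y) →ₗ[ℂ] Hom Z Y
  map_tensor_one : ∀ (Z Y W : Cocycle N) (t : Hom (X.tensor Z) (X.tensor Y)),
    (φ (Z.tensor W) (Y.tensor W) ⟨_, tensorField_one_mem t.2 W⟩ : K → (H →L[ℂ] H)) =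
      tensorField Z (φ Z Y t) 1
  map_whisker : ∀ (Z Y Z' Y' : Cocycle N) (s : Hom Y Y') (t : Hom (X.tensor Z) (X.tensor Y))
    (r : Hom Z' Z),
    (φ Z' Y' ⟨_, whisker_mem s.2 t.2 r.2⟩ : K → (H →L[ℂ] H)) = s * φ Z Y t * r

/-- Positive elements of the `C*`-algebra `(X, X)`. -/
def IsPositive {X : Cocycle N} (t : Hom X X) : Prop :=
  ∃ s ∈ Hom X X, (t : K → (H →L[ℂ] H)) = star s * s

/-- A left inverse is standard if it is positive, normalized, and
`(φ_{X,X}(ε(X, X)))² = c · 1_X` for some `c > 0`. -/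
structure LeftInverse.IsStandard {X : Cocycle N} (L : LeftInverse X) : Prop where
  positive : ∀ (Y : Cocycle N) (t : Hom (X.tensor Y) (X.tensor Y)),
    IsPositive t → IsPositive (L.φ Y Y t)
  normalized : (L.φ (unit N) (unit N) ⟨1, one_mem_hom _⟩ : K → (H →L[ℂ] H)) = 1
  exists_sq : ∃ c : ℝ, 0 < c ∧
    (L.φ X X ⟨X.symm X, symm_mem_hom X X⟩ : K → (H →L[ℂ] H)) ^ 2 =
      (c : ℂ) • (1 : K → (H →L[ℂ] H))

/-- A covariant `1`-cocycle has finite statistics if it admits a standard left inverse. -/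
def HasFiniteStatistics (X : Cocycle N) : Prop := ∃ L : LeftInverse X, L.IsStandard

/-- `X'` is a conjugate of `X`: there are `r ∈ (I, X' ⊗ X)` and `r' ∈ (I, X ⊗ X')` with
`(r'^* ⊗ 1_X) · (1_X ⊗ r) = 1_X` and `(r^* ⊗ 1_{X'}) · (1_{X'} ⊗ r') = 1_{X'}`. -/
def IsConjugate (X X' : Cocycle N) : Prop :=
  ∃ r ∈ Hom (unit N) (X'.tensor X), ∃ r' ∈ Hom (unit N) (X.tensor X'),
    tensorField (X.tensor X') (star r') 1 * tensorField X 1 r = 1 ∧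
      tensorField (X'.tensor X) (star r) 1 * tensorField X' 1 r' = 1

end Cocycle

end Net

end CovariantSectors

/-!
The proof is the determinant argument of Doplicher, Haag and Roberts, carried out in the symmetric
tensor category of covariant cocycles.

*The calculus.* An arrow `t ⊗ 1` is `t` as a field, and `1_X ⊗ s` is the value at `s` of a star
endomorphism `X.endo` of the algebra of fields. Arrows intertwine these endomorphisms (`hom_endo`),
and the symmetry is unitary, natural and satisfies the hexagon identities (`symm_mul_symm`,
`symm_mul_of_mem`, `symm_tensor_left`), because `ε(X, Y)_a` is a commutator of transporters between
mutually disjoint regions (`symm_eq_commutator`). The Borchers property provides subobjects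
(`exists_subobject`), and duality provides an inverse for a cocycle `Z` for which `ε(Z, Z)` is a scalar
(`exists_tensor_eq_unit`).

*The statistics parameter.* Let `φ` be a standard left inverse of `X` and `φ(ε(X, X)) = c κ`, with
`c > 0` and a self-adjoint unitary `κ ∈ (X, X)`. The symmetry twisted by `κ` is an exchange operator
`τ` with `φ(τ) = c` and satisfies the relations of the permutation groups
(`isExchange_twistedSymm`), so that it defines antisymmetrizers `A_n ∈ (X^{⊗n}, X^{⊗n})`. From
`φ(A_{n+1}) = (n + 1)⁻¹ (1 - n c) A_n` and positivity, `c = 1 / d` for an integer `d` with `A_d ≠ 0`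
(`exists_dimension`). As `φ` is faithful (`eq_zero_of_app_star_mul_self`), `A_{d+1} = 0`.

*The determinant.* Let `w ∈ (Z, X^{⊗d})` be an isometry with range projection `A_d`. The left inverse
of `Z` induced by `φ` takes a value of square `1` on `ε(Z, Z)`, and by faithfulness `ε(Z, Z)` is a
scalar (`exists_determinant`). So `Z` has an inverse `Z'`, and `w` is an arrow
`s ∈ (I, X ⊗ Y)` for `Y = X^{⊗(d-1)} ⊗ Z'`. The vanishing of `A_{d+1}` yields
`(1_X ⊗ s^*) · (ε(X, X) ⊗ 1_Y) · (1_X ⊗ s) = c κ`.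

*The conjugate.* With `r = ε(X, Y) s` the last identity is one of the two conjugate equations, up to
the invertible factor `c κ`. The other composite is then a projection in `(Y, Y)`, and the conjugate
is the corresponding subobject of `Y`; its left inverse is implemented by the restriction of `s`
(`exists_conjugate_of_arrow`).
-/

namespace CovariantSectors

variable {K P : Type*} [PartialOrder K] [Group P] [MulAction P K]
variable {H : Type*} [NormedAddCommGroup H] [InnerProductSpace ℂ H] [CompleteSpace H]
variable {S : IndexSet K P} {N : ObservableNet S H}

/-! ### Localized fields and the endomorphism of a cocycle -/

/-- A field of operators `s_a`, `a ∈ K`, is localized if `s_a ∈ 𝒜(a)`. -/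
def Localized (N : ObservableNet S H) (s : K → (H →L[ℂ] H)) : Prop := ∀ a, s a ∈ N.alg a

namespace Localized

theorem star {s : K → (H →L[ℂ] H)} (hs : Localized N s) : Localized N (star s) := fun a => star_mem (hs a)

end Localized

namespace Cocycle

/-- The endomorphism `s ↦ 1_X ⊗ s` of fields, `(1_X ⊗ s)_a = ρ^X(a)_a(s_a)`. Since `t ⊗ 1` is `t` as a
field, the monoidal structure on arrows is entirely encoded in these endomorphisms. -/
noncomputable def endo (X : Cocycle N) : (K → (H →L[ℂ] H)) →⋆ₐ[ℂ] (K → (H →L[ℂ] H)) where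
  toFun s a := X.rho a a (s a)
  map_one' := by ext1; simp
  map_mul' s t := by ext1; simp
  map_zero' := by ext1; simp
  map_add' s t := by ext1; simp
  commutes' c := by ext1; simp [Algebra.algebraMap_eq_smul_one]
  map_star' s := funext fun a => (X.rho a a).map_star' (s a)

theorem endo_apply (X : Cocycle N) (s : K → (H →L[ℂ] H)) (a : K) :
    X.endo s a = X.rho a a (s a) := rfl

theorem tensorField_eq (X : Cocycle N) (t s : K → (H →L[ℂ] H)) :
    tensorField X t s = t * X.endo s := rfl

theorem localized_endo (X : Cocycle N) {s : K → (H →L[ℂ] H)} (hs : Localized N s) :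
    Localized N (X.endo s) := fun a => X.rho_mem le_rfl (hs a)

theorem endo_tensor (X Y : Cocycle N) {s : K → (H →L[ℂ] H)} (hs : Localized N s) :
    (X.tensor Y).endo s = X.endo (Y.endo s) := funext fun a => X.rho_tensor Y le_rfl (hs a)

theorem unit_transport (o a : K) : (unit N).transport o a = 1 := by
  rw [← (unit N).prod_eq_transport (S.path_isPath o a)]
  exact List.prod_eq_one fun u hu => by
    obtain ⟨b, -, rfl⟩ := List.mem_map.1 hu
    rfl

theorem endo_unit (s : K → (H →L[ℂ] H)) : (unit N).endo s = s := by
  ext1 a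
  rw [endo_apply, rho, unit_transport]
  simp

/-- Arrows intertwine the endomorphisms: `t · (1_X ⊗ s) = (1_Y ⊗ s) · t`. -/
theorem hom_endo {X Y : Cocycle N} {t s : K → (H →L[ℂ] H)} (ht : t ∈ Hom X Y)
    (hs : Localized N s) : t * X.endo s = Y.endo s * t :=
  funext fun a => hom_rho ht a (hs a)

theorem star_mem_hom {X Y : Cocycle N} {t : K → (H →L[ℂ] H)} (ht : t ∈ Hom X Y) :
    star t ∈ Hom Y X := by
  refine ⟨Localized.star ht.1, fun g b => ?_⟩
  have h := congrArg star (ht.2 g b)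
  have hst : N.α g⁻¹ (star (t (g • b.d0))) = star (N.α g⁻¹ (t (g • b.d0))) :=
    (N.α g⁻¹).map_star' _
  rw [star_mul, star_mul, ← hst] at h
  have hX := Unitary.mul_star_self_of_mem (X g b).2
  have hY := Unitary.star_mul_self_of_mem (Y g b).2
  calc N.α g⁻¹ (star t (g • b.d0)) * (Y g b : H →L[ℂ] H)
      = (X g b * star (X g b : H →L[ℂ] H)) * N.α g⁻¹ (star (t (g • b.d0))) * Y g b := by
        rw [hX, one_mul]; rfl
    _ = X g b * (star (X g b : H →L[ℂ] H) * N.α g⁻¹ (star (t (g • b.d0)))) * Y g b := by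
        simp only [mul_assoc]
    _ = X g b * star t b.d1 := by rw [h, mul_assoc, mul_assoc, hY, mul_one]; rfl

/-- The arrow `1_X ⊗ s`. -/
theorem endo_mem (X : Cocycle N) {Z L : Cocycle N} {s : K → (H →L[ℂ] H)} (hs : s ∈ Hom Z L) :
    X.endo s ∈ Hom (X.tensor Z) (X.tensor L) := by
  simpa [tensorField_eq] using tensorField_mem (one_mem_hom X) hs

/-- The arrow `t ⊗ 1_Z`, which is `t` as a field. -/
theorem mem_tensor_right {X Y : Cocycle N} {t : K → (H →L[ℂ] H)} (ht : t ∈ Hom X Y)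
    (Z : Cocycle N) : t ∈ Hom (X.tensor Z) (Y.tensor Z) := by
  simpa [tensorField_eq] using tensorField_mem ht (one_mem_hom Z)

theorem tensor_unit (X : Cocycle N) : X.tensor (unit N) = X := by
  ext g b : 4
  change (X g b : H →L[ℂ] H) * X.rho b.d1 b.supp 1 = X g b
  rw [map_one, mul_one]

theorem unit_tensor (X : Cocycle N) : (unit N).tensor X = X := by
  ext g b : 4
  change ((1 : unitary (H →L[ℂ] H)) : H →L[ℂ] H) * (unit N).rho b.d1 b.supp (X g b) = X g b
  rw [rho, unit_transport]
  simp

/-- The arrows of the unit cocycle are the scalars. -/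
theorem exists_eq_smul_one_of_mem_unit [Nonempty K] {t : K → (H →L[ℂ] H)}
    (ht : t ∈ Hom (unit N) (unit N)) : ∃ z : ℂ, t = z • 1 := by
  have hconst : ∀ o a, t o = t a := fun o a => by
    simpa [unit_transport] using hom_transport ht o a
  obtain ⟨o⟩ := ‹Nonempty K›
  have hcomm : ∀ T : H →L[ℂ] H, (∀ a, T ∈ N.alg a) → ∀ a, ∀ A ∈ N.alg a, T * A = A * T :=
    fun T hT a A hA => N.causality _ _ (S.disj_perp a) _ (hT _) _ hA
  have hall : ∀ a, t o ∈ N.alg a := fun a => hconst a o ▸ ht.1 a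
  have hmem : t o ∈ Set.centralizer (globalAlgebra N.alg : Set (H →L[ℂ] H)) := by
    have hle : globalAlgebra N.alg ≤ StarSubalgebra.centralizer ℂ {t o} := by
      refine StarSubalgebra.topologicalClosure_minimal (StarAlgebra.adjoin_le ?_) ?_
      · intro A hA
        obtain ⟨a, ha⟩ := Set.mem_iUnion.1 hA
        rw [SetLike.mem_coe, StarSubalgebra.mem_centralizer_iff]
        rintro g rfl
        exact ⟨hcomm _ hall _ _ ha, hcomm _ (fun a => star_mem (hall a)) _ _ ha⟩
      · exact Set.isClosed_centralizer _
    intro A hA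
    exact ((StarSubalgebra.mem_centralizer_iff ℂ).1 (hle hA) _ rfl).1.symm
  have := N.factoriality.subset ⟨hmem, N.alg_subset_global o (ht.1 o)⟩
  obtain ⟨z, hz⟩ := this
  exact ⟨z, funext fun a => by rw [hconst a o, ← hz]; rfl⟩

/-! ### The symmetry -/

theorem exists_disjoint_triple (S : IndexSet K P) (a : K) :
    ∃ o v, S.perp o a ∧ S.perp v a ∧ S.perp v o := by
  obtain ⟨v, hv, hva⟩ := S.exists_perp_of_perp _ _ (S.disj_perp a)
  exact ⟨S.disj a, v, S.disj_perp a, hva, hv⟩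

/-- The symmetry as a commutator of transporters between mutually disjoint regions. -/
theorem symm_eq_commutator (X Y : Cocycle N) {a o v : K} (ho : S.perp o a) (hv : S.perp v a)
    (hvo : S.perp v o) : X.symm Y a = (Y.transport a o : H →L[ℂ] H) * X.transport a v *
      Y.transport o a * X.transport v a := by
  rw [X.symm_eq_pair Y a (S.perp_symm _ _ ho), Y.pair_snd, Y.transport_inv, pair,
    X.transport_self, one_mul, X.dressed_of_perp Y (S.perp_symm _ _ hvo) (S.perp_symm _ _ hv)]
  simp only [Submonoid.coe_mul, mul_assoc]

theorem localized_symm (X Y : Cocycle N) : Localized N (X.symm Y) := X.symm_mem_alg Y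

@[simp]
theorem symm_mul_symm (X Y : Cocycle N) : Y.symm X * X.symm Y = 1 := by
  funext a
  have h := S.disj_perp a
  rw [Pi.mul_apply, X.symm_eq_pair Y a h, Y.symm_eq_pair X a (S.perp_symm _ _ h),
    ← Submonoid.coe_mul]
  simp [mul_assoc]

theorem star_symm (X Y : Cocycle N) : star (X.symm Y) = Y.symm X := by
  funext a
  have h := S.disj_perp a
  rw [Pi.star_apply, X.symm_eq_pair Y a h, Y.symm_eq_pair X a (S.perp_symm _ _ h),
    ← Unitary.coe_star, Unitary.star_eq_inv]
  simp

/-- Naturality of the symmetry in the first argument. -/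
theorem symm_mul_of_mem {X X' : Cocycle N} {t : K → (H →L[ℂ] H)} (ht : t ∈ Hom X X')
    (Y : Cocycle N) : X'.symm Y * t = Y.endo t * X.symm Y := by
  funext a
  obtain ⟨o, v, ho, hv, hvo⟩ := exists_disjoint_triple S a
  rw [Pi.mul_apply, Pi.mul_apply, X'.symm_eq_commutator Y ho hv hvo,
    X.symm_eq_commutator Y ho hv hvo, endo_apply, Y.rho_eq a ho (ht.1 a), mul_assoc _ _ (t a),
    ← hom_transport ht v a]
  have h1 := Y.transport_comm (S.perp_symm _ _ hvo) (S.perp_symm _ _ hv) (ht.1 v)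
  have h2 := hom_transport ht a v
  have h3 := Y.transport_coe_mul o a o
  rw [Y.transport_self] at h3
  calc _ = (Y.transport a o : H →L[ℂ] H) * X'.transport a v * (Y.transport o a * t v) *
        X.transport v a := by simp only [mul_assoc]
    _ = (Y.transport a o : H →L[ℂ] H) * (t a * X.transport a v) * Y.transport o a *
        X.transport v a := by rw [h1, h2]; simp only [mul_assoc]
    _ = (Y.transport a o : H →L[ℂ] H) * t a * ((Y.transport o a : H →L[ℂ] H) * Y.transport a o) *
        X.transport a v * Y.transport o a * X.transport v a := by
      rw [h3]; simp [mul_assoc]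
    _ = _ := by simp only [mul_assoc]

/-- Naturality of the symmetry in the second argument. -/
theorem symm_mul_endo_of_mem (X : Cocycle N) {Y Y' : Cocycle N} {s : K → (H →L[ℂ] H)}
    (hs : s ∈ Hom Y Y') : X.symm Y' * X.endo s = s * X.symm Y := by
  have h := symm_mul_of_mem hs X
  calc X.symm Y' * X.endo s = X.symm Y' * (X.endo s * Y.symm X) * X.symm Y := by
        simp [mul_assoc]
    _ = s * X.symm Y := by rw [← h, ← mul_assoc, symm_mul_symm, one_mul]

/-- `ε(X ⊗ Y, Z) = (ε(X, Z) ⊗ 1_Y) · (1_X ⊗ ε(Y, Z))`. -/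
theorem symm_tensor_left (X Y Z : Cocycle N) :
    (X.tensor Y).symm Z = X.symm Z * X.endo (Y.symm Z) := by
  funext a
  obtain ⟨o, v, ho, hv, hvo⟩ := exists_disjoint_triple S a
  obtain ⟨t, htv, hta⟩ := S.exists_perp_of_perp _ _ hv
  have hat := S.perp_symm _ _ hta
  have hvt := S.perp_symm _ _ htv
  have key : (X.tensor Y).transport a v * Y.symm X v =
      (X.transport a v : H →L[ℂ] H) * Y.transport a v := by
    rw [Y.symm_eq_commutator X htv (S.perp_symm _ _ hv) hat, X.tensor_transport Y hat hvt]
    have h1 := X.transport_coe_mul t v t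
    have h2 := X.transport_coe_mul a t v
    have h3 := Y.transport_coe_mul a v a
    rw [X.transport_self] at h1
    rw [Y.transport_self] at h3
    simp only [Submonoid.coe_mul]
    calc _ = (X.transport a t : H →L[ℂ] H) * Y.transport a v *
          ((X.transport t v : H →L[ℂ] H) * X.transport v t) * Y.transport v a * X.transport t v *
          Y.transport a v := by simp only [mul_assoc]
      _ = (X.transport a t : H →L[ℂ] H) * (Y.transport a v * Y.transport v a) * X.transport t v *
          Y.transport a v := by rw [h1]; simp [mul_assoc]
      _ = _ := by rw [h3]; simp [← h2, mul_assoc]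
  have key2 : (X.tensor Y).transport a v =
      (X.transport a v : H →L[ℂ] H) * Y.transport a v * X.symm Y v := by
    rw [← key, mul_assoc]
    have := congrFun (X.symm_mul_symm Y) v
    rw [Pi.mul_apply, Pi.one_apply] at this
    rw [this, mul_one]
  have key3 : ((X.tensor Y).transport v a : H →L[ℂ] H) =
      Y.symm X v * Y.transport v a * X.transport v a := by
    have := congrArg star key2
    rw [star_mul, star_mul, transport_coe_star, transport_coe_star, transport_coe_star,
      ← Pi.star_apply, star_symm] at this
    rw [this, mul_assoc]
  rw [Pi.mul_apply, (X.tensor Y).symm_eq_commutator Z ho hv hvo, X.symm_eq_commutator Z ho hv hvo,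
    endo_apply, Y.symm_eq_commutator Z ho hv hvo, X.rho_eq a hv, key2, key3]
  · have h1 := Z.transport_comm (S.perp_symm _ _ hvo) (S.perp_symm _ _ hv) (X.symm_mem_alg Y v)
    have h2 := congrFun (Y.symm_mul_symm X) v
    have h3 := Z.transport_coe_mul o a o
    have h4 := X.transport_coe_mul v a v
    rw [Pi.mul_apply, Pi.one_apply] at h2
    rw [Z.transport_self] at h3
    rw [X.transport_self] at h4
    calc _ = (Z.transport a o : H →L[ℂ] H) * X.transport a v * Y.transport a v *
          (X.symm Y v * Z.transport o a) * Y.symm X v * Y.transport v a * X.transport v a := by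
          simp only [mul_assoc]
      _ = (Z.transport a o : H →L[ℂ] H) * X.transport a v * Y.transport a v * Z.transport o a *
          (X.symm Y v * Y.symm X v) * Y.transport v a * X.transport v a := by
          rw [← h1]; simp only [mul_assoc]
      _ = (Z.transport a o : H →L[ℂ] H) * X.transport a v * ((Z.transport o a : H →L[ℂ] H) *
          (((X.transport v a : H →L[ℂ] H) * X.transport a v) * Z.transport a o)) *
          Y.transport a v * Z.transport o a * Y.transport v a * X.transport v a := by
          rw [h2, h4]; simp only [Submonoid.coe_one, one_mul, mul_one]; rw [h3]; simp [mul_assoc]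
      _ = _ := by simp only [mul_assoc]
  · rw [← Y.symm_eq_commutator Z ho hv hvo]; exact Y.symm_mem_alg Z a

/-- `ε(X, Y ⊗ Z) = (1_Y ⊗ ε(X, Z)) · (ε(X, Y) ⊗ 1_Z)`. -/
theorem symm_tensor_right (X Y Z : Cocycle N) :
    X.symm (Y.tensor Z) = Y.endo (X.symm Z) * X.symm Y := by
  rw [← star_symm, symm_tensor_left, star_mul, ← map_star, star_symm, star_symm]

theorem unit_symm (X : Cocycle N) : (unit N).symm X = 1 := by
  have h := symm_tensor_left (unit N) (unit N) X
  rw [endo_unit, tensor_unit] at h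
  have h2 := (unit N).symm_mul_symm X
  calc (unit N).symm X = X.symm (unit N) * ((unit N).symm X * (unit N).symm X) := by
        rw [← mul_assoc, h2, one_mul]
    _ = 1 := by rw [← h, h2]

/-- The braid relation for `ε(X, X)`. -/
theorem symm_braid (X : Cocycle N) : X.symm X * X.endo (X.symm X) * X.symm X =
    X.endo (X.symm X) * X.symm X * X.endo (X.symm X) := by
  have h := symm_mul_of_mem (X.symm_mem_hom X) X
  rwa [symm_tensor_left, ← mul_assoc] at h

/-! ### Subobjects -/

theorem transport_mem (X : Cocycle N) {o a s : K} (ho : o ≤ s) (ha : a ≤ s) :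
    (X.transport o a : H →L[ℂ] H) ∈ N.alg s := by
  have h := X.mem_alg 1 ⟨o, a, s, ho, ha⟩
  rwa [X.apply_eq_transport] at h

theorem ne_zero_of_mem_hom {X : Cocycle N} {t : K → (H →L[ℂ] H)} (ht : t ∈ Hom X X)
    (h : t ≠ 0) (a : K) : t a ≠ 0 := by
  intro ha
  refine h (funext fun o => ?_)
  have h1 := hom_transport ht o a
  rw [ha, mul_zero] at h1
  calc t o = t o * X.transport o a * X.transport a o := by
        rw [mul_assoc, X.transport_coe_mul, X.transport_self]; simp
    _ = 0 := by rw [h1, zero_mul]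

/-- A field of isometries `W_a ∈ 𝒜(a)` whose range projections form an arrow `E ∈ (Y, Y)` defines a
cocycle, namely `(g, b) ↦ α_g⁻¹(W_{g∂₀b}^*) Y_b(g) W_{∂₁b}`. -/
noncomputable def compress (Y : Cocycle N) (W : K → (H →L[ℂ] H)) (hW : Localized N W)
    (h1 : star W * W = 1) (hE : W * star W ∈ Hom Y Y) : Cocycle N where
  toFun g b := ⟨N.α g⁻¹ (star (W (g • b.d0))) * Y g b * W b.d1, by
    have h1' : ∀ a, star (W a) * W a = 1 := fun a => congrFun h1 a
    have hst : ∀ A, N.α g⁻¹ (star A) = star (N.α g⁻¹ A) := (N.α g⁻¹).map_star'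
    have hYl := Unitary.star_mul_self_of_mem (Y g b).2
    have hYr := Unitary.mul_star_self_of_mem (Y g b).2
    have hE' : N.α g⁻¹ (W (g • b.d0)) * star (N.α g⁻¹ (W (g • b.d0))) * Y g b =
        Y g b * (W b.d1 * star (W b.d1)) := by
      have := hE.2 g b
      rwa [Pi.mul_apply, Pi.star_apply, map_mul, hst] at this
    have h2 : star (N.α g⁻¹ (W (g • b.d0))) * N.α g⁻¹ (W (g • b.d0)) = 1 := by
      rw [← hst, ← map_mul, h1', map_one]
    have h3 := h1' b.d1
    rw [Unitary.mem_iff, hst]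
    generalize N.α g⁻¹ (W (g • b.d0)) = A at *
    generalize W b.d1 = B at *
    generalize (Y g b : H →L[ℂ] H) = U at *
    simp only [star_mul, star_star]
    constructor
    · calc star B * (star U * A) * (star A * U * B) = star B * star U * (A * star A * U) * B := by
            simp only [mul_assoc]
        _ = star B * (star U * U) * B * (star B * B) := by rw [hE']; simp only [mul_assoc]
        _ = 1 := by rw [hYl, h3, mul_one, mul_one, h3]
    · calc star A * U * B * (star B * (star U * A)) = star A * (U * (B * star B)) * star U * A := by
            simp only [mul_assoc]
        _ = (star A * A) * star A * (U * star U) * A := by rw [← hE']; simp only [mul_assoc]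
        _ = 1 := by rw [hYr, h2, mul_one, one_mul, h2]⟩
  mem_alg g b := mul_mem (mul_mem (N.isotony _ _ b.d0_le (N.α_inv_mem g (star_mem (hW _))))
    (Y.mem_alg g b)) (N.isotony _ _ b.d1_le (hW _))
  cocycle g g' c := by
    have hE' := hE.2 g c.d2
    have h1' : ∀ a, star (W a) * W a = 1 := fun a => congrFun h1 a
    simp only [Pi.mul_apply, Pi.star_apply, map_mul] at hE'
    have hα : ∀ A, N.α (g' * g)⁻¹ A = N.α g⁻¹ (N.α g'⁻¹ A) := fun A => by
      rw [mul_inv_rev, map_mul]; rfl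
    change N.α (g' * g)⁻¹ (star (W ((g' * g) • c.d1.d0))) * Y (g' * g) c.d1 * W c.d1.d1 =
      N.α g⁻¹ (N.α g'⁻¹ (star (W (g' • g • c.d0.d0))) * Y g' (S.act g c.d0) * W (g • c.d0.d1)) *
        (N.α g⁻¹ (star (W (g • c.d2.d0))) * Y g c.d2 * W c.d2.d1)
    rw [hα, Y.cocycle, smul_smul, c.d00_eq, c.d10_eq, c.d11_eq, map_mul, map_mul]
    symm
    calc _ = N.α g⁻¹ (N.α g'⁻¹ (star (W ((g' * g) • c.d1.d0)))) *
          N.α g⁻¹ (Y g' (S.act g c.d0)) * (N.α g⁻¹ (W (g • c.d2.d0)) *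
          N.α g⁻¹ (star (W (g • c.d2.d0))) * Y g c.d2) * W c.d2.d1 := by simp only [mul_assoc]
      _ = N.α g⁻¹ (N.α g'⁻¹ (star (W ((g' * g) • c.d1.d0)))) *
          N.α g⁻¹ (Y g' (S.act g c.d0)) * Y g c.d2 * W c.d2.d1 *
          (star (W c.d2.d1) * W c.d2.d1) := by rw [hE']; simp only [mul_assoc]
      _ = _ := by rw [h1', mul_one]; simp only [mul_assoc]

theorem mem_compress (Y : Cocycle N) {W : K → (H →L[ℂ] H)} (hW : Localized N W)
    (h1 : star W * W = 1) (hE : W * star W ∈ Hom Y Y) : W ∈ Hom (Y.compress W hW h1 hE) Y := by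
  refine ⟨hW, fun g b => ?_⟩
  have hE' := hE.2 g b
  have h1' : star (W b.d1) * W b.d1 = 1 := congrFun h1 _
  rw [Pi.mul_apply, Pi.mul_apply, Pi.star_apply, Pi.star_apply, map_mul] at hE'
  change N.α g⁻¹ (W (g • b.d0)) * (N.α g⁻¹ (star (W (g • b.d0))) * Y g b * W b.d1) = _
  calc _ = N.α g⁻¹ (W (g • b.d0)) * N.α g⁻¹ (star (W (g • b.d0))) * Y g b * W b.d1 := by
        simp only [mul_assoc]
    _ = Y g b * W b.d1 * (star (W b.d1) * W b.d1) := by rw [hE']; simp only [mul_assoc]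
    _ = _ := by rw [h1', mul_one]

/-- Nonzero projections have subobjects. The Borchers property yields an isometry for a projection
of `𝒜(o)` only in a larger algebra, but the values of an arrow at `o ⊂ a` and at `a` are equivalent
in `𝒜(a)` by a transporter. -/
theorem exists_subobject {Y : Cocycle N} {E : K → (H →L[ℂ] H)} (hE : E ∈ Hom Y Y)
    (hsa : star E = E) (hid : E * E = E) (hne : E ≠ 0) :
    ∃ Z : Cocycle N, ∃ w ∈ Hom Z Y, star w * w = 1 ∧ w * star w = E := by
  have hW : ∀ a, ∃ W ∈ N.alg a, star W * W = 1 ∧ W * star W = E a := by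
    intro a
    obtain ⟨o, ho⟩ := (S.exists_sub a).1
    obtain ⟨V, hV, hV1, hV2⟩ := N.borchers o a ho (E o) (hE.1 o)
      ⟨congrFun hid o, congrFun hsa o⟩ (ne_zero_of_mem_hom hE hne o)
    have ht := Y.transport_coe_mul o a o
    have ht' := Y.transport_coe_mul a o a
    rw [Y.transport_self] at ht ht'
    refine ⟨Y.transport a o * V, mul_mem (Y.transport_mem le_rfl (S.lt_of_sub _ _ ho).le) hV,
      ?_, ?_⟩
    · rw [star_mul, Y.transport_coe_star]
      calc _ = star V * ((Y.transport o a : H →L[ℂ] H) * Y.transport a o) * V := by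
            simp only [mul_assoc]
        _ = 1 := by rw [ht]; simp [hV1]
    · rw [star_mul, Y.transport_coe_star]
      calc _ = (Y.transport a o : H →L[ℂ] H) * (V * star V) * Y.transport o a := by
            simp only [mul_assoc]
        _ = E a := by rw [hV2, ← hom_transport hE, mul_assoc, ht']; simp
  choose W hW hW1 hW2 using hW
  have h1 : star W * W = 1 := funext hW1
  have h2 : W * star W = E := funext hW2
  exact ⟨Y.compress W hW h1 (h2 ▸ hE), W, Y.mem_compress hW h1 _, h1, h2⟩

/-! ### Positive arrows -/

theorem map_sqrt (φ : (H →L[ℂ] H) ≃⋆ₐ[ℂ] (H →L[ℂ] H)) {A : H →L[ℂ] H} (hA : 0 ≤ A) :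
    φ (CFC.sqrt A) = CFC.sqrt (φ A) := by
  symm
  refine CFC.sqrt_unique (by rw [← map_mul, CFC.sqrt_mul_sqrt_self A]) ?_
  have h0 := CFC.sqrt_nonneg A
  set B := CFC.sqrt A
  have h : star (CFC.sqrt B) * CFC.sqrt B = B := by
    rw [(IsSelfAdjoint.of_nonneg (CFC.sqrt_nonneg B)).star_eq, CFC.sqrt_mul_sqrt_self B]
  have hst : φ (star (CFC.sqrt B)) = star (φ (CFC.sqrt B)) := φ.map_star' _
  rw [← h, map_mul, hst]
  exact star_mul_self_nonneg _

theorem sqrt_mem (M : VonNeumannAlgebra H) {A : H →L[ℂ] H} (hA : A ∈ M) : CFC.sqrt A ∈ M := by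
  rw [← M.commutant_commutant, VonNeumannAlgebra.mem_commutant_iff]
  intro B hB
  have h : Commute A B := VonNeumannAlgebra.mem_commutant_iff.1 hB A hA
  exact (h.cfcₙ_nnreal _).eq.symm

/-- If `v ∈ (Y, W)`, then `v^* v` is positive in `(Y, Y)`. -/
theorem exists_star_mul_self {Y W : Cocycle N} {v : K → (H →L[ℂ] H)} (hv : v ∈ Hom Y W) :
    ∃ u ∈ Hom Y Y, star v * v = star u * u := by
  have hp := mul_mem_hom (star_mem_hom hv) hv
  have h0 : ∀ a, 0 ≤ (star v * v) a := fun a => star_mul_self_nonneg (v a)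
  refine ⟨fun a => CFC.sqrt ((star v * v) a), ⟨fun a => sqrt_mem _ (hp.1 a), fun g b => ?_⟩,
    funext fun a => ?_⟩
  · have hc : ∀ A, Unitary.conjStarAlgAut ℂ (H →L[ℂ] H) (Y g b) A =
        Y g b * A * star (Y g b : H →L[ℂ] H) := fun A => rfl
    have hU := Unitary.star_mul_self_of_mem (Y g b).2
    have hU' := Unitary.mul_star_self_of_mem (Y g b).2
    have h : N.α g⁻¹ ((star v * v) (g • b.d0)) =
        Unitary.conjStarAlgAut ℂ (H →L[ℂ] H) (Y g b) ((star v * v) b.d1) := by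
      rw [hc, ← hp.2 g b, mul_assoc, hU', mul_one]
    rw [map_sqrt _ (h0 _), h, ← map_sqrt _ (h0 _), hc, mul_assoc, hU, mul_one]
  · change _ = star (CFC.sqrt ((star v * v) a)) * CFC.sqrt ((star v * v) a)
    rw [(IsSelfAdjoint.of_nonneg (CFC.sqrt_nonneg ((star v * v) a))).star_eq,
      CFC.sqrt_mul_sqrt_self _ (h0 a)]

/-! ### Invertibility of simple cocycles -/

section Inverse

variable {X : Cocycle N} {z : ℂ}

/-- If `ε(X, X)` is a scalar, the preimage of `A` under `ρ(o)_a` does not depend on the choice of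
the region disjoint from `a`. -/
theorem transport_conj_eq_of_symm (hz : X.symm X = z • 1) {o a v w : K} (ho : o ≤ a)
    (hv : S.perp v a) (hw : S.perp w a) {A : H →L[ℂ] H} (hA : A ∈ N.alg a) :
    (X.transport v o : H →L[ℂ] H) * A * X.transport o v =
      X.transport w o * A * X.transport o w := by
  have hperp : ∀ {s}, S.perp s a → S.perp s o := fun h =>
    S.perp_symm _ _ (S.perp_of_le _ _ _ (S.perp_symm _ _ h) ho)
  have hmul : ∀ s t : K, (X.transport s t : H →L[ℂ] H) * X.transport t s = 1 := fun s t => by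
    rw [X.transport_coe_mul, X.transport_self]; rfl
  have hz1 : (star z * z) • (1 : H →L[ℂ] H) = 1 := by
    have h : star (X.symm X) * X.symm X = 1 := by rw [star_symm, symm_mul_symm]
    rw [hz, star_smul, star_one, smul_mul_smul_comm, one_mul] at h
    exact congrFun h a
  -- for disjoint `s`, `t` the scalar symmetry at `o` lets transporters be interchanged
  have hdisj : ∀ s t, S.perp s a → S.perp t a → S.perp s t →
      (X.transport s o : H →L[ℂ] H) * A * X.transport o s =
        X.transport t o * A * X.transport o t := by
    intro s t hs ht hst
    have hε : (X.transport o t : H →L[ℂ] H) * X.transport o s * X.transport t o *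
        X.transport s o = z • 1 := by
      rw [← X.symm_eq_commutator X (hperp ht) (hperp hs) hst, hz]; rfl
    have hsw : (X.transport o t : H →L[ℂ] H) * X.transport o s =
        z • ((X.transport o s : H →L[ℂ] H) * X.transport o t) := by
      calc _ = ((X.transport o t : H →L[ℂ] H) * X.transport o s * X.transport t o *
            X.transport s o) * (X.transport o s * X.transport o t) := by
            rw [mul_assoc _ (X.transport s o : H →L[ℂ] H),
              ← mul_assoc (X.transport s o : H →L[ℂ] H), hmul, one_mul, mul_assoc, hmul, mul_one]
        _ = _ := by rw [hε]; simp
    have hso : (X.transport s t : H →L[ℂ] H) =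
        z • ((X.transport o t : H →L[ℂ] H) * X.transport s o) := by
      calc (X.transport s t : H →L[ℂ] H) = X.transport s o *
            ((X.transport o t : H →L[ℂ] H) * X.transport o s) * X.transport s o := by
            rw [mul_assoc, mul_assoc, hmul, mul_one, X.transport_coe_mul]
        _ = _ := by
            rw [hsw, mul_smul_comm, smul_mul_assoc, ← mul_assoc, hmul, one_mul]
    have hcomm := X.transport_comm hs ht hA
    have hQ : (X.transport o t : H →L[ℂ] H) * X.transport s o * A =
        A * ((X.transport o t : H →L[ℂ] H) * X.transport s o) := by
      rw [hso, smul_mul_assoc, mul_smul_comm] at hcomm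
      have := congrArg (fun B => star z • B) hcomm
      simp only [smul_smul] at this
      have h1 : ∀ B : H →L[ℂ] H, (star z * z) • B = B := fun B => by
        rw [← one_mul B, ← smul_mul_assoc, hz1]
      rwa [h1, h1] at this
    calc _ = (X.transport t o : H →L[ℂ] H) * ((X.transport o t : H →L[ℂ] H) * X.transport s o * A) *
          X.transport o s := by
          rw [← mul_assoc, ← mul_assoc, hmul, one_mul]
      _ = _ := by
          rw [hQ]; simp only [mul_assoc]; rw [hmul, mul_one]
  obtain ⟨l, hl, hl'⟩ := S.connected_compl a v hv w hw
  clear hv hw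
  induction hl with
  | single b =>
    obtain ⟨h1, h2, h3⟩ := hl' b (by simp)
    obtain ⟨t, ht, hta⟩ := S.exists_perp_of_perp _ _ h1
    rw [hdisj _ t h3 hta (S.perp_of_le _ _ _ (S.perp_symm _ _ ht) b.d1_le),
      hdisj _ t h2 hta (S.perp_of_le _ _ _ (S.perp_symm _ _ ht) b.d0_le)]
  | cons b h ih =>
    obtain ⟨h1, h2, h3⟩ := hl' b (by simp)
    obtain ⟨t, ht, hta⟩ := S.exists_perp_of_perp _ _ h1
    rw [ih fun b hb => hl' b (by simp [hb]),
      hdisj _ t h3 hta (S.perp_of_le _ _ _ (S.perp_symm _ _ ht) b.d1_le),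
      hdisj _ t h2 hta (S.perp_of_le _ _ _ (S.perp_symm _ _ ht) b.d0_le)]

theorem rho_symm_apply (X : Cocycle N) (o a : K) (A : H →L[ℂ] H) : (X.rho o a).symm A =
    (X.transport (S.disj a) o : H →L[ℂ] H) * A * X.transport o (S.disj a) := by
  rw [StarAlgEquiv.symm_apply_eq]
  have h := X.transport_coe_mul o (S.disj a) o
  rw [X.transport_self] at h
  symm
  calc _ = (X.transport o (S.disj a) : H →L[ℂ] H) * ((X.transport (S.disj a) o : H →L[ℂ] H) * A *
        X.transport o (S.disj a)) * X.transport (S.disj a) o := by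
        rw [← X.transport_coe_star o]; rfl
    _ = ((X.transport o (S.disj a) : H →L[ℂ] H) * X.transport (S.disj a) o) * A *
        ((X.transport o (S.disj a) : H →L[ℂ] H) * X.transport (S.disj a) o) := by
        simp only [mul_assoc]
    _ = A := by rw [h]; simp

/-- If `ε(X, X)` is a scalar, `ρ(o)_a` maps `𝒜(a)` onto itself. -/
theorem rho_symm_mem (hz : X.symm X = z • 1) {o a : K} (ho : o ≤ a) {A : H →L[ℂ] H}
    (hA : A ∈ N.alg a) : (X.rho o a).symm A ∈ N.alg a := by
  rw [rho_symm_apply, ← SetLike.mem_coe, N.duality a]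
  refine ⟨Set.mul_mem_centralizer (Set.mul_mem_centralizer (X.transport_mem_global _ _)
    (N.alg_subset_global _ hA)) (X.transport_mem_global _ _), fun s hs => ?_⟩
  rw [VonNeumannAlgebra.mem_commutant_iff]
  intro B hB
  obtain ⟨v, hvs, hva⟩ := S.exists_perp_of_perp s a hs
  have hos : S.perp o s := S.perp_of_le _ _ _ (S.perp_symm _ _ hs) ho
  rw [transport_conj_eq_of_symm hz ho (S.disj_perp a) hva hA]
  have h1 := X.transport_comm hvs hos hB
  have h2 := X.transport_comm hos hvs hB
  have h3 := N.causality _ _ hs _ hB _ hA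
  calc _ = B * X.transport v o * A * X.transport o v := by simp only [mul_assoc]
    _ = X.transport v o * (B * A) * X.transport o v := by rw [← h1]; simp only [mul_assoc]
    _ = X.transport v o * A * (B * X.transport o v) := by rw [h3]; simp only [mul_assoc]
    _ = _ := by rw [← h2]; simp only [mul_assoc]

/-- A cocycle whose symmetry is a scalar is invertible: the inverse is
`(g, b) ↦ ρ(∂₁b)_{|b|}⁻¹(X_b(g)^*)`. -/
theorem exists_tensor_eq_unit (hz : X.symm X = z • 1) : ∃ X' : Cocycle N, X.tensor X' = unit N := by
  have hmem : ∀ g b, (X.rho b.d1 b.supp).symm (star (X g b : H →L[ℂ] H)) ∈ N.alg b.supp :=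
    fun g b => rho_symm_mem hz b.d1_le (star_mem (X.mem_alg g b))
  have hunit : ∀ (g : P) (b : Simplex1 K),
      (X.rho b.d1 b.supp).symm (star (X g b : H →L[ℂ] H)) ∈ unitary (H →L[ℂ] H) := by
    intro g b
    rw [rho_symm_apply, ← Unitary.coe_star]
    have : (X.transport b.d1 (S.disj b.supp) : H →L[ℂ] H) = star
      (X.transport (S.disj b.supp) b.d1 : H →L[ℂ] H) := (X.transport_coe_star _ _).symm
    rw [this, ← Unitary.coe_star, ← Submonoid.coe_mul, ← Submonoid.coe_mul]
    exact Subtype.prop _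
  refine ⟨⟨fun g b => ⟨_, hunit g b⟩, hmem, fun g g' c => ?_⟩, ?_⟩
  · apply EquivLike.injective (X.rho c.d1.d1 c.supp)
    have hA : N.α g⁻¹ ((X.rho (S.act g c.d0).d1 (S.act g c.d0).supp).symm
        (star (X g' (S.act g c.d0) : H →L[ℂ] H))) ∈ N.alg c.supp :=
      N.isotony _ _ c.d0_supp_le (N.α_inv_mem g (hmem g' (S.act g c.d0)))
    have h := X.rho_covariance g c.d2 hA
    rw [N.α_α_inv, X.rho_of_le (a := (S.act g c.d0).supp) _ (S.smul_le g c.d0_supp_le)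
      (hmem _ _), ← c.d10_eq] at h
    have h' : (X g c.d2 : H →L[ℂ] H) * X.rho c.d2.d1 c.supp (N.α g⁻¹
        ((X.rho (S.act g c.d0).d1 (S.act g c.d0).supp).symm
        (star (X g' (S.act g c.d0) : H →L[ℂ] H)))) =
        N.α g⁻¹ (star (X g' (S.act g c.d0) : H →L[ℂ] H)) * X g c.d2 := by
      rw [h]
      exact congrArg (fun B => N.α g⁻¹ B * (X g c.d2 : H →L[ℂ] H))
        ((X.rho (S.act g c.d0).d1 (S.act g c.d0).supp).apply_symm_apply _)
    have hst : ∀ A, N.α g⁻¹ (star A) = star (N.α g⁻¹ A) := (N.α g⁻¹).map_star'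
    have hU := Unitary.star_mul_self_of_mem (X g c.d2).2
    have hU' := Unitary.mul_star_self_of_mem (X g c.d2).2
    simp only
    rw [map_mul, X.rho_of_le _ c.d1_supp_le (hmem _ _), StarAlgEquiv.apply_symm_apply, c.d11_eq,
      X.rho_of_le _ c.d2_supp_le (hmem _ _), StarAlgEquiv.apply_symm_apply, X.cocycle, star_mul,
      ← hst]
    rw [← one_mul (X.rho c.d2.d1 c.supp _), ← hU, mul_assoc (star (X g c.d2 : H →L[ℂ] H)), h',
      mul_assoc, mul_assoc, hU', mul_one]
  · ext g b : 4
    change (X g b : H →L[ℂ] H) * X.rho b.d1 b.supp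
      ((X.rho b.d1 b.supp).symm (star (X g b : H →L[ℂ] H))) = 1
    rw [StarAlgEquiv.apply_symm_apply]
    exact Unitary.mul_star_self_of_mem (X g b).2

end Inverse

/-! ### Positive normalized left inverses -/

/-- A positive normalized left inverse of `X`, given by its values on fields. The laws are required
only on arrows; outside the arrow spaces the values of `app` carry no information. Since
`t ⊗ 1_W = t` as a field, the first law of a left inverse says that `app` is stable under tensoring
with `W` on the right. -/
structure PositiveLeftInverse (X : Cocycle N) where
  app : Cocycle N → Cocycle N → (K → (H →L[ℂ] H)) → (K → (H →L[ℂ] H))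
  app_mem : ∀ {Z Y t}, t ∈ Hom (X.tensor Z) (X.tensor Y) → app Z Y t ∈ Hom Z Y
  app_add : ∀ {Z Y t s}, t ∈ Hom (X.tensor Z) (X.tensor Y) → s ∈ Hom (X.tensor Z) (X.tensor Y) →
    app Z Y (t + s) = app Z Y t + app Z Y s
  app_smul : ∀ {Z Y t} (c : ℂ), t ∈ Hom (X.tensor Z) (X.tensor Y) →
    app Z Y (c • t) = c • app Z Y t
  app_tensor : ∀ {Z Y t} (W), t ∈ Hom (X.tensor Z) (X.tensor Y) →
    app (Z.tensor W) (Y.tensor W) t = app Z Y t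
  app_whisker : ∀ {Z Y Z' Y' s t r}, s ∈ Hom Y Y' → t ∈ Hom (X.tensor Z) (X.tensor Y) →
    r ∈ Hom Z' Z → app Z' Y' (X.endo s * t * X.endo r) = s * app Z Y t * r
  app_star_mul_self : ∀ {Y t}, t ∈ Hom (X.tensor Y) (X.tensor Y) →
    ∃ s ∈ Hom Y Y, app Y Y (star t * t) = star s * s
  app_one_unit : app (unit N) (unit N) 1 = 1

open Classical in
/-- A standard left inverse as a positive normalized left inverse; `app` is extended by zero outside
the arrow spaces. -/
noncomputable def LeftInverse.IsStandard.toPositive {X : Cocycle N} {L : LeftInverse X}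
    (hL : L.IsStandard) : PositiveLeftInverse X where
  app Z Y t := if h : t ∈ Hom (X.tensor Z) (X.tensor Y) then L.φ Z Y ⟨t, h⟩ else 0
  app_mem {Z Y t} h := by rw [dif_pos h]; exact (L.φ Z Y ⟨t, h⟩).2
  app_add {Z Y t s} ht hs := by
    rw [dif_pos ht, dif_pos hs, dif_pos (add_mem ht hs)]
    exact congrArg Subtype.val (map_add (L.φ Z Y) ⟨t, ht⟩ ⟨s, hs⟩)
  app_smul {Z Y t} c ht := by
    rw [dif_pos ht, dif_pos (Submodule.smul_mem _ c ht)]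
    exact congrArg Subtype.val (map_smul (L.φ Z Y) c ⟨t, ht⟩)
  app_tensor {Z Y t} W ht := by
    have h := L.map_tensor_one Z Y W ⟨t, ht⟩
    simp only [tensorField_eq, map_one, mul_one] at h
    rw [dif_pos ht, dif_pos (by rw [← tensor_assoc, ← tensor_assoc]; exact mem_tensor_right ht W)]
    exact h
  app_whisker {Z Y Z' Y' s t r} hs ht hr := by
    have h := L.map_whisker Z Y Z' Y' ⟨s, hs⟩ ⟨t, ht⟩ ⟨r, hr⟩
    simp only [tensorField_eq, one_mul] at h
    rw [dif_pos ht, dif_pos (mul_mem_hom (mul_mem_hom (X.endo_mem hs) ht) (X.endo_mem hr))]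
    exact h
  app_star_mul_self {Y t} ht := by
    have h := mul_mem_hom (star_mem_hom ht) ht
    obtain ⟨s, hs, hs'⟩ := hL.positive Y ⟨_, h⟩ ⟨t, ht, rfl⟩
    exact ⟨s, hs, by rw [dif_pos h]; exact hs'⟩
  app_one_unit := by rw [dif_pos (one_mem_hom _)]; exact hL.normalized

namespace PositiveLeftInverse

variable {X Y Z W : Cocycle N} {s t u : K → (H →L[ℂ] H)}

/-- The left inverse defined by a positive normalized left inverse. -/
noncomputable def toLeftInverse (φ : PositiveLeftInverse X) : LeftInverse X where
  φ Z Y :=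
    { toFun := fun t => ⟨φ.app Z Y t, φ.app_mem t.2⟩
      map_add' := fun t s => Subtype.ext (φ.app_add t.2 s.2)
      map_smul' := fun c t => Subtype.ext (φ.app_smul c t.2) }
  map_tensor_one Z Y W t := by
    simp only [tensorField_eq, map_one, mul_one]
    exact φ.app_tensor W t.2
  map_whisker Z Y Z' Y' s t r := by
    simp only [tensorField_eq, one_mul]
    exact φ.app_whisker s.2 t.2 r.2

/-- A cocycle has finite statistics if it has a positive normalized left inverse whose value on
`ε(X, X)` has a strictly positive scalar as square. -/
theorem hasFiniteStatistics (φ : PositiveLeftInverse X) {c : ℝ} (hc : 0 < c)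
    (h : φ.app X X (X.symm X) * φ.app X X (X.symm X) = (c : ℂ) • 1) : X.HasFiniteStatistics := by
  refine ⟨φ.toLeftInverse, ?_, φ.app_one_unit, c, hc, ?_⟩
  · rintro Y ⟨t, ht⟩ ⟨s, hs, rfl⟩
    exact φ.app_star_mul_self hs
  · rw [sq]; exact h

theorem app_sub (φ : PositiveLeftInverse X) (ht : t ∈ Hom (X.tensor Z) (X.tensor Y))
    (hs : s ∈ Hom (X.tensor Z) (X.tensor Y)) :
    φ.app Z Y (t - s) = φ.app Z Y t - φ.app Z Y s := by
  have h := φ.app_add ht (Submodule.smul_mem _ (-1 : ℂ) hs)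
  rw [φ.app_smul _ hs] at h
  simpa [sub_eq_add_neg] using h

theorem app_one (φ : PositiveLeftInverse X) (Y : Cocycle N) : φ.app Y Y 1 = 1 := by
  have h := φ.app_tensor Y (one_mem_hom (X.tensor (unit N)))
  rwa [unit_tensor, φ.app_one_unit] at h

theorem app_endo_mul (φ : PositiveLeftInverse X) (hs : s ∈ Hom Y W)
    (ht : t ∈ Hom (X.tensor Z) (X.tensor Y)) :
    φ.app Z W (X.endo s * t) = s * φ.app Z Y t := by
  simpa using φ.app_whisker hs ht (one_mem_hom Z)

theorem app_mul_endo (φ : PositiveLeftInverse X) (ht : t ∈ Hom (X.tensor Z) (X.tensor Y))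
    (hs : s ∈ Hom W Z) : φ.app W Y (t * X.endo s) = φ.app Z Y t * s := by
  simpa using φ.app_whisker (one_mem_hom Y) ht hs

theorem app_endo (φ : PositiveLeftInverse X) (hs : s ∈ Hom Y Z) :
    φ.app Y Z (X.endo s) = s := by
  simpa [φ.app_one] using φ.app_endo_mul hs (one_mem_hom (X.tensor Y))

/-- If `z B' + z̄ B + |z|²` is positive for all `z ∈ ℂ`, then `B = 0`: to first order in `z` both
`z B' + z̄ B` and its negative are positive. -/
theorem _root_.ContinuousLinearMap.eq_zero_of_forall_nonneg {B B' : H →L[ℂ] H}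
    (h : ∀ z : ℂ, 0 ≤ z • B' + star z • B + (star z * z) • (1 : H →L[ℂ] H)) : B = 0 := by
  have h1 : ∀ z : ℂ, 0 ≤ z • B' + star z • B := by
    intro z
    have h2 : ∀ r : ℝ, 0 < r →
        0 ≤ (z • B' + star z • B) + r • ((star z * z) • (1 : H →L[ℂ] H)) := by
      intro r hr
      have h3 := smul_nonneg (inv_nonneg.2 hr.le) (h ((r : ℂ) * z))
      have h4 : r⁻¹ • (((r : ℂ) * z) • B' + star ((r : ℂ) * z) • B +
          (star ((r : ℂ) * z) * ((r : ℂ) * z)) • (1 : H →L[ℂ] H)) =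
          (z • B' + star z • B) + r • ((star z * z) • (1 : H →L[ℂ] H)) := by
        have hr' : (r : ℂ) ≠ 0 := by exact_mod_cast hr.ne'
        have hs : star (r : ℂ) = r := Complex.conj_ofReal r
        simp only [smul_add, ← Complex.coe_smul, smul_smul, star_mul', hs]
        push_cast
        congr 2
        · congr 2
          field_simp
        · field_simp
        · rw [inv_mul_eq_iff_eq_mul₀ hr']; ring
      rwa [h4] at h3
    have h5 : Filter.Tendsto (fun r : ℝ => (z • B' + star z • B) +
        r • ((star z * z) • (1 : H →L[ℂ] H))) (nhdsWithin 0 (Set.Ioi 0))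
        (nhds ((z • B' + star z • B) + (0 : ℝ) • ((star z * z) • (1 : H →L[ℂ] H)))) :=
      (Continuous.tendsto (by fun_prop) 0).mono_left nhdsWithin_le_nhds
    rw [zero_smul, add_zero] at h5
    exact ge_of_tendsto h5 (Filter.eventually_of_mem self_mem_nhdsWithin h2)
  have h2 : ∀ z : ℂ, z • B' + star z • B = 0 := fun z => by
    refine le_antisymm ?_ (h1 z)
    have := h1 (-z)
    rw [star_neg, neg_smul, neg_smul, ← neg_add] at this
    exact neg_nonneg.1 this
  have h3 := h2 1
  have h4 := h2 Complex.I
  simp only [one_smul, star_one] at h3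
  have h5 : B' = -B := eq_neg_of_add_eq_zero_left h3
  have h6 : star Complex.I = -Complex.I := Complex.conj_I
  rw [h5, h6, smul_neg, neg_smul, ← neg_add, neg_eq_zero, ← add_smul] at h4
  exact (smul_eq_zero.1 h4).resolve_left (by simp [Complex.ext_iff])

/-- The Cauchy–Schwarz inequality in the degenerate case. -/
theorem app_eq_zero_of_app_star_mul_self (φ : PositiveLeftInverse X)
    (hu : u ∈ Hom (X.tensor Y) (X.tensor Y)) (h : φ.app Y Y (star u * u) = 0) :
    φ.app Y Y u = 0 := by
  have hu' := star_mem_hom hu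
  have h1 := one_mem_hom (X.tensor Y)
  have key : ∀ z : ℂ, φ.app Y Y (star (u + z • 1) * (u + z • 1)) =
      z • φ.app Y Y (star u) + star z • φ.app Y Y u + (star z * z) • 1 := by
    intro z
    have hm : ∀ {c : ℂ} {t}, t ∈ Hom (X.tensor Y) (X.tensor Y) →
      c • t ∈ Hom (X.tensor Y) (X.tensor Y) := fun ht => Submodule.smul_mem _ _ ht
    have : star (u + z • 1) * (u + z • 1) =
        star u * u + (z • star u + (star z • u + (star z * z) • 1)) := by
      simp only [star_add, star_smul, star_one, mul_add, add_mul, mul_smul_comm, smul_mul_assoc,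
        mul_one, one_mul, smul_smul, smul_add, mul_comm z]
      abel
    rw [this, φ.app_add (mul_mem_hom hu' hu) (add_mem (hm hu') (add_mem (hm hu) (hm h1))), h,
      φ.app_add (hm hu') (add_mem (hm hu) (hm h1)), φ.app_add (hm hu) (hm h1), φ.app_smul _ hu',
      φ.app_smul _ hu, φ.app_smul _ h1, φ.app_one, zero_add, add_assoc]
  funext a
  refine ContinuousLinearMap.eq_zero_of_forall_nonneg (B' := φ.app Y Y (star u) a) fun z => ?_
  obtain ⟨s, -, hs⟩ := φ.app_star_mul_self (add_mem hu (Submodule.smul_mem _ z h1))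
  rw [key] at hs
  have := congrFun hs a
  simp only [Pi.add_apply, Pi.smul_apply, Pi.one_apply] at this
  rw [this]
  exact star_mul_self_nonneg (s a)

/-- Conjugating `1_X ⊗ p` by `ε(X, X)` interchanges the first two factors, so that the left inverse
acts on the factor `X` of `p`. -/
theorem app_symm_conj (φ : PositiveLeftInverse X) (ht : t ∈ Hom (X.tensor Y) (X.tensor Y)) :
    φ.app (X.tensor Y) (X.tensor Y) (X.symm X * X.endo t * X.symm X) =
      X.endo (φ.app Y Y t) := by
  have h1 := symm_mul_of_mem ht X
  rw [symm_tensor_left] at h1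
  have h2 : X.symm X * X.endo t * X.symm X = X.endo (Y.symm X) * t * X.endo (X.symm Y) := by
    have h3 : X.endo (Y.symm X) * X.endo (X.symm Y) = 1 := by
      rw [← map_mul, symm_mul_symm, map_one]
    calc _ = X.symm X * (X.endo t * (X.symm X * X.endo (Y.symm X))) * X.endo (X.symm Y) := by
          rw [mul_assoc, mul_assoc _ _ (X.endo (X.symm Y)), mul_assoc (X.endo t),
            mul_assoc (X.symm X) (X.endo (Y.symm X)), h3, mul_one]
      _ = _ := by
          rw [← h1]
          simp only [← mul_assoc]
          rw [symm_mul_symm, one_mul]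
  have ht' : t ∈ Hom (X.tensor (Y.tensor X)) (X.tensor (Y.tensor X)) := by
    rw [← tensor_assoc]; exact mem_tensor_right ht X
  rw [h2, φ.app_whisker (Y.symm_mem_hom X) ht' (X.symm_mem_hom Y), φ.app_tensor X ht,
    symm_mul_of_mem (φ.app_mem ht) X, mul_assoc, symm_mul_symm, mul_one]

/-- A positive normalized left inverse is faithful if its value on `ε(X, X)` is invertible. -/
theorem eq_zero_of_app_star_mul_self (φ : PositiveLeftInverse X) {v : K → (H →L[ℂ] H)}
    (hv : φ.app X X (X.symm X) * v = 1) (ht : t ∈ Hom (X.tensor Y) (X.tensor Y))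
    (h : φ.app Y Y (star t * t) = 0) : t = 0 := by
  have hε : X.symm X ∈ Hom (X.tensor (X.tensor Y)) (X.tensor (X.tensor Y)) := by
    rw [← tensor_assoc]; exact mem_tensor_right (X.symm_mem_hom X) Y
  have hu := mul_mem_hom (X.endo_mem ht) hε
  have h0 : φ.app (X.tensor Y) (X.tensor Y) (X.endo t * X.symm X) = 0 := by
    refine φ.app_eq_zero_of_app_star_mul_self hu ?_
    have : star (X.endo t * X.symm X) * (X.endo t * X.symm X) =
        X.symm X * X.endo (star t * t) * X.symm X := by
      rw [star_mul, star_symm, ← map_star, map_mul]; simp only [mul_assoc]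
    rw [this, φ.app_symm_conj (mul_mem_hom (star_mem_hom ht) ht), h, map_zero]
  rw [φ.app_endo_mul ht hε, φ.app_tensor Y (X.symm_mem_hom X)] at h0
  rw [← mul_one t, ← hv, ← mul_assoc, h0, zero_mul]

/-! ### Left inverses of tensor products and subobjects -/

/-- The trivial left inverse of the unit cocycle. -/
noncomputable def ofUnit (N : ObservableNet S H) : PositiveLeftInverse (unit N) where
  app _ _ t := t
  app_mem {Z Y t} h := by rwa [unit_tensor, unit_tensor] at h
  app_add _ _ := rfl
  app_smul _ _ := rfl
  app_tensor _ _ := rfl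
  app_whisker _ _ _ := by rw [endo_unit, endo_unit]
  app_star_mul_self {Y t} h := by
    rw [unit_tensor] at h
    exact ⟨t, h, rfl⟩
  app_one_unit := rfl

/-- The left inverse of `X ⊗ Y` which removes `X` first and `Y` next. -/
noncomputable def comp (φ : PositiveLeftInverse X) (ψ : PositiveLeftInverse Y) :
    PositiveLeftInverse (X.tensor Y) where
  app Z W t := ψ.app Z W (φ.app (Y.tensor Z) (Y.tensor W) t)
  app_mem {Z W t} h := by
    rw [tensor_assoc, tensor_assoc] at h
    exact ψ.app_mem (φ.app_mem h)
  app_add {Z W t s} ht hs := by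
    rw [tensor_assoc, tensor_assoc] at ht hs
    rw [φ.app_add ht hs, ψ.app_add (φ.app_mem ht) (φ.app_mem hs)]
  app_smul {Z W t} c ht := by
    rw [tensor_assoc, tensor_assoc] at ht
    rw [φ.app_smul c ht, ψ.app_smul c (φ.app_mem ht)]
  app_tensor {Z W t} V ht := by
    rw [tensor_assoc, tensor_assoc] at ht
    rw [← tensor_assoc, ← tensor_assoc, φ.app_tensor V ht, ψ.app_tensor V (φ.app_mem ht)]
  app_whisker {Z W Z' W' s t r} hs ht hr := by
    rw [tensor_assoc, tensor_assoc] at ht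
    rw [endo_tensor _ _ hs.1, endo_tensor _ _ hr.1,
      φ.app_whisker (Y.endo_mem hs) ht (Y.endo_mem hr), ψ.app_whisker hs (φ.app_mem ht) hr]
  app_star_mul_self {Z t} ht := by
    rw [tensor_assoc] at ht
    obtain ⟨s, hs, h⟩ := φ.app_star_mul_self ht
    rw [h]
    exact ψ.app_star_mul_self hs
  app_one_unit := by rw [φ.app_one, ψ.app_one]

/-- The values on the symmetry are multiplicative. -/
theorem comp_app_symm (φ : PositiveLeftInverse X) (ψ : PositiveLeftInverse Y) :
    (φ.comp ψ).app (X.tensor Y) (X.tensor Y) ((X.tensor Y).symm (X.tensor Y)) =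
      φ.app X X (X.symm X) * X.endo (ψ.app Y Y (Y.symm Y)) := by
  have hYX : Y.symm X ∈ Hom (Y.tensor (X.tensor Y)) (X.tensor (Y.tensor Y)) := by
    rw [← tensor_assoc, ← tensor_assoc]; exact mem_tensor_right (Y.symm_mem_hom X) Y
  have hXY : X.symm Y ∈ Hom (X.tensor (Y.tensor Y)) (Y.tensor (X.tensor Y)) := by
    rw [← tensor_assoc, ← tensor_assoc]; exact mem_tensor_right (X.symm_mem_hom Y) Y
  have hXX : X.symm X ∈ Hom (X.tensor (X.tensor (Y.tensor Y))) (X.tensor (X.tensor (Y.tensor Y))) := by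
    rw [← tensor_assoc]; exact mem_tensor_right (X.symm_mem_hom X) _
  have hYY : Y.symm Y ∈ Hom (Y.tensor (Y.tensor X)) (Y.tensor (Y.tensor X)) := by
    rw [← tensor_assoc]; exact mem_tensor_right (Y.symm_mem_hom Y) _
  have ha := φ.app_mem (X.symm_mem_hom X)
  have hb := ψ.app_mem (Y.symm_mem_hom Y)
  set a := φ.app X X (X.symm X) with ha_def
  set b := ψ.app Y Y (Y.symm Y) with hb_def
  have hY1 : X.endo (Y.symm Y) ∈ Hom (X.tensor (Y.tensor Y)) (X.tensor (Y.tensor Y)) :=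
    X.endo_mem (Y.symm_mem_hom Y)
  -- both strands are unfolded, and `ε(X, X)` is moved next to the right factor
  have e1 : (X.tensor Y).symm (X.tensor Y) = X.endo (X.symm Y * X.endo (Y.symm Y)) *
      X.symm X * X.endo (Y.symm X) := by
    have hc : X.symm X * X.endo (X.endo (Y.symm Y)) = X.endo (X.endo (Y.symm Y)) * X.symm X := by
      rw [← endo_tensor _ _ (localized_symm Y Y)]
      exact hom_endo (X.symm_mem_hom X) (localized_symm Y Y)
    rw [symm_tensor_left, symm_tensor_right X X Y, symm_tensor_right Y X Y, map_mul, map_mul,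
      mul_assoc (X.endo (X.symm Y)), ← mul_assoc (X.symm X), hc]
    simp only [mul_assoc]
  have e2 : φ.app (Y.tensor (X.tensor Y)) (Y.tensor (X.tensor Y))
      ((X.tensor Y).symm (X.tensor Y)) = X.symm Y * X.endo (Y.symm Y) * a * Y.symm X := by
    rw [e1, φ.app_whisker (mul_mem_hom hXY hY1) hXX hYX,
      φ.app_tensor (Y.tensor Y) (X.symm_mem_hom X)]
  have e3 : X.symm Y * X.endo (Y.symm Y) * Y.symm X =
      Y.endo (Y.symm X) * Y.symm Y * Y.endo (X.symm Y) := by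
    have := symm_mul_of_mem (Y.symm_mem_hom X) Y
    rw [symm_tensor_left, symm_tensor_left] at this
    rw [this, mul_assoc]
  have e4 : X.symm Y * X.endo (Y.symm Y) * a * Y.symm X =
      Y.endo (a * Y.symm X) * Y.symm Y * Y.endo (X.symm Y) := by
    rw [mul_assoc (X.symm Y), ← hom_endo ha (localized_symm Y Y), ← mul_assoc (X.symm Y),
      symm_mul_of_mem ha Y, mul_assoc (Y.endo a), mul_assoc (Y.endo a), e3, map_mul]
    simp only [mul_assoc]
  change ψ.app (X.tensor Y) (X.tensor Y) (φ.app (Y.tensor (X.tensor Y)) (Y.tensor (X.tensor Y))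
    ((X.tensor Y).symm (X.tensor Y))) = _
  rw [e2, e4, ψ.app_whisker (mul_mem_hom (mem_tensor_right ha Y) (Y.symm_mem_hom X)) hYY
    (X.symm_mem_hom Y), ψ.app_tensor X (Y.symm_mem_hom Y), ← hb_def, mul_assoc a,
    symm_mul_of_mem hb X]
  simp only [mul_assoc, symm_mul_symm, mul_one]

/-- The left inverse of a subobject, normalized by the weight `m` of its projection. -/
noncomputable def ofSubobject (φ : PositiveLeftInverse Y) {w : K → (H →L[ℂ] H)} (hw : w ∈ Hom Z Y)
    (hw1 : star w * w = 1) {m : ℝ} (hm : 0 < m)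
    (hφ : φ.app (unit N) (unit N) (w * star w) = (m : ℂ) • 1) : PositiveLeftInverse Z where
  app V W t := (m⁻¹ : ℂ) • φ.app V W (w * t * star w)
  app_mem {V W t} ht := Submodule.smul_mem _ _ (φ.app_mem (mul_mem_hom (mul_mem_hom
    (mem_tensor_right hw W) ht) (mem_tensor_right (star_mem_hom hw) V)))
  app_add {V W t s} ht hs := by
    rw [mul_add, add_mul, φ.app_add (mul_mem_hom (mul_mem_hom
      (mem_tensor_right hw W) ht) (mem_tensor_right (star_mem_hom hw) V)) (mul_mem_hom (mul_mem_hom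
      (mem_tensor_right hw W) hs) (mem_tensor_right (star_mem_hom hw) V)), smul_add]
  app_smul {V W t} c ht := by
    rw [mul_smul_comm, smul_mul_assoc, φ.app_smul c (mul_mem_hom (mul_mem_hom
      (mem_tensor_right hw W) ht) (mem_tensor_right (star_mem_hom hw) V)), smul_comm]
  app_tensor {V W t} U ht := by
    rw [φ.app_tensor U (mul_mem_hom (mul_mem_hom
      (mem_tensor_right hw W) ht) (mem_tensor_right (star_mem_hom hw) V))]
  app_whisker {V W V' W' s t r} hs ht hr := by
    have h1 := hom_endo hw hs.1
    have h2 := hom_endo (star_mem_hom hw) hr.1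
    have : w * (Z.endo s * t * Z.endo r) * star w =
        Y.endo s * (w * t * star w) * Y.endo r := by
      calc _ = (w * Z.endo s) * t * (Z.endo r * star w) := by simp only [mul_assoc]
        _ = _ := by rw [h1, ← h2]; simp only [mul_assoc]
    rw [this, φ.app_whisker hs (mul_mem_hom (mul_mem_hom
      (mem_tensor_right hw W) ht) (mem_tensor_right (star_mem_hom hw) V)) hr, mul_smul_comm,
      smul_mul_assoc]
  app_star_mul_self {V t} ht := by
    obtain ⟨s, hs, h⟩ := φ.app_star_mul_self (mul_mem_hom (mul_mem_hom
      (mem_tensor_right hw V) ht) (mem_tensor_right (star_mem_hom hw) V))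
    have h1 : star (w * t * star w) * (w * t * star w) = w * (star t * t) * star w := by
      simp only [star_mul, star_star, mul_assoc]
      rw [← mul_assoc (star w) w, hw1, one_mul]
    rw [h1] at h
    refine ⟨((Real.sqrt m : ℝ) : ℂ)⁻¹ • s, Submodule.smul_mem _ _ hs, ?_⟩
    rw [h, star_smul, smul_mul_smul_comm, star_inv₀, Complex.star_def, Complex.conj_ofReal,
      ← mul_inv, ← Complex.ofReal_mul, Real.mul_self_sqrt hm.le]
  app_one_unit := by
    rw [mul_one, hφ, smul_smul, inv_mul_cancel₀ (by exact_mod_cast hm.ne'), one_smul]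

/-- The value on `ε(Z, Z)` of the left inverse of a subobject `Z` of `Y`. -/
theorem ofSubobject_app_symm (φ : PositiveLeftInverse Y) {w : K → (H →L[ℂ] H)} (hw : w ∈ Hom Z Y)
    (hw1 : star w * w = 1) {m : ℝ} (hm : 0 < m)
    (hφ : φ.app (unit N) (unit N) (w * star w) = (m : ℂ) • 1) :
    (φ.ofSubobject hw hw1 hm hφ).app Z Z (Z.symm Z) =
      (m⁻¹ : ℂ) • (star w * φ.app Y Y (Y.symm Y) * w) := by
  change (m⁻¹ : ℂ) • φ.app Z Z (w * Z.symm Z * star w) = _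
  have h : w * Z.symm Z * star w = Y.endo (star w) * Y.symm Y * Y.endo w := by
    rw [mul_assoc, symm_mul_of_mem (star_mem_hom hw) Z, ← mul_assoc,
      hom_endo hw (star_mem_hom hw).1, mul_assoc, mul_assoc, symm_mul_endo_of_mem Y hw]
  rw [h, φ.app_whisker (star_mem_hom hw) (Y.symm_mem_hom Y) hw]

end PositiveLeftInverse

end Cocycle

/-! ### Antisymmetrizers -/

section Algebra

variable {R : Type*} [Ring R] [Algebra ℂ R]

/-- The inductive step for antisymmetrizers `q ≥ p` of `n - 1` and `n` strands, where `τ` exchanges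
a new strand with the first strand of `p`, and `σ` exchanges the first two strands of `p`. -/
theorem antisymmetrizer_step {a p q τ σ : R} {n : ℂ} (hp : n • p = q - (n - 1) • (q * σ * q))
    (hpp : p * p = p) (hqp : q * p = p) (hpq : p * q = p) (hτq : q * τ = τ * q)
    (hτ : τ * τ = 1) (hσp : σ * p = -p) (hpσ : p * σ = -p) (hb : τ * σ * τ = σ * τ * σ)
    (hn : n + 1 ≠ 0) (ha : a = (n + 1)⁻¹ • (p * (1 - n • τ) * p)) :
    a * a = a ∧ τ * a = -a := by
  have hx : p * (1 - n • τ) * p = p - n • (p * τ * p) := by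
    rw [mul_sub, sub_mul, mul_one, hpp, mul_smul_comm, smul_mul_assoc]
  have h0 : τ * q * τ * p = p := by
    rw [← hτq, mul_assoc q, hτ, mul_one, hqp]
  have h0' : τ * (q * σ * q) * τ * p = q * (τ * σ * τ) * p := by
    calc _ = τ * q * σ * (q * τ) * p := by simp only [mul_assoc]
      _ = q * τ * σ * τ * (q * p) := by rw [hτq]; simp only [mul_assoc]
      _ = _ := by rw [hqp]; simp only [mul_assoc]
  have h1 : n • (τ * p * τ * p) = p + (n - 1) • (q * σ * τ * p) := by
    calc n • (τ * p * τ * p) = τ * (n • p) * τ * p := by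
          simp only [mul_smul_comm, smul_mul_assoc]
      _ = τ * q * τ * p - (n - 1) • (τ * (q * σ * q) * τ * p) := by
          rw [hp]; simp only [mul_sub, sub_mul, mul_smul_comm, smul_mul_assoc]
      _ = p - (n - 1) • (q * (σ * τ) * (σ * p)) := by
          rw [h0, h0', hb]; simp only [mul_assoc]
      _ = _ := by
          rw [hσp, mul_neg, smul_neg, sub_neg_eq_add]; simp only [mul_assoc]
  have h2 : n • (p * τ * p) = τ * p - (n - 1) • (q * σ * τ * p) := by
    calc n • (p * τ * p) = (n • p) * τ * p := by simp only [smul_mul_assoc]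
      _ = q * τ * p - (n - 1) • (q * σ * (q * τ) * p) := by
          rw [hp]; simp only [sub_mul, smul_mul_assoc, mul_assoc]
      _ = _ := by
          rw [hτq, mul_assoc τ q p, hqp, mul_assoc _ (τ * q), mul_assoc τ, hqp]
          simp only [mul_assoc]
  have h3 : n • (p * τ * p * τ * p) = p - (n - 1) • (p * τ * p) := by
    have : p * (n • (τ * p * τ * p)) = n • (p * τ * p * τ * p) := by
      rw [mul_smul_comm]; simp only [mul_assoc]
    rw [← this, h1, mul_add, hpp, mul_smul_comm]
    have : p * (q * σ * τ * p) = -(p * τ * p) := by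
      calc _ = (p * q) * σ * τ * p := by simp only [mul_assoc]
        _ = _ := by rw [hpq, hpσ]; simp only [neg_mul]
    rw [this, smul_neg, ← sub_eq_add_neg]
  rw [ha, hx]
  constructor
  · have h4 : (p - n • (p * τ * p)) * (p - n • (p * τ * p)) =
        (n + 1) • (p - n • (p * τ * p)) := by
      have e1 : p * (p * τ * p) = p * τ * p := by rw [← mul_assoc, ← mul_assoc, hpp]
      have e2 : p * τ * p * p = p * τ * p := by rw [mul_assoc, hpp]
      have e3 : p * τ * p * (p * τ * p) = p * τ * p * τ * p := by
        rw [← mul_assoc, ← mul_assoc, e2]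
      rw [mul_sub, sub_mul, sub_mul, hpp, mul_smul_comm, mul_smul_comm, smul_mul_assoc, e1, e2,
        smul_mul_assoc, e3, h3]
      module
    rw [smul_mul_smul_comm, h4, smul_smul, mul_assoc, inv_mul_cancel₀ hn, mul_one]
  · rw [mul_smul_comm, ← smul_neg]
    congr 1
    have h5 : τ * (n • (p * τ * p)) = n • (τ * p * τ * p) := by
      rw [mul_smul_comm]; simp only [mul_assoc]
    rw [mul_sub, h5, h1, h2]
    abel

end Algebra

namespace Cocycle

/-- The tensor powers of a cocycle. -/
noncomputable def tpow (X : Cocycle N) : ℕ → Cocycle N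
  | 0 => unit N
  | n + 1 => X.tensor (tpow X n)

/-- The antisymmetrizers `A_n ∈ (X^{⊗n}, X^{⊗n})` defined by an exchange operator
`τ ∈ (X ⊗ X, X ⊗ X)`, through the recursion
`A_{n+1} = (n + 1)⁻¹ (1_X ⊗ A_n) (1 - n τ) (1_X ⊗ A_n)`. -/
noncomputable def antisymm (X : Cocycle N) (τ : K → (H →L[ℂ] H)) : ℕ → K → (H →L[ℂ] H)
  | 0 => 1
  | n + 1 => ((n : ℂ) + 1)⁻¹ •
      (X.endo (antisymm X τ n) * (1 - (n : ℂ) • τ) * X.endo (antisymm X τ n))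

/-- A self-adjoint unitary of `(X ⊗ X, X ⊗ X)` satisfying the braid relation, and hence defining
representations of the permutation groups on the tensor powers of `X`. -/
structure IsExchange (X : Cocycle N) (τ : K → (H →L[ℂ] H)) : Prop where
  mem : τ ∈ Hom (X.tensor X) (X.tensor X)
  star_eq : star τ = τ
  mul_self : τ * τ = 1
  braid : τ * X.endo τ * τ = X.endo τ * τ * X.endo τ

variable {X : Cocycle N} {τ : K → (H →L[ℂ] H)}

@[simp]
theorem antisymm_zero : X.antisymm τ 0 = 1 := rfl

theorem antisymm_succ (n : ℕ) : X.antisymm τ (n + 1) = ((n : ℂ) + 1)⁻¹ •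
    (X.endo (X.antisymm τ n) * (1 - (n : ℂ) • τ) * X.endo (X.antisymm τ n)) := rfl

@[simp]
theorem antisymm_one : X.antisymm τ 1 = 1 := by simp [antisymm_succ]

theorem antisymm_two : X.antisymm τ 2 = (2 : ℂ)⁻¹ • (1 - τ) := by
  rw [antisymm_succ 1]; norm_num

namespace IsExchange

theorem one_sub_mem (hτ : X.IsExchange τ) (n : ℕ) :
    1 - (n : ℂ) • τ ∈ Hom (X.tpow (n + 1)) (X.tpow (n + 1)) := by
  cases n with
  | zero => simpa using one_mem_hom _
  | succ n =>
    refine sub_mem (one_mem_hom _) (Submodule.smul_mem _ _ ?_)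
    have := mem_tensor_right hτ.mem (X.tpow n)
    rwa [tensor_assoc] at this

theorem antisymm_mem (hτ : X.IsExchange τ) (n : ℕ) :
    X.antisymm τ n ∈ Hom (X.tpow n) (X.tpow n) := by
  induction n with
  | zero => exact one_mem_hom _
  | succ n ih =>
    exact Submodule.smul_mem _ _ (mul_mem_hom (mul_mem_hom (X.endo_mem ih) (hτ.one_sub_mem n))
      (X.endo_mem ih))

theorem star_antisymm (hτ : X.IsExchange τ) (n : ℕ) : star (X.antisymm τ n) = X.antisymm τ n := by
  induction n with
  | zero => simp
  | succ n ih =>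
    rw [antisymm_succ, star_smul, star_mul, star_mul, ← map_star, ih, star_sub, star_one, star_smul,
      hτ.star_eq, mul_assoc]
    simp

set_option maxRecDepth 4000 in
/-- The antisymmetrizers are decreasing projections, and the exchange operator acts on them by `-1`;
these properties have to be proved together. -/
theorem antisymm_aux (hτ : X.IsExchange τ) (n : ℕ) :
    X.antisymm τ (n + 1) * X.antisymm τ (n + 1) = X.antisymm τ (n + 1) ∧
    X.endo (X.antisymm τ n) * X.antisymm τ (n + 1) = X.antisymm τ (n + 1) ∧
    X.antisymm τ (n + 2) * X.antisymm τ (n + 2) = X.antisymm τ (n + 2) ∧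
    τ * X.antisymm τ (n + 2) = -X.antisymm τ (n + 2) := by
  induction n with
  | zero =>
    refine ⟨by simp, by simp, ?_, ?_⟩
    · simp only [zero_add, antisymm_two, smul_mul_smul_comm, mul_sub, sub_mul, hτ.mul_self, mul_one,
        one_mul]
      module
    · simp only [zero_add, antisymm_two, mul_smul_comm, mul_sub, hτ.mul_self, mul_one]
      module
  | succ n ih =>
    obtain ⟨h1, h2, h3, h4⟩ := ih
    have e1 := congrArg X.endo h1
    have e3 := congrArg X.endo h3
    rw [map_mul] at e1 e3
    have hle : X.endo (X.antisymm τ (n + 1)) * X.antisymm τ (n + 2) = X.antisymm τ (n + 2) := by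
      rw [antisymm_succ (n + 1), mul_smul_comm, ← mul_assoc, ← mul_assoc, e1]
    have hge : X.antisymm τ (n + 2) * X.endo (X.antisymm τ (n + 1)) = X.antisymm τ (n + 2) := by
      have := congrArg star hle
      rwa [star_mul, ← map_star, hτ.star_antisymm, hτ.star_antisymm] at this
    have h4' : X.antisymm τ (n + 2) * τ = -X.antisymm τ (n + 2) := by
      have := congrArg star h4
      rwa [star_mul, star_neg, hτ.star_antisymm, hτ.star_eq] at this
    have hn : ((n + 2 : ℕ) : ℂ) ≠ 0 := by exact_mod_cast (Nat.succ_ne_zero (n + 1))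
    have hcast : ((n + 1 : ℕ) : ℂ) = ((n + 2 : ℕ) : ℂ) - 1 := by push_cast; ring
    have hcast' : ((n + 1 : ℕ) : ℂ) + 1 = ((n + 2 : ℕ) : ℂ) := by push_cast; ring
    have := antisymmetrizer_step (a := X.antisymm τ (n + 3)) (p := X.endo (X.antisymm τ (n + 2)))
      (q := X.endo (X.endo (X.antisymm τ (n + 1)))) (τ := τ) (σ := X.endo τ)
      (n := ((n + 2 : ℕ) : ℂ)) ?_ e3 ?_ ?_ ?_ hτ.mul_self ?_ ?_ hτ.braid ?_
      (antisymm_succ (n + 2))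
    · exact ⟨h3, hle, this.1, this.2⟩
    · have e5 : (X.endo (X.antisymm τ (n + 1)) * (1 - ((n + 1 : ℕ) : ℂ) • τ) *
          X.endo (X.antisymm τ (n + 1))) = X.endo (X.antisymm τ (n + 1)) -
          ((n + 1 : ℕ) : ℂ) • (X.endo (X.antisymm τ (n + 1)) * τ *
          X.endo (X.antisymm τ (n + 1))) := by
        rw [mul_sub, sub_mul, mul_one, e1, mul_smul_comm, smul_mul_assoc]
      rw [antisymm_succ (n + 1), map_smul, hcast', smul_smul, mul_inv_cancel₀ hn, one_smul, e5,
        map_sub, map_smul, map_mul, map_mul, hcast]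
    · rw [← map_mul, hle]
    · rw [← map_mul, hge]
    · rw [← endo_tensor _ _ (hτ.antisymm_mem _).1]
      exact (hom_endo hτ.mem (hτ.antisymm_mem _).1).symm
    · rw [← map_mul, h4, map_neg]
    · rw [← map_mul, h4', map_neg]
    · exact_mod_cast (Nat.succ_ne_zero (n + 2))

theorem antisymm_mul_self (hτ : X.IsExchange τ) (n : ℕ) :
    X.antisymm τ n * X.antisymm τ n = X.antisymm τ n := by
  cases n with
  | zero => simp
  | succ n => exact (hτ.antisymm_aux n).1

theorem app_antisymm_succ (hτ : X.IsExchange τ) (φ : PositiveLeftInverse X) {c : ℂ}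
    (hφ : φ.app X X τ = c • 1) (n : ℕ) :
    φ.app (X.tpow n) (X.tpow n) (X.antisymm τ (n + 1)) =
      (((n : ℂ) + 1)⁻¹ * (1 - n * c)) • X.antisymm τ n := by
  have hA := hτ.antisymm_mem n
  have h1 : φ.app (X.tpow n) (X.tpow n) (1 - (n : ℂ) • τ) = (1 - n * c) • 1 := by
    cases n with
    | zero => simpa using φ.app_one _
    | succ n =>
      have hm := mem_tensor_right hτ.mem (X.tpow n)
      rw [tensor_assoc] at hm
      change φ.app (X.tensor (X.tpow n)) (X.tensor (X.tpow n)) _ = _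
      rw [φ.app_sub (one_mem_hom _) (Submodule.smul_mem _ _ hm), φ.app_one, φ.app_smul _ hm,
        φ.app_tensor _ hτ.mem, hφ, smul_smul, sub_smul, one_smul]
  rw [antisymm_succ, φ.app_smul _ (mul_mem_hom (mul_mem_hom (X.endo_mem hA) (hτ.one_sub_mem n))
    (X.endo_mem hA)), φ.app_whisker hA (hτ.one_sub_mem n) hA, h1, mul_smul_comm, mul_one,
    smul_mul_assoc, hτ.antisymm_mul_self, smul_smul]

end IsExchange

end Cocycle

/-! ### The twisted exchange operator -/

section Twist

variable {R : Type*} [Ring R] [Algebra ℂ R]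

/-- For commuting involutions `a` and `b`, the involution `(1 + a + b - ab) / 2`, which is `-1` where
`a = b = -1` and `1` elsewhere. -/
noncomputable def twist (a b : R) : R := (2 : ℂ)⁻¹ • (1 + a + b - a * b)

theorem twist_comm {a b : R} (h : a * b = b * a) : twist a b = twist b a := by
  rw [twist, twist, h, add_right_comm]

theorem twist_mul_self {a b : R} (ha : a * a = 1) (hb : b * b = 1) (h : a * b = b * a) :
    twist a b * twist a b = 1 := by
  have h1 : a * (a * b) = b := by rw [← mul_assoc, ha, one_mul]
  have h2 : b * (a * b) = a := by rw [h, ← mul_assoc, hb, one_mul]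
  have h3 : a * b * a = b := by rw [h, mul_assoc, ha, mul_one]
  have h4 : a * b * b = a := by rw [mul_assoc, hb, mul_one]
  have h5 : a * b * (a * b) = 1 := by rw [← mul_assoc, h3, hb]
  have key : (1 + a + b - a * b) * (1 + a + b - a * b) = (4 : ℂ) • 1 := by
    simp only [mul_add, add_mul, mul_sub, sub_mul, mul_one, one_mul, ha, hb, h1, h2, h3, h4, h5, ← h]
    module
  rw [twist, smul_mul_smul_comm, key, smul_smul]
  norm_num

theorem mul_twist {e a b a' b' : R} (ha : e * a = a' * e) (hb : e * b = b' * e) :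
    e * twist a b = twist a' b' * e := by
  have : e * (a * b) = a' * b' * e := by rw [← mul_assoc, ha, mul_assoc, hb, mul_assoc]
  rw [twist, twist, mul_smul_comm, smul_mul_assoc]
  congr 1
  simp only [mul_add, add_mul, mul_sub, sub_mul, ha, hb, this, mul_one, one_mul]

theorem twist_commute {a b c d : R} (h1 : a * c = c * a) (h2 : a * d = d * a) (h3 : b * c = c * b)
    (h4 : b * d = d * b) : twist a b * twist c d = twist c d * twist a b := by
  have hc : c * twist a b = twist a b * c := mul_twist h1.symm h3.symm
  have hd : d * twist a b = twist a b * d := mul_twist h2.symm h4.symm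
  exact mul_twist hc.symm hd.symm

/-- The braid relation is stable under twisting by commuting involutions which are permuted by the
exchange operators. -/
theorem twist_braid {e f a b c : R} (hab : a * b = b * a) (hac : a * c = c * a)
    (hbc : b * c = c * b) (hea : e * a = b * e) (heb : e * b = a * e) (hec : e * c = c * e)
    (hfa : f * a = a * f) (hfb : f * b = c * f) (hfc : f * c = b * f)
    (h : e * f * e = f * e * f) :
    (e * twist a b) * (f * twist b c) * (e * twist a b) =
      (f * twist b c) * (e * twist a b) * (f * twist b c) := by
  have e1 : e * twist a b = twist a b * e := by rw [mul_twist hea heb, twist_comm hab]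
  have e2 : e * twist b c = twist a c * e := mul_twist heb hec
  have e3 : e * twist a c = twist b c * e := mul_twist hea hec
  have f1 : f * twist b c = twist b c * f := by rw [mul_twist hfb hfc, twist_comm hbc]
  have f2 : f * twist a b = twist a c * f := mul_twist hfa hfb
  have f3 : f * twist a c = twist a b * f := mul_twist hfa hfc
  have d1 : twist a b * twist a c = twist a c * twist a b := twist_commute rfl hac hab.symm hbc
  have d2 : twist a b * twist b c = twist b c * twist a b := twist_commute hab hac rfl hbc
  have d3 : twist a c * twist b c = twist b c * twist a c := twist_commute hab hac hbc.symm rfl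
  generalize twist a b = p at *
  generalize twist b c = q at *
  generalize twist a c = r at *
  calc e * p * (f * q) * (e * p) = p * e * (q * f) * (p * e) := by rw [e1, f1]
    _ = p * (e * q) * (f * p) * e := by simp only [mul_assoc]
    _ = p * r * (e * r) * f * e := by rw [e2, f2]; simp only [mul_assoc]
    _ = p * r * q * (e * f * e) := by rw [e3]; simp only [mul_assoc]
    _ = q * r * (p * f) * e * f := by
      rw [h, mul_assoc p, d3, ← mul_assoc p, d2, mul_assoc q, d1]; simp only [mul_assoc]
    _ = q * r * f * (r * e) * f := by rw [← f3]; simp only [mul_assoc]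
    _ = q * (f * p) * e * (q * f) := by rw [← e2, f2]; simp only [mul_assoc]
    _ = f * q * (p * e) * (f * q) := by rw [← f1, ← mul_assoc q, ← f1]; simp only [mul_assoc]
    _ = _ := by rw [e1]

end Twist

namespace Cocycle

variable {X Y : Cocycle N} {κ : K → (H →L[ℂ] H)}

/-- The symmetry of `X` twisted by an involution `κ` of `X`. -/
noncomputable def twistedSymm (X : Cocycle N) (κ : K → (H →L[ℂ] H)) : K → (H →L[ℂ] H) :=
  X.symm X * twist κ (X.endo κ)

theorem isExchange_twistedSymm (hκ : κ ∈ Hom X X) (hs : star κ = κ) (h1 : κ * κ = 1) :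
    X.IsExchange (X.twistedSymm κ) := by
  have hE1 : X.endo κ * X.endo κ = 1 := by rw [← map_mul, h1, map_one]
  have hE : star (X.endo κ) = X.endo κ := by rw [← map_star, hs]
  have hc : κ * X.endo κ = X.endo κ * κ := hom_endo hκ hκ.1
  have hc2 : X.endo κ * X.endo (X.endo κ) = X.endo (X.endo κ) * X.endo κ := by
    rw [← map_mul, hc, map_mul]
  have hc3 : κ * X.endo (X.endo κ) = X.endo (X.endo κ) * κ := hom_endo hκ (X.localized_endo hκ.1)
  have ha : X.symm X * κ = X.endo κ * X.symm X := symm_mul_of_mem hκ X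
  have hb : X.symm X * X.endo κ = κ * X.symm X := symm_mul_endo_of_mem X hκ
  have hst : star (twist κ (X.endo κ)) = twist κ (X.endo κ) := by
    rw [twist, star_smul]
    simp [hs, hE, hc]
  have hcomm : X.symm X * twist κ (X.endo κ) = twist κ (X.endo κ) * X.symm X := by
    rw [mul_twist ha hb, twist_comm hc]
  refine ⟨?_, ?_, ?_, ?_⟩
  · have hκ' := mem_tensor_right hκ X
    have hκ'' := X.endo_mem hκ
    exact mul_mem_hom (X.symm_mem_hom X) (Submodule.smul_mem _ _ (sub_mem (add_mem (add_mem
      (one_mem_hom _) hκ') hκ'') (mul_mem_hom hκ' hκ'')))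
  · rw [twistedSymm, star_mul, hst, star_symm, hcomm]
  · rw [twistedSymm]
    nth_rw 1 [hcomm]
    rw [mul_assoc, ← mul_assoc (X.symm X), symm_mul_symm, one_mul, twist_mul_self h1 hE1 hc]
  · have hmap : X.endo (X.twistedSymm κ) =
        X.endo (X.symm X) * twist (X.endo κ) (X.endo (X.endo κ)) := by
      simp [twistedSymm, twist]
    rw [hmap, twistedSymm]
    refine twist_braid hc hc3 hc2 ha hb ?_ ?_ ?_ ?_ X.symm_braid
    · rw [← endo_tensor _ _ hκ.1]
      exact hom_endo (X.symm_mem_hom X) hκ.1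
    · exact (hom_endo hκ (X.localized_symm X)).symm
    · rw [← map_mul, ha, map_mul]
    · rw [← map_mul, hb, map_mul]

namespace PositiveLeftInverse

variable (φ : PositiveLeftInverse X)

/-- The value on `ε(X, X)` is self-adjoint, since `(1 + ε(X, X)) / 2` is a projection. -/
theorem star_app_symm : star (φ.app X X (X.symm X)) = φ.app X X (X.symm X) := by
  have hε := X.symm_mem_hom X
  have h1 := one_mem_hom (X.tensor X)
  have hp := Submodule.smul_mem _ (2⁻¹ : ℂ) (add_mem h1 hε)
  obtain ⟨s, -, h⟩ := φ.app_star_mul_self hp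
  have hpp : star ((2⁻¹ : ℂ) • (1 + X.symm X)) * ((2⁻¹ : ℂ) • (1 + X.symm X)) =
      (2⁻¹ : ℂ) • (1 + X.symm X) := by
    rw [star_smul, star_add, star_one, star_symm, smul_mul_smul_comm]
    simp only [mul_add, add_mul, mul_one, one_mul, symm_mul_symm, star_inv₀, star_ofNat]
    module
  rw [hpp, φ.app_smul _ (add_mem h1 hε), φ.app_add h1 hε, φ.app_one] at h
  have h2 : φ.app X X (X.symm X) = (2 : ℂ) • (star s * s) - 1 := by
    rw [← h, smul_smul]; norm_num
  rw [h2]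
  simp

theorem app_twistedSymm (hκ : κ ∈ Hom X X) (h1 : κ * κ = 1) {c : ℂ}
    (h : φ.app X X (X.symm X) = c • κ) : φ.app X X (X.twistedSymm κ) = c • 1 := by
  have hε := X.symm_mem_hom X
  have hb : X.symm X * κ = X.endo κ * X.symm X := symm_mul_of_mem hκ X
  have e : X.twistedSymm κ = (2⁻¹ : ℂ) • (X.symm X + X.endo κ * X.symm X + X.symm X * X.endo κ -
      X.endo κ * X.symm X * X.endo κ) := by
    rw [twistedSymm, twist, mul_smul_comm, mul_sub, mul_add, mul_add, mul_one, ← mul_assoc, hb]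
  have m1 := mul_mem_hom (X.endo_mem hκ) hε
  have m2 := mul_mem_hom hε (X.endo_mem hκ)
  have m3 := mul_mem_hom m1 (X.endo_mem hκ)
  rw [e, φ.app_smul _ (sub_mem (add_mem (add_mem hε m1) m2) m3), φ.app_sub (add_mem (add_mem hε m1) m2)
    m3, φ.app_add (add_mem hε m1) m2, φ.app_add hε m1, φ.app_endo_mul hκ hε, φ.app_mul_endo hε hκ,
    φ.app_whisker hκ hε hκ, h]
  simp only [mul_smul_comm, smul_mul_assoc, h1, one_mul]
  module

/-! ### The statistical dimension -/

theorem app_zero (Y Z : Cocycle N) : φ.app Y Z 0 = 0 := by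
  simpa using φ.app_smul (0 : ℂ) (zero_mem (Hom (X.tensor Y) (X.tensor Z)))

/-- The statistics parameter `c` is the inverse of a positive integer `d`: otherwise all the
antisymmetrizers are nonzero, and since `φ(A_{n+1}) = (n + 1)⁻¹ (1 - n c) A_n` this contradicts the
positivity of `φ` as soon as `n c > 1`. -/
theorem exists_dimension [Nonempty K] [Nontrivial H] {τ : K → (H →L[ℂ] H)} (hτ : X.IsExchange τ)
    {c : ℝ} (hc : 0 < c) (h : φ.app X X τ = (c : ℂ) • 1) :
    ∃ d : ℕ, d * c = 1 ∧ X.antisymm τ d ≠ 0 := by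
  by_contra! hcon
  have hne : ∀ n : ℕ, X.antisymm τ n ≠ 0 := by
    intro n
    induction n with
    | zero => exact one_ne_zero
    | succ n ih =>
      intro h0
      have h1 := hτ.app_antisymm_succ φ h n
      rw [h0, φ.app_zero] at h1
      rcases smul_eq_zero.1 h1.symm with h2 | h2
      · refine ih (hcon n ?_)
        rcases mul_eq_zero.1 h2 with h3 | h3
        · exact absurd h3 (inv_ne_zero (by exact_mod_cast n.succ_ne_zero))
        · have : (1 : ℂ) = (n * c : ℝ) := by push_cast; exact sub_eq_zero.1 h3
          exact_mod_cast this.symm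
      · exact ih h2
  obtain ⟨n, hn⟩ := exists_nat_gt (1 / c)
  rw [div_lt_iff₀ hc] at hn
  obtain ⟨s, -, hs⟩ := φ.app_star_mul_self (hτ.antisymm_mem (n + 1))
  rw [hτ.star_antisymm, hτ.antisymm_mul_self, hτ.app_antisymm_succ φ h n] at hs
  refine hne n (funext fun a => ?_)
  have h1 : 0 ≤ X.antisymm τ n a := by
    have : X.antisymm τ n a = star (X.antisymm τ n a) * X.antisymm τ n a := by
      rw [← Pi.star_apply, ← Pi.mul_apply, hτ.star_antisymm, hτ.antisymm_mul_self]
    rw [this]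
    exact star_mul_self_nonneg _
  have h2 : 0 ≤ ((n * c - 1) / (n + 1) : ℝ)⁻¹ • ((((n : ℂ) + 1)⁻¹ * (1 - n * c)) • X.antisymm τ n a) := by
    have := congrFun hs a
    rw [Pi.smul_apply] at this
    rw [this]
    refine smul_nonneg (inv_nonneg.2 (div_nonneg (by linarith) (by positivity))) ?_
    exact star_mul_self_nonneg (s a)
  have h3 : ((n * c - 1) / (n + 1) : ℝ)⁻¹ • ((((n : ℂ) + 1)⁻¹ * (1 - n * c)) • X.antisymm τ n a) =
      -X.antisymm τ n a := by
    rw [← Complex.coe_smul, smul_smul, ← neg_one_smul ℂ (X.antisymm τ n a)]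
    congr 1
    have e1 : ((n * c - 1 : ℝ) : ℂ) ≠ 0 := by
      exact_mod_cast (by linarith : (n * c - 1 : ℝ) ≠ 0)
    have e2 : ((n : ℂ) + 1) ≠ 0 := by exact_mod_cast n.succ_ne_zero
    push_cast at e1 ⊢
    field_simp
    ring
  rw [h3] at h2
  exact le_antisymm (neg_nonneg.1 h2) h1

/-- A cocycle with self-adjoint unitary statistics parameter has scalar symmetry. -/
theorem exists_symm_eq_smul_one [Nonempty K]
    (h : φ.app X X (X.symm X) * φ.app X X (X.symm X) = 1) : ∃ z : ℂ, X.symm X = z • 1 := by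
  have hs := φ.star_app_symm
  have hε := X.symm_mem_hom X
  have hμ := φ.app_mem hε
  have hv : φ.app X X (X.symm X) * φ.app X X (X.symm X) = 1 := h
  set μ := φ.app X X (X.symm X) with hdef
  have hE := X.endo_mem hμ
  have m1 := mul_mem_hom hε hE
  have m2 := mul_mem_hom hE hε
  have h1 := one_mem_hom (X.tensor X)
  have e : star (X.symm X - X.endo μ) * (X.symm X - X.endo μ) =
      (1 + 1) - (X.symm X * X.endo μ + X.endo μ * X.symm X) := by
    rw [star_sub, star_symm, ← map_star, hs, mul_sub, sub_mul, sub_mul, symm_mul_symm, ← map_mul, h,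
      map_one]
    abel
  have hzero : X.symm X - X.endo μ = 0 := by
    refine φ.eq_zero_of_app_star_mul_self hv (sub_mem hε hE) ?_
    rw [e, φ.app_sub (add_mem h1 h1) (add_mem m1 m2), φ.app_add h1 h1, φ.app_add m1 m2, φ.app_one,
      φ.app_mul_endo hε hμ, φ.app_endo_mul hμ hε, ← hdef, h, sub_self]
  have hε' : X.symm X = X.endo μ := sub_eq_zero.1 hzero
  have hEE : X.endo μ * X.endo μ = 1 := by rw [← map_mul, h, map_one]
  have hμE : μ = X.endo μ := by
    have := symm_mul_of_mem hμ X
    rw [hε', hEE] at this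
    calc μ = X.endo μ * (X.endo μ * μ) := by rw [← mul_assoc, hEE, one_mul]
      _ = X.endo μ := by rw [this, mul_one]
  have hμu : μ ∈ Hom (X.tensor (unit N)) (X.tensor (unit N)) := by rwa [tensor_unit]
  obtain ⟨z, hz⟩ := exists_eq_smul_one_of_mem_unit (φ.app_mem hμu)
  have h4 := φ.app_tensor X hμu
  rw [unit_tensor, hz] at h4
  have h5 := φ.app_endo hμ
  rw [← hμE, h4] at h5
  exact ⟨z, by rw [hε', ← hμE, h5]⟩

end PositiveLeftInverse

/-! ### The determinant -/

variable {X Y : Cocycle N} {κ : K → (H →L[ℂ] H)}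

/-- The left inverses of the tensor powers. -/
noncomputable def PositiveLeftInverse.tpow (φ : PositiveLeftInverse X) :
    ∀ n, PositiveLeftInverse (X.tpow n)
  | 0 => ofUnit N
  | n + 1 => φ.comp (tpow φ n)

/-- The tensor powers `κ ⊗ ⋯ ⊗ κ` of an arrow. -/
noncomputable def tpowField (X : Cocycle N) (κ : K → (H →L[ℂ] H)) : ℕ → K → (H →L[ℂ] H)
  | 0 => 1
  | n + 1 => κ * X.endo (tpowField X κ n)

theorem tpowField_mem (hκ : κ ∈ Hom X X) (n : ℕ) :
    X.tpowField κ n ∈ Hom (X.tpow n) (X.tpow n) := by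
  induction n with
  | zero => exact one_mem_hom _
  | succ n ih => exact mul_mem_hom (mem_tensor_right hκ _) (X.endo_mem ih)

theorem tpowField_mul_self (hκ : κ ∈ Hom X X) (h1 : κ * κ = 1) (n : ℕ) :
    X.tpowField κ n * X.tpowField κ n = 1 := by
  induction n with
  | zero => exact one_mul 1
  | succ n ih =>
    change κ * X.endo (X.tpowField κ n) * (κ * X.endo (X.tpowField κ n)) = 1
    rw [mul_assoc, ← mul_assoc (X.endo _) κ, ← hom_endo hκ (tpowField_mem hκ n).1, mul_assoc,
      ← map_mul, ih, map_one, mul_one, h1]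

theorem twistedSymm_mul_endo (hκ : κ ∈ Hom X X) :
    X.twistedSymm κ * X.endo κ = κ * X.twistedSymm κ := by
  have hc : X.endo κ * κ = κ * X.endo κ := (hom_endo hκ hκ.1).symm
  rw [twistedSymm, mul_assoc, ← mul_twist (e := X.endo κ) hc rfl, ← mul_assoc,
    symm_mul_endo_of_mem X hκ, mul_assoc]

theorem twistedSymm_mul (hκ : κ ∈ Hom X X) :
    X.twistedSymm κ * κ = X.endo κ * X.twistedSymm κ := by
  have hc : κ * X.endo κ = X.endo κ * κ := hom_endo hκ hκ.1
  rw [twistedSymm, mul_assoc, ← mul_twist (e := κ) rfl hc, ← mul_assoc,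
    symm_mul_of_mem hκ X, mul_assoc]

theorem symm_eq_twistedSymm (hκ : κ ∈ Hom X X) (h1 : κ * κ = 1) :
    X.symm X = (2⁻¹ : ℂ) • (X.twistedSymm κ + X.twistedSymm κ * κ + κ * X.twistedSymm κ -
      κ * X.twistedSymm κ * κ) := by
  have hE1 : X.endo κ * X.endo κ = 1 := by rw [← map_mul, h1, map_one]
  have hc : κ * X.endo κ = X.endo κ * κ := hom_endo hκ hκ.1
  have h : X.symm X = X.twistedSymm κ * twist κ (X.endo κ) := by
    rw [twistedSymm, mul_assoc, twist_mul_self h1 hE1 hc, mul_one]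
  rw [h, twist, mul_smul_comm, mul_sub, mul_add, mul_add, mul_one, twistedSymm_mul_endo hκ, hc,
    ← mul_assoc, twistedSymm_mul_endo hκ]

theorem tpowField_mul_antisymm (hκ : κ ∈ Hom X X) (hτ : X.IsExchange (X.twistedSymm κ)) (n : ℕ) :
    X.tpowField κ n * X.antisymm (X.twistedSymm κ) n =
      X.antisymm (X.twistedSymm κ) n * X.tpowField κ n := by
  induction n with
  | zero => rfl
  | succ n ih =>
    have hT : X.tpowField κ (n + 1) = κ * X.endo (X.tpowField κ n) := rfl
    have hL := (hτ.antisymm_mem n).1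
    have hA : Commute (X.tpowField κ (n + 1)) (X.endo (X.antisymm (X.twistedSymm κ) n)) := by
      rw [hT]
      refine Commute.mul_left (hom_endo hκ hL) ?_
      rw [commute_iff_eq, ← map_mul, ih, map_mul]
    have hB : Commute (X.tpowField κ (n + 1)) (1 - (n : ℂ) • X.twistedSymm κ) := by
      refine (Commute.one_right _).sub_right ?_
      cases n with
      | zero => simp
      | succ n =>
        refine Commute.smul_right ?_ _
        have hT' : X.tpowField κ (n + 2) = κ * X.endo κ * X.endo (X.endo (X.tpowField κ n)) := by
          rw [mul_assoc, ← map_mul]; rfl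
        have hc : κ * X.endo κ = X.endo κ * κ := hom_endo hκ hκ.1
        have h1 : Commute (κ * X.endo κ) (X.twistedSymm κ) := by
          rw [commute_iff_eq, ← mul_assoc (X.twistedSymm κ), twistedSymm_mul hκ, mul_assoc,
            mul_assoc, twistedSymm_mul_endo hκ, ← mul_assoc, ← mul_assoc, hc]
        rw [hT', ← endo_tensor _ _ (tpowField_mem hκ n).1]
        exact h1.mul_left (hom_endo hτ.mem (tpowField_mem hκ n).1).symm
    exact ((hA.mul_right hB).mul_right hA).smul_right _

namespace PositiveLeftInverse

variable (φ : PositiveLeftInverse X)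

theorem tpow_app_symm {c : ℂ} (h : φ.app X X (X.symm X) = c • κ) (n : ℕ) :
    (φ.tpow n).app (X.tpow n) (X.tpow n) ((X.tpow n).symm (X.tpow n)) =
      c ^ n • X.tpowField κ n := by
  induction n with
  | zero =>
    change (unit N).symm (unit N) = (c ^ 0 • 1 : K → (H →L[ℂ] H))
    rw [unit_symm, pow_zero, one_smul]
  | succ n ih =>
    refine (comp_app_symm φ (φ.tpow n)).trans ?_
    rw [h, ih, map_smul, smul_mul_smul_comm, ← pow_succ']
    rfl

/-- The weights of the antisymmetrizers, for the statistics parameter `c = 1 / d`. -/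
theorem tpow_app_antisymm {τ : K → (H →L[ℂ] H)} (hτ : X.IsExchange τ) {c : ℝ}
    (h : φ.app X X τ = (c : ℂ) • 1) {d : ℕ} (hd : d * c = 1) (n : ℕ) (hn : n ≤ d) :
    (φ.tpow n).app (unit N) (unit N) (X.antisymm τ n) = ((d.choose n * c ^ n : ℝ) : ℂ) • 1 := by
  induction n with
  | zero =>
    rw [antisymm_zero, (φ.tpow 0).app_one]
    simp
  | succ n ih =>
    change (φ.tpow n).app (unit N) (unit N) (φ.app ((X.tpow n).tensor (unit N))
      ((X.tpow n).tensor (unit N)) (X.antisymm τ (n + 1))) = _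
    have hm : X.antisymm τ n ∈ Hom ((X.tpow n).tensor (unit N)) ((X.tpow n).tensor (unit N)) := by
      rw [tensor_unit]; exact hτ.antisymm_mem n
    have h1 := Nat.choose_succ_right_eq d n
    have h2 : (d.choose (n + 1) : ℝ) * (n + 1) = d.choose n * (d - n) := by
      rw [← Nat.cast_sub (by omega)]; exact_mod_cast h1
    have h3 : (d.choose (n + 1) * c ^ (n + 1) : ℝ) =
        ((n : ℝ) + 1)⁻¹ * (1 - n * c) * (d.choose n * c ^ n) := by
      have : (n : ℝ) + 1 ≠ 0 := by positivity
      field_simp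
      linear_combination c * c ^ n * h2 + d.choose n * c ^ n * hd
    rw [tensor_unit, hτ.app_antisymm_succ φ h n, (φ.tpow n).app_smul _ hm, ih (by omega), smul_smul,
      h3]
    push_cast
    rfl

end PositiveLeftInverse

/-- A subobject of `X^{⊗d}` defined by the antisymmetrizer, where `1 / d` is the statistics
parameter of `X`, has scalar symmetry. -/
theorem exists_determinant [Nonempty K] [Nontrivial H] (φ : PositiveLeftInverse X)
    (hκ : κ ∈ Hom X X) (hs : star κ = κ) (h1 : κ * κ = 1) {c : ℝ} (hc : 0 < c)
    (h : φ.app X X (X.symm X) = (c : ℂ) • κ) :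
    ∃ (n : ℕ) (Z : Cocycle N), ∃ w ∈ Hom Z (X.tpow (n + 1)), star w * w = 1 ∧
      (∃ z : ℂ, Z.symm Z = z • 1) ∧
      X.endo (star w) * X.symm X * X.endo w = (c : ℂ) • κ := by
  have hτ := isExchange_twistedSymm hκ hs h1
  have hφ := φ.app_twistedSymm hκ h1 h
  obtain ⟨d, hd, hne⟩ := φ.exists_dimension hτ hc hφ
  have hcc : (c : ℂ) ≠ 0 := by exact_mod_cast hc.ne'
  have hd' : (d : ℂ) * c = 1 := by exact_mod_cast hd
  have hdz : (d : ℂ) ≠ 0 := left_ne_zero_of_mul_eq_one hd'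
  obtain ⟨n, rfl⟩ : ∃ n, d = n + 1 := Nat.exists_eq_succ_of_ne_zero (by rintro rfl; simp at hdz)
  -- the antisymmetrizer following the last nonzero one vanishes by faithfulness
  have hzero : X.antisymm (X.twistedSymm κ) (n + 1 + 1) = 0 := by
    refine φ.eq_zero_of_app_star_mul_self (v := (c : ℂ)⁻¹ • κ) ?_ (hτ.antisymm_mem (n + 1 + 1)) ?_
    · rw [h, smul_mul_smul_comm, h1, mul_inv_cancel₀ hcc, one_smul]
    · rw [hτ.star_antisymm, hτ.antisymm_mul_self, hτ.app_antisymm_succ φ hφ, hd', sub_self,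
        mul_zero, zero_smul]
  obtain ⟨Z, w, hw, hw1, hw2⟩ := exists_subobject (hτ.antisymm_mem (n + 1)) (hτ.star_antisymm _)
    (hτ.antisymm_mul_self _) hne
  set A := X.antisymm (X.twistedSymm κ) (n + 1) with hA
  have hAw : A * w = w := by rw [← hw2, mul_assoc, hw1, mul_one]
  have hwA : star w * A = star w := by rw [← hw2, ← mul_assoc, hw1, one_mul]
  have hAτA : X.endo A * X.twistedSymm κ * X.endo A = (c : ℂ) • X.endo A := by
    rw [antisymm_succ, smul_eq_zero] at hzero
    have h2 := hzero.resolve_left (inv_ne_zero (by exact_mod_cast (n + 1).succ_ne_zero))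
    rw [← hA, mul_sub, sub_mul, mul_one, ← map_mul, hτ.antisymm_mul_self, mul_smul_comm,
      smul_mul_assoc, sub_eq_zero] at h2
    rw [← hA] at h2
    calc _ = ((c : ℂ) * ((n + 1 : ℕ) : ℂ)) • (X.endo A * X.twistedSymm κ * X.endo A) := by
          rw [mul_comm, hd', one_smul]
      _ = (c : ℂ) • X.endo A := by rw [← smul_smul, ← h2]
  have hwτw : X.endo (star w) * X.twistedSymm κ * X.endo w = (c : ℂ) • 1 := by
    calc _ = X.endo (star w) * (X.endo A * X.twistedSymm κ * X.endo A) * X.endo w := by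
          have e1 : X.endo (star w) = X.endo (star w) * X.endo A := by rw [← map_mul, hwA]
          have e2 : X.endo w = X.endo A * X.endo w := by rw [← map_mul, hAw]
          rw [e1, e2]
          simp only [mul_assoc, ← map_mul, hAw]
          simp only [← mul_assoc, ← map_mul, hwA]
      _ = (c : ℂ) • X.endo (star w * (A * w)) := by
          rw [hAτA]; simp only [map_mul, mul_smul_comm, smul_mul_assoc, mul_assoc]
      _ = _ := by rw [hAw, hw1, map_one]
  refine ⟨n, Z, w, hw, hw1, ?_, ?_⟩
  · have hm := φ.tpow_app_antisymm hτ hφ hd (n + 1) le_rfl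
    rw [← hA, ← hw2, Nat.choose_self, Nat.cast_one, one_mul] at hm
    have hpos : (0 : ℝ) < c ^ (n + 1) := pow_pos hc _
    refine ((φ.tpow (n + 1)).ofSubobject hw hw1 hpos hm).exists_symm_eq_smul_one ?_
    have hK := tpowField_mul_self hκ h1 (n + 1)
    have hKA := tpowField_mul_antisymm hκ hτ (n + 1)
    rw [← hA] at hKA
    have hval : ((φ.tpow (n + 1)).ofSubobject hw hw1 hpos hm).app Z Z (Z.symm Z) =
        star w * X.tpowField κ (n + 1) * w := by
      rw [PositiveLeftInverse.ofSubobject_app_symm, φ.tpow_app_symm h, mul_smul_comm,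
        smul_mul_assoc, smul_smul, Complex.ofReal_pow, inv_mul_cancel₀ (pow_ne_zero _ hcc),
        one_smul]
    rw [hval]
    generalize X.tpowField κ (n + 1) = T at *
    calc _ = star w * T * (w * star w) * T * w := by simp only [mul_assoc]
      _ = star w * (A * (T * T)) * w := by
        rw [hw2, mul_assoc (star w), hKA]; simp only [mul_assoc]
      _ = 1 := by rw [hK, mul_one, hwA, hw1]
  · have hcl : X.endo (star w) * κ = κ * X.endo (star w) := (hom_endo hκ (star_mem_hom hw).1).symm
    have hcr : κ * X.endo w = X.endo w * κ := hom_endo hκ hw.1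
    have e : X.endo (star w) * X.symm X * X.endo w = (2⁻¹ : ℂ) •
        (X.endo (star w) * X.twistedSymm κ * X.endo w +
        X.endo (star w) * X.twistedSymm κ * X.endo w * κ +
        κ * (X.endo (star w) * X.twistedSymm κ * X.endo w) -
        κ * (X.endo (star w) * X.twistedSymm κ * X.endo w) * κ) := by
      rw [symm_eq_twistedSymm hκ h1, mul_smul_comm, smul_mul_assoc]
      congr 1
      simp only [mul_add, add_mul, mul_sub, sub_mul]
      congr 1
      · congr 1
        · congr 1
          rw [mul_assoc, mul_assoc, mul_assoc, hcr]; simp only [mul_assoc]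
        · rw [← mul_assoc (X.endo _) κ, hcl]; simp only [mul_assoc]
      · rw [mul_assoc κ, ← mul_assoc (X.endo _) κ, hcl, mul_assoc, mul_assoc, mul_assoc, hcr]
        simp only [mul_assoc]
    rw [e, hwτw]
    simp only [mul_smul_comm, smul_mul_assoc, mul_one, one_mul, h1]
    module

variable {X Y : Cocycle N}

/-! ### Conjugates -/

/-- The left inverse `t ↦ m⁻¹ (q^* ⊗ 1) · (1_X ⊗ t) · (q ⊗ 1)` of `Y` implemented by an arrow
`q ∈ (I, X ⊗ Y)` with `q^* q = m > 0`. -/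
noncomputable def PositiveLeftInverse.ofArrow {q : K → (H →L[ℂ] H)}
    (hq : q ∈ Hom (unit N) (X.tensor Y)) {m : ℝ} (hm : 0 < m) (hqq : star q * q = (m : ℂ) • 1) :
    PositiveLeftInverse Y :=
  have hq' : ∀ Z, q ∈ Hom Z (X.tensor (Y.tensor Z)) := fun Z => by
    have := mem_tensor_right hq Z
    rwa [unit_tensor, tensor_assoc] at this
  { app := fun Z W t => (m⁻¹ : ℂ) • (star q * X.endo t * q)
    app_mem := fun {Z W t} ht => Submodule.smul_mem _ _
      (mul_mem_hom (mul_mem_hom (star_mem_hom (hq' W)) (X.endo_mem ht)) (hq' Z))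
    app_add := fun _ _ => by rw [map_add, mul_add, add_mul, smul_add]
    app_smul := fun c _ => by rw [map_smul, mul_smul_comm, smul_mul_assoc, smul_comm]
    app_tensor := fun _ _ => rfl
    app_whisker := fun {Z W Z' W' s t r} hs ht hr => by
      have h1 := hom_endo (star_mem_hom hq) hs.1
      have h2 := hom_endo hq hr.1
      rw [endo_unit, endo_tensor _ _ hs.1] at h1
      rw [endo_unit, endo_tensor _ _ hr.1] at h2
      rw [map_mul, map_mul, mul_smul_comm, smul_mul_assoc]
      congr 1
      calc _ = (star q * X.endo (Y.endo s)) * X.endo t * (X.endo (Y.endo r) * q) := by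
            simp only [mul_assoc]
        _ = _ := by rw [h1, ← h2]; simp only [mul_assoc]
    app_star_mul_self := fun {Z t} ht => by
      obtain ⟨u, hu, h⟩ := exists_star_mul_self (mul_mem_hom (X.endo_mem ht) (hq' Z))
      refine ⟨((Real.sqrt m : ℝ) : ℂ)⁻¹ • u, Submodule.smul_mem _ _ hu, ?_⟩
      have e : star q * X.endo (star t * t) * q = star u * u := by
        rw [← h, star_mul, ← map_star, map_mul]; simp only [mul_assoc]
      rw [e, star_smul, smul_mul_smul_comm, star_inv₀, Complex.star_def, Complex.conj_ofReal,
        ← mul_inv, ← Complex.ofReal_mul, Real.mul_self_sqrt hm.le]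
    app_one_unit := by
      rw [map_one, mul_one, hqq, smul_smul, inv_mul_cancel₀ (by exact_mod_cast hm.ne'), one_smul] }

/-- The squared norm of a nonzero arrow from the unit is a positive scalar. -/
theorem exists_star_mul_self_eq_smul_one [Nonempty K] [Nontrivial H] {q : K → (H →L[ℂ] H)}
    (hq : q ∈ Hom (unit N) Y) (hne : q ≠ 0) :
    ∃ m : ℝ, 0 < m ∧ star q * q = (m : ℂ) • 1 := by
  obtain ⟨z, hz⟩ := exists_eq_smul_one_of_mem_unit (mul_mem_hom (star_mem_hom hq) hq)
  obtain ⟨a⟩ := ‹Nonempty K›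
  have hza : star (q a) * q a = z • 1 := congrFun hz a
  obtain ⟨x, hx⟩ := exists_ne (0 : H)
  have hin : ∀ a, z * inner ℂ x x = inner ℂ (q a x) (q a x) := fun a => by
    have h1 := congrArg (fun T : H →L[ℂ] H => inner ℂ x (T x)) (congrFun hz a)
    simp only [Pi.mul_apply, Pi.star_apply, Pi.smul_apply, Pi.one_apply,
      ContinuousLinearMap.star_eq_adjoint, mul_apply_eq_comp,
      ContinuousLinearMap.adjoint_inner_right, smul_apply,
      one_apply_eq_self, inner_smul_right] at h1
    exact h1.symm
  have hx2 : (0 : ℝ) < ‖x‖ ^ 2 := by positivity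
  have hzr : z = ((‖q a x‖ ^ 2 / ‖x‖ ^ 2 : ℝ) : ℂ) := by
    have := hin a
    rw [inner_self_eq_norm_sq_to_K, inner_self_eq_norm_sq_to_K] at this
    have hxc : ((‖x‖ ^ 2 : ℝ) : ℂ) ≠ 0 := by exact_mod_cast hx2.ne'
    push_cast at hxc ⊢
    rw [eq_div_iff hxc]
    exact this
  refine ⟨_, lt_of_le_of_ne (by positivity) fun h0 => hne ?_, hzr ▸ hz⟩
  rw [hzr, ← h0, Complex.ofReal_zero, zero_smul] at hz
  exact funext fun b => CStarRing.star_mul_self_eq_zero_iff _ |>.1 (congrFun hz b)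

/-- The transpose `a ↦ (r^* ⊗ 1) · (1 ⊗ (a ⊗ 1) · r')` from `(X, X)` to `(Y, Y)` is antimultiplicative
if `r` and `r'` satisfy one of the conjugate equations. -/
theorem transpose_mul {r r' a b : K → (H →L[ℂ] H)} (hr : r ∈ Hom (unit N) (Y.tensor X))
    (hr' : r' ∈ Hom (unit N) (X.tensor Y)) (ha : a ∈ Hom X X) (hb : b ∈ Hom X X)
    (h : X.endo (star r) * r' = 1) :
    (star r * Y.endo (a * r')) * (star r * Y.endo (b * r')) = star r * Y.endo (b * a * r') := by
  have har := mul_mem_hom (mem_tensor_right ha Y) hr'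
  have hrs := star_mem_hom hr
  have hsw : ∀ {u}, Localized N u → u * star r = star r * Y.endo (X.endo u) := fun hu => by
    have := hom_endo hrs hu
    rwa [endo_unit, endo_tensor _ _ hu, eq_comm] at this
  have hu : X.endo (Y.endo (a * r')) * r' = r' * (a * r') := by
    have := hom_endo hr' har.1
    rwa [endo_unit, endo_tensor _ _ har.1, eq_comm] at this
  have hu' : X.endo (Y.endo (a * r')) * (b * r') = b * (r' * (a * r')) := by
    rw [← mul_assoc, ← hom_endo hb (Y.localized_endo har.1), mul_assoc, hu]
  have hb' : X.endo (star r) * (b * (r' * (a * r'))) = b * a * r' := by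
    rw [← mul_assoc, ← hom_endo hb hrs.1, mul_assoc, ← mul_assoc (X.endo _), h, one_mul, mul_assoc]
  calc _ = star r * (Y.endo (a * r') * star r) * Y.endo (b * r') := by simp only [mul_assoc]
    _ = (star r * star r) * Y.endo (X.endo (Y.endo (a * r')) * (b * r')) := by
      rw [hsw (Y.localized_endo har.1), map_mul Y.endo _ (b * r')]; simp only [mul_assoc]
    _ = star r * Y.endo (X.endo (star r) * (b * (r' * (a * r')))) := by
      rw [hu', hsw hrs.1, map_mul Y.endo (X.endo _), mul_assoc]
    _ = _ := by rw [hb']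

/-- For `q ∈ (I, X ⊗ Y)` and `r = ε(X, Y) q`, the value on `ε(Y, Y)` of the left inverse implemented
by `q` is one of the two sides of the conjugate equations. -/
theorem compress_symm_eq {q : K → (H →L[ℂ] H)} (hq : q ∈ Hom (unit N) (X.tensor Y)) :
    star q * X.endo (Y.symm Y) * q = star (X.symm Y * q) * Y.endo q := by
  have h1 : X.symm Y * X.endo (Y.symm Y) * q = Y.endo q := by
    have := symm_mul_of_mem hq Y
    rwa [unit_symm, mul_one, symm_tensor_left] at this
  rw [← h1, star_mul, star_symm]
  calc _ = star q * (Y.symm X * X.symm Y) * X.endo (Y.symm Y) * q := by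
        rw [symm_mul_symm, mul_one]
    _ = _ := by simp only [mul_assoc]

/-- If an arrow `s ∈ (I, X ⊗ Y)` implements a self-adjoint statistics parameter `ζ` of `X` with
positive scalar square, then `X` has a conjugate with finite statistics. It is the subobject of `Y`
cut out by the projection `e = (r^* ⊗ 1) · (1 ⊗ r')`, where `r = ε(X, Y) s` and `r' = c⁻¹ ζ s` satisfy
one of the conjugate equations. -/
theorem exists_conjugate_of_arrow [Nonempty K] [Nontrivial H] {s ζ : K → (H →L[ℂ] H)}
    (hs : s ∈ Hom (unit N) (X.tensor Y)) (hζ : ζ ∈ Hom X X) (hζs : star ζ = ζ) {c : ℝ} (hc : 0 < c)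
    (hζ2 : ζ * ζ = (c : ℂ) • 1) (h : X.endo (star s) * X.symm X * X.endo s = ζ) :
    ∃ X' : Cocycle N, X'.HasFiniteStatistics ∧ X.IsConjugate X' := by
  have hcc : (c : ℂ) ≠ 0 := by exact_mod_cast hc.ne'
  have hss := star_mem_hom hs
  obtain ⟨r, hr_def⟩ : ∃ r, r = X.symm Y * s := ⟨_, rfl⟩
  have hr : r ∈ Hom (unit N) (Y.tensor X) := hr_def ▸ mul_mem_hom (X.symm_mem_hom Y) hs
  have hrs := star_mem_hom hr
  have hζY := mem_tensor_right hζ Y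
  have hζs' := mul_mem_hom hζY hs
  obtain ⟨r', hr'_def⟩ : ∃ r', r' = (c : ℂ)⁻¹ • (ζ * s) := ⟨_, rfl⟩
  have hr' : r' ∈ Hom (unit N) (X.tensor Y) := hr'_def ▸ Submodule.smul_mem _ _ hζs'
  have hsr : star s * X.endo r = ζ := by
    have h1 := symm_mul_of_mem hss X
    rw [unit_symm, one_mul, symm_tensor_left] at h1
    rw [h1, hr_def, map_mul, ← h]
    calc _ = X.endo (star s) * X.symm X * (X.endo (Y.symm X * X.symm Y)) * X.endo s := by
          rw [map_mul]; simp only [mul_assoc]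
      _ = _ := by rw [symm_mul_symm, map_one, mul_one]
  have hz1 : star r' * X.endo r = 1 := by
    rw [hr'_def, star_smul, star_mul, hζs, smul_mul_assoc, mul_assoc, hom_endo hζ hr.1, ← mul_assoc,
      hsr, hζ2, smul_smul, star_inv₀, Complex.star_def, Complex.conj_ofReal, inv_mul_cancel₀ hcc,
      one_smul]
  have hz2 : X.endo (star r) * r' = 1 := by
    have := congrArg star hz1
    rwa [star_mul, star_star, ← map_star, star_one] at this
  -- the projection onto the conjugate
  obtain ⟨e, he_def⟩ : ∃ e, e = star r * Y.endo r' := ⟨_, rfl⟩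
  have he : e ∈ Hom Y Y := by
    rw [he_def]
    have h1 := Y.endo_mem hr'
    have h2 := mem_tensor_right hrs Y
    rw [tensor_unit, ← tensor_assoc] at h1
    rw [unit_tensor] at h2
    exact mul_mem_hom h2 h1
  have he_star : star e = e := by
    have h1 : star r * Y.endo (ζ * s) = star s * ζ * X.endo (Y.symm Y) * s := by
      have h2 : Y.symm X * Y.endo ζ = ζ * Y.symm X := symm_mul_endo_of_mem Y hζ
      have h3 := symm_mul_of_mem hs Y
      rw [unit_symm, mul_one, symm_tensor_left] at h3
      rw [hr_def, star_mul, star_symm, map_mul, ← mul_assoc, mul_assoc (star s), h2, ← h3]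
      calc _ = star s * ζ * (Y.symm X * X.symm Y) * X.endo (Y.symm Y) * s := by
            simp only [mul_assoc]
        _ = _ := by rw [symm_mul_symm, mul_one]
    have h4 : e = (c : ℂ)⁻¹ • (star s * (ζ * X.endo (Y.symm Y)) * s) := by
      rw [he_def, hr'_def, map_smul, mul_smul_comm, h1]; simp only [mul_assoc]
    rw [h4, star_smul, star_mul, star_mul, star_mul, star_star, hζs, ← map_star, star_symm,
      ← hom_endo hζ (localized_symm Y Y), star_inv₀, Complex.star_def, Complex.conj_ofReal,
      mul_assoc (star s)]
  have he_mul : e * e = e := by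
    have := transpose_mul hr hr' (one_mem_hom X) (one_mem_hom X) hz2
    rwa [one_mul, one_mul, one_mul, ← he_def] at this
  have her : e * r = r := by
    have h1 := hom_endo hr hr.1
    rw [endo_unit, endo_tensor _ _ hr.1] at h1
    rw [← he_star, he_def, star_mul, star_star, ← map_star, mul_assoc, h1, ← mul_assoc, ← map_mul,
      hz1, map_one, one_mul]
  have hne : e ≠ 0 := by
    rintro rfl
    rw [zero_mul] at her
    rw [← her, map_zero, mul_zero] at hz1
    exact zero_ne_one hz1
  obtain ⟨X', v, hv, hv1, hv2⟩ := exists_subobject he he_star he_mul hne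
  have hvs := star_mem_hom hv
  obtain ⟨p, hp_def⟩ : ∃ p, p = star v * r := ⟨_, rfl⟩
  obtain ⟨p', hp'_def⟩ : ∃ p', p' = X.endo (star v) * r' := ⟨_, rfl⟩
  have hp : p ∈ Hom (unit N) (X'.tensor X) := hp_def ▸ mul_mem_hom (mem_tensor_right hvs X) hr
  have hp' : p' ∈ Hom (unit N) (X.tensor X') := hp'_def ▸ mul_mem_hom (X.endo_mem hvs) hr'
  have hc1 : star p' * X.endo p = 1 := by
    calc _ = star r' * X.endo ((v * star v) * r) := by
          rw [hp'_def, hp_def, star_mul, ← map_star, star_star, mul_assoc, ← map_mul, mul_assoc]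
      _ = 1 := by rw [hv2, her, hz1]
  have hc2 : star p * X'.endo p' = 1 := by
    have h1 := hom_endo hv hp'.1
    have h2 := hom_endo hrs hvs.1
    rw [endo_unit, endo_tensor _ _ hvs.1] at h2
    calc _ = star r * (v * X'.endo p') := by rw [hp_def, star_mul, star_star, mul_assoc]
      _ = (star r * Y.endo (X.endo (star v))) * Y.endo r' * v := by
          rw [h1, hp'_def, map_mul]; simp only [mul_assoc]
      _ = star v * e * v := by rw [h2, he_def]; simp only [mul_assoc]
      _ = (star v * v) * (star v * v) := by rw [← hv2]; simp only [mul_assoc]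
      _ = 1 := by rw [hv1, one_mul]
  have hc3 : X.endo (star p) * p' = 1 := by
    have := congrArg star hc1
    rwa [star_mul, star_star, ← map_star, star_one] at this
  refine ⟨X', ?_, p, hp, p', hp', ?_, ?_⟩
  · -- the left inverse of `X'` is implemented by `ζ p'`
    have hq : ζ * p' ∈ Hom (unit N) (X.tensor X') := mul_mem_hom (mem_tensor_right hζ X') hp'
    have hζp : ζ * (ζ * p') = (c : ℂ) • p' := by
      rw [← mul_assoc, hζ2, smul_mul_assoc, one_mul]
    have hqne : ζ * p' ≠ 0 := by
      intro h0
      rw [h0, mul_zero] at hζp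
      have hp0 := (smul_eq_zero.1 hζp.symm).resolve_left hcc
      rw [hp0, mul_zero] at hc3
      exact zero_ne_one hc3
    obtain ⟨m, hm, hqq⟩ := exists_star_mul_self_eq_smul_one hq hqne
    have hpq : X.symm X' * (ζ * p') = p := by
      have h1 : ζ * r' = s := by
        rw [hr'_def, mul_smul_comm, ← mul_assoc, hζ2, smul_mul_assoc, one_mul, smul_smul,
          inv_mul_cancel₀ hcc, one_smul]
      rw [hp'_def, ← mul_assoc ζ, hom_endo hζ hvs.1, mul_assoc, h1, ← mul_assoc,
        symm_mul_endo_of_mem X hvs, mul_assoc, ← hr_def, hp_def]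
    have hval : star (ζ * p') * X.endo (X'.symm X') * (ζ * p') = star p * X'.endo (ζ * p') := by
      rw [compress_symm_eq hq, hpq]
    have hsq : (star p * X'.endo (ζ * p')) * (star p * X'.endo (ζ * p')) = (c : ℂ) • 1 := by
      rw [transpose_mul hp hp' hζ hζ hc3, hζ2, smul_mul_assoc, one_mul, map_smul, mul_smul_comm, hc2]
    refine (PositiveLeftInverse.ofArrow hq hm hqq).hasFiniteStatistics (c := m⁻¹ * m⁻¹ * c)
      (by positivity) ?_
    change ((m⁻¹ : ℂ) • (star (ζ * p') * X.endo (X'.symm X') * (ζ * p'))) *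
      ((m⁻¹ : ℂ) • (star (ζ * p') * X.endo (X'.symm X') * (ζ * p'))) = _
    rw [hval, smul_mul_smul_comm, hsq, smul_smul]
    push_cast
    rfl
  · simpa [tensorField_eq] using hc1
  · simpa [tensorField_eq] using hc2

/-- Every cocycle with finite statistics has a conjugate with finite statistics, on a nontrivial
Hilbert space. -/
theorem HasFiniteStatistics.exists_conjugate [Nonempty K] [Nontrivial H]
    (hX : X.HasFiniteStatistics) : ∃ X' : Cocycle N, X'.HasFiniteStatistics ∧ X.IsConjugate X' := by
  obtain ⟨L, hL⟩ := hX
  obtain ⟨c, hc, hsq⟩ := hL.exists_sq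
  set φ := hL.toPositive with hφ
  have hval : φ.app X X (X.symm X) = L.φ X X ⟨X.symm X, symm_mem_hom X X⟩ :=
    dif_pos (symm_mem_hom X X)
  rw [← hval, sq] at hsq
  have hpos : 0 < Real.sqrt c := Real.sqrt_pos.2 hc
  have hne : ((Real.sqrt c : ℝ) : ℂ) ≠ 0 := by exact_mod_cast hpos.ne'
  have hcc : ((Real.sqrt c : ℝ) : ℂ) * (Real.sqrt c : ℝ) = c := by
    rw [← Complex.ofReal_mul, Real.mul_self_sqrt hc.le]
  obtain ⟨κ, hκ_def⟩ : ∃ κ, κ = ((Real.sqrt c : ℝ) : ℂ)⁻¹ • φ.app X X (X.symm X) := ⟨_, rfl⟩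
  have hκ : κ ∈ Hom X X := hκ_def ▸ Submodule.smul_mem _ _ (φ.app_mem (symm_mem_hom X X))
  have hκs : star κ = κ := by
    rw [hκ_def, star_smul, φ.star_app_symm, star_inv₀, Complex.star_def, Complex.conj_ofReal]
  have hκ1 : κ * κ = 1 := by
    rw [hκ_def, smul_mul_smul_comm, hsq, smul_smul, ← mul_inv, hcc, inv_mul_cancel₀, one_smul]
    exact_mod_cast hc.ne'
  have happ : φ.app X X (X.symm X) = ((Real.sqrt c : ℝ) : ℂ) • κ := by
    rw [hκ_def, smul_smul, mul_inv_cancel₀ hne, one_smul]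
  obtain ⟨n, Z, w, hw, hw1, ⟨z, hz⟩, hww⟩ := exists_determinant φ hκ hκs hκ1 hpos happ
  obtain ⟨Z', hZ'⟩ := exists_tensor_eq_unit hz
  have hw' : w ∈ Hom (unit N) (X.tensor ((X.tpow n).tensor Z')) := by
    have := mem_tensor_right hw Z'
    rw [hZ'] at this
    exact tensor_assoc X (X.tpow n) Z' ▸ this
  refine exists_conjugate_of_arrow hw' (Submodule.smul_mem _ ((Real.sqrt c : ℝ) : ℂ) hκ) ?_ hc ?_ hww
  · rw [star_smul, hκs, Complex.star_def, Complex.conj_ofReal]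
  · rw [smul_mul_smul_comm, hκ1, hcc]

end Cocycle

end CovariantSectors

theorem mainTheorem1 {K P : Type*} [PartialOrder K] [Nonempty K] [Group P] [MulAction P K]
    {H : Type*} [NormedAddCommGroup H] [InnerProductSpace ℂ H] [CompleteSpace H]
    (S : CovariantSectors.IndexSet K P) (N : CovariantSectors.ObservableNet S H)
    (X : CovariantSectors.Cocycle N) (hX : X.HasFiniteStatistics) :
    ∃ X' : CovariantSectors.Cocycle N, X'.HasFiniteStatistics ∧ X.IsConjugate X' := by
  rcases subsingleton_or_nontrivial H with hH | hH
  · -- on the zero Hilbert space all fields coincide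
    exact ⟨X, hX, 0, zero_mem _, 0, zero_mem _, Subsingleton.elim _ _, Subsingleton.elim _ _⟩
  · exact hX.exists_conjugate
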